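/- **Setting.** Let $n\ge 0$, let $a=\mathrm{diag}(a_1,\dots,a_n)\in u(n)$ (so every $a_k$ is purely imaginary), let $b\in u(n)$ be of the form $b=p(a)$ for some polynomial $p\in\mathbb C[X]$, and let $j\ge 1$ be an integer. Put $u(n)_a=\{z\in u(n): [a,z]=0\}$ and let $u(n)_a^\perp=\{y\in u(n): \mathrm{tr}(zy)=0 \text{ for all } z\in u(n)_a\}$. *The flow.* For $u$ in the Schwartz class $\mathcal S(\mathbb R,u(n)_a^\perp)$ let $m\sim I+m_1(x)\lambda^{-1}+m_2(x)\lambda^{-2}+\cdots$ be the expansion at $\lambda=\infty$ of its reduced wave function, that is, the unique formal series with $m_0=I$, $[a,m_{k+1}]+(m_k)_x=m_k u$ for $k\ge 0$ (equivalently $\psi=e^{a\lambda x}m$ satisfies $\psi_x=\psi(a\lambda+u)$), and $\lim_{x\to-\infty}m_k(x)=0$ for $k\ge 1$. Let $Q_{b,k}(u)$ be the coefficient of $\lambda^{-k}$ in $m^{-1}bm$. Let $\mathcal M_{a,b,j}$ be the set of smooth maps $u:\mathbb R^2\to u(n)_a^\perp$, $(x,t)\mapsto u(x,t)$, such that $u(\cdot,t)$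 is in the Schwartz class for every $t\in\mathbb R$ and $$u_t=(Q_{b,j}(u))_x+[u,Q_{b,j}(u)].$$ A *trivialization* of $u\in\mathcal M_{a,b,j}$ (normalized at $(0,0)$) is a map $E(x,t,\lambda)$, $(x,t)\in\mathbb R^2$, $\lambda\in\mathbb C$, with values in the complex $n\times n$ matrices and $$E_x=E(a\lambda+u),\qquad E_t=E\bigl(b\lambda^j+Q_{b,1}(u)\lambda^{j-1}+\cdots+Q_{b,j}(u)\bigr),\qquad E(0,0,\lambda)=I.$$ *The groups.* $G_+$ is the group of holomorphic maps $f:\mathbb C\to GL(n,\mathbb C)$ with $f(\bar\lambda)^*f(\lambda)=I$. $G_-^m$ is the group of rational maps $g$ of $\lambda$ into $GL(n,\mathbb C)$ (matrices of rational functions) with $g(\infty)=I$ and $g(\bar\lambda)^*g(\lambda)=I$. **Theorem.** Every $u\in\mathcal M_{a,b,j}$ has exactly one trivialization. For every $g\in G_-^m$ and every $u\in\mathcal M_{a,b,j}$ with trivialization $E$, writing $E(x,t)=E(x,t,\cdot)$: 1. for every $(x,t)\in\mathbb R^2$ the product $gE(x,t)$ factors uniquely as $$gE(x,t)=\tilde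 E(x,t)\,\tilde g(x,t),\qquad \tilde E(x,t)\in G_+,\quad \tilde g(x,t)\in G_-^m$$ (an identity of meromorphic functions of $\lambda$), and $\tilde E(0,0)=I$; 2. $\tilde E^{-1}\tilde E_x=a\lambda+\tilde u(x,t)$ for some $\tilde u\in\mathcal M_{a,b,j}$; 3. $g*u=\tilde u$ defines an action of the group $G_-^m$ on the set $\mathcal M_{a,b,j}$, i.e. $I*u=u$ and $(gh)*u=g*(h*u)$ for all $g,h\in G_-^m$ and $u\in\mathcal M_{a,b,j}$; 4. $\tilde E$ is the trivialization of $\tilde u$. -/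

import Mathlib

open Filter Topology MeasureTheory
open scoped Matrix ContDiff SchwartzMap ComplexConjugate

noncomputable section

namespace UnHierarchy

/-- Complex `n × n` matrices, `gl(n, ℂ)`. -/
abbrev Mat (n : ℕ) : Type := Matrix (Fin n) (Fin n) ℂ

variable {n : ℕ}

/-! ### Calculus of matrix-valued functions of a real variable, entry by entry -/

/-- The matrix-valued function `F` has derivative `F'` at `x`. -/
def HasMatDerivAt (F : ℝ → Mat n) (F' : Mat n) (x : ℝ) : Prop :=
  ∀ i j, HasDerivAt (fun y => F y i j) (F' i j) x

/-- The derivative of a matrix-valued function. -/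
def matDeriv (F : ℝ → Mat n) (x : ℝ) : Mat n :=
  Matrix.of fun i j => deriv (fun y => F y i j) x

/-- `F` lies in the Schwartz class. -/
def IsSchwartz (F : ℝ → Mat n) : Prop :=
  ∀ i j, ∃ f : 𝓢(ℝ, ℂ), ∀ x, f x = F x i j

/-! ### The phase space -/

/-- The orthogonal complement `u(n)_a^⊥`, with respect to the trace form, of the centralizer
`u(n)_a = {z ∈ u(n) | [a, z] = 0}` of `a = diag(a₁, …, aₙ)` in `u(n)`. -/
def centralizerPerp (a : Fin n → ℂ) : Set (Mat n) :=
  {y | yᴴ = -y ∧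
    ∀ z : Mat n, zᴴ = -z → Matrix.diagonal a * z = z * Matrix.diagonal a → (z * y).trace = 0}

/-! ### The differential operators `Q_{b,k}`

A reduced wave function `m(x, λ)` of `u` has an expansion
`m ~ I + m₁(x) λ⁻¹ + m₂(x) λ⁻² + ⋯` at `λ = ∞`, tends to `I` as `x → -∞`, and
`ψ = e^{aλx} m` satisfies `ψ_x = ψ (aλ + u)`. On coefficients this reads
`[a, m_{k+1}] + (m_k)_x = m_k u`, and `m_k → 0` as `x → -∞` for `k ≥ 1`. The entries `(i, j)` with
`a_i ≠ a_j` of this equation give the corresponding entries of `m_{k+1}`; the entries with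
`a_i = a_j` of the next equation give the derivative of the remaining entries of `m_{k+1}`,
which are then found by integration from `-∞`. -/

/-- The entries `(i, j)` with `a_i ≠ a_j` of `m_{k+1}`, computed from `m = m_k`: the solution `P` of
`[a, P] = m u - m_x` on these entries, extended by `0`. -/
def waveOff (a : Fin n → ℂ) (u m : ℝ → Mat n) (x : ℝ) : Mat n :=
  Matrix.of fun i j =>
    if a i = a j then 0 else ((m x * u x) i j - matDeriv m x i j) / (a i - a j)

/-- The coefficients `m_k(x)` of the expansion of the reduced wave function of `u` at `λ = ∞`. -/
def waveCoeff (a : Fin n → ℂ) (u : ℝ → Mat n) : ℕ → ℝ → Mat n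
  | 0 => fun _ => 1
  | k + 1 => fun x =>
      waveOff a u (waveCoeff a u k) x +
        Matrix.of fun i j =>
          if a i = a j then
            ∫ y in Set.Iic x, (waveOff a u (waveCoeff a u k) y * u y) i j
          else 0

/-- The expansion of the reduced wave function at the point `x`, as a power series in `λ⁻¹`. -/
def waveSeries (a : Fin n → ℂ) (u : ℝ → Mat n) (x : ℝ) : PowerSeries (Mat n) :=
  PowerSeries.mk fun k => waveCoeff a u k x

/-- `Q_{b,k}(u)(x)`: the coefficient of `λ^{-k}` in the expansion of `m⁻¹ b m` at `λ = ∞`. -/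
def Q (a : Fin n → ℂ) (b : Mat n) (u : ℝ → Mat n) (k : ℕ) (x : ℝ) : Mat n :=
  PowerSeries.coeff k
    (PowerSeries.invOfUnit (waveSeries a u x) 1 * PowerSeries.C b * waveSeries a u x)

/-! ### Solutions of the `j`-th flow and their trivializations -/

/-- `u(x, t)` is a smooth solution on `ℝ²` of the `j`-th flow
`u_t = (Q_{b,j}(u))_x + [u, Q_{b,j}(u)]` defined by `b` in the `u(n)`-hierarchy on
the Schwartz class `𝓢(ℝ, u(n)_a^⊥)`. -/
structure IsSolution (a : Fin n → ℂ) (b : Mat n) (j : ℕ) (u : ℝ → ℝ → Mat n) : Prop where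
  smooth : ∀ k l, ContDiff ℝ ∞ (fun p : ℝ × ℝ => u p.1 p.2 k l)
  mem_perp : ∀ x t, u x t ∈ centralizerPerp a
  schwartz : ∀ t, IsSchwartz (fun x => u x t)
  flow : ∀ x t, HasMatDerivAt (fun s => u x s)
    (matDeriv (Q a b (fun y => u y t) j) x +
      (u x t * Q a b (fun y => u y t) j x - Q a b (fun y => u y t) j x * u x t)) t

/-- The space `M_{a,b,j}` of solutions of the `j`-th flow. -/
def solutionSpace (a : Fin n → ℂ) (b : Mat n) (j : ℕ) : Set (ℝ → ℝ → Mat n) :=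
  {u | IsSolution a b j u}

/-- `E(x, t, λ)` is a trivialization of `u` normalized at `(0, 0)`. -/
structure IsTrivialization (a : Fin n → ℂ) (b : Mat n) (j : ℕ) (u : ℝ → ℝ → Mat n)
    (E : ℝ → ℝ → ℂ → Mat n) : Prop where
  deriv_x : ∀ x t l, HasMatDerivAt (fun y => E y t l)
    (E x t l * (l • Matrix.diagonal a + u x t)) x
  deriv_t : ∀ x t l, HasMatDerivAt (fun s => E x s l)
    (E x t l * ∑ k ∈ Finset.range (j + 1), l ^ (j - k) • Q a b (fun y => u y t) k x) t
  base : ∀ l, E 0 0 l = 1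

/-! ### The loop groups -/

/-- `f ∈ G_+`: `f` is a holomorphic map from `ℂ` to `GL(n, ℂ)` with `f(λ̄)* f(λ) = I`
(which contains the invertibility of `f(λ)`). -/
structure IsGPlus (f : ℂ → Mat n) : Prop where
  holo : ∀ i j, Differentiable ℂ (fun l => f l i j)
  reality : ∀ l, (f (conj l))ᴴ * f l = 1

/-- The value at `λ` of a matrix of rational functions (meaningful off the finite set of poles). -/
def evalAt (g : Matrix (Fin n) (Fin n) (RatFunc ℂ)) (l : ℂ) : Mat n :=
  g.map (RatFunc.eval (RingHom.id ℂ) l)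

theorem eventually_denom_ne_zero (r : RatFunc ℂ) :
    ∀ᶠ l in cofinite, Polynomial.eval₂ (RingHom.id ℂ) l r.denom ≠ 0 := by
  have h : {l : ℂ | r.denom.IsRoot l}.Finite := Polynomial.finite_setOfPred_isRoot r.denom_ne_zero
  filter_upwards [h.eventually_cofinite_notMem] with l hl h0
  exact hl h0

theorem eventually_eval_sum {ι : Type} (s : Finset ι) (f : ι → RatFunc ℂ) :
    ∀ᶠ l in cofinite, RatFunc.eval (RingHom.id ℂ) l (∑ i ∈ s, f i) =
      ∑ i ∈ s, RatFunc.eval (RingHom.id ℂ) l (f i) := by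
  classical
  induction s using Finset.induction_on with
  | empty => simp
  | insert i s hi ih =>
    filter_upwards [ih, eventually_denom_ne_zero (f i),
      eventually_denom_ne_zero (∑ i ∈ s, f i)] with l h1 h2 h3
    rw [Finset.sum_insert hi, Finset.sum_insert hi, RatFunc.eval_add _ _ h2 h3, h1]

theorem eventually_evalAt_mul (g h : Matrix (Fin n) (Fin n) (RatFunc ℂ)) :
    ∀ᶠ l in cofinite, evalAt (g * h) l = evalAt g l * evalAt h l := by
  have h1 : ∀ᶠ l in cofinite, ∀ i j,
      RatFunc.eval (RingHom.id ℂ) l (∑ k, g i k * h k j) =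
      ∑ k, RatFunc.eval (RingHom.id ℂ) l (g i k * h k j) :=
    eventually_all.2 fun i => eventually_all.2 fun j => eventually_eval_sum _ _
  have h2 : ∀ᶠ l in cofinite, ∀ i j,
      Polynomial.eval₂ (RingHom.id ℂ) l (g i j).denom ≠ 0 :=
    eventually_all.2 fun i => eventually_all.2 fun j => eventually_denom_ne_zero _
  have h3 : ∀ᶠ l in cofinite, ∀ i j,
      Polynomial.eval₂ (RingHom.id ℂ) l (h i j).denom ≠ 0 :=
    eventually_all.2 fun i => eventually_all.2 fun j => eventually_denom_ne_zero _
  filter_upwards [h1, h2, h3] with l h1 h2 h3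
  ext i j
  simp only [evalAt, Matrix.map_apply, Matrix.mul_apply]
  rw [h1]
  exact Finset.sum_congr rfl fun k _ => RatFunc.eval_mul _ _ (h2 i k) (h3 k j)

theorem evalAt_one (l : ℂ) : evalAt (1 : Matrix (Fin n) (Fin n) (RatFunc ℂ)) l = 1 :=
  Matrix.map_one _ (RatFunc.eval_zero _ _) (RatFunc.eval_one _ _)

theorem tendsto_conj_cofinite : Tendsto (fun l : ℂ => conj l) cofinite cofinite :=
  (star_injective (R := ℂ)).tendsto_cofinite

/-- The group `G_-^m` of rational maps `g` with values in `GL(n, ℂ)` such that `g(∞) = I` and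
`g(λ̄)* g(λ) = I`. Its elements are matrices of rational functions of `λ`, and the last identity is
one between rational functions, that is, it holds for all but finitely many `λ`. -/
def GMinus (n : ℕ) : Subgroup (Matrix (Fin n) (Fin n) (RatFunc ℂ))ˣ where
  carrier := {g | (∀ᶠ l in cofinite, (evalAt g.val (conj l))ᴴ * evalAt g.val l = 1) ∧
    Tendsto (evalAt g.val) (cocompact ℂ) (𝓝 1)}
  one_mem' := by
    refine ⟨Eventually.of_forall fun l => ?_, ?_⟩
    · simp [evalAt_one]
    · exact tendsto_const_nhds.congr fun l => by simp [evalAt_one]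
  mul_mem' := by
    rintro g h ⟨hg, hg'⟩ ⟨hh, hh'⟩
    have hm := eventually_evalAt_mul g.val h.val
    refine ⟨?_, ?_⟩
    · filter_upwards [hg, hh, hm, tendsto_conj_cofinite.eventually hm] with l h1 h2 h3 h4
      rw [Units.val_mul, h3, h4, Matrix.conjTranspose_mul, Matrix.mul_assoc,
        ← Matrix.mul_assoc _ (evalAt g.val l), h1, Matrix.one_mul, h2]
    · have h1 := hg'.mul hh'
      rw [one_mul] at h1
      refine h1.congr' ?_
      filter_upwards [cocompact_le_cofinite hm] with l hl
      exact hl.symm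
  inv_mem' := by
    rintro g ⟨hg, hg'⟩
    have hm := eventually_evalAt_mul g.val g.inv
    rw [g.val_inv] at hm
    have key : ∀ᶠ l in cofinite, evalAt g.inv l = (evalAt g.val (conj l))ᴴ := by
      filter_upwards [hg, hm] with l h1 h2
      rw [evalAt_one] at h2
      calc evalAt g.inv l
          = ((evalAt g.val (conj l))ᴴ * evalAt g.val l) * evalAt g.inv l := by
            rw [h1, Matrix.one_mul]
        _ = _ := by rw [Matrix.mul_assoc, ← h2, Matrix.mul_one]
    refine ⟨?_, ?_⟩
    · filter_upwards [hg, key, tendsto_conj_cofinite.eventually key] with l h1 h2 h3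
      change (evalAt g.inv (conj l))ᴴ * evalAt g.inv l = 1
      rw [h2, h3, Complex.conj_conj, Matrix.conjTranspose_conjTranspose]
      exact mul_eq_one_comm.1 h1
    · have hc : Tendsto (fun l : ℂ => conj l) (cocompact ℂ) (cocompact ℂ) :=
        Complex.conjCLE.toHomeomorph.isClosedEmbedding.tendsto_cocompact
      have h1 : Tendsto (fun l => (evalAt g.val (conj l))ᴴ) (cocompact ℂ) (𝓝 (1 : Mat n)ᴴ) :=
        (Continuous.tendsto (by fun_prop) (1 : Mat n)).comp (hg'.comp hc)
      rw [Matrix.conjTranspose_one] at h1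
      refine h1.congr' ?_
      filter_upwards [cocompact_le_cofinite key] with l hl
      exact hl.symm

/-- `g f = f' g'` in `G_+ × G_-^m`: the right-hand side is a factorization of the product of `g` and
the holomorphic map `f`; the identity is one between meromorphic functions of `λ` with finitely many
poles. -/
def IsFactorization (g : GMinus n) (f f' : ℂ → Mat n) (g' : GMinus n) : Prop :=
  IsGPlus f' ∧
    ∀ᶠ l in cofinite, evalAt g.1.val l * f l = f' l * evalAt g'.1.val l

end UnHierarchy

end

/-! Everything is reduced to one Darboux step. By `GMinus.induction`, G_-^m is generated by the
simple elements (λ + S)/(λ - z̄), where λ + S = (λ - z)π + (λ - z̄)(1 - π), z is not real and π is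
the orthogonal projection onto a line ℂv. For such an element the factorization is explicit: π is
replaced by the projection onto the line of w(x,t) = E(x,t,z)⁻¹v, and the scalar 1/(λ - z̄) cancels.
It remains to see that u' = u + [S, a] is again a solution and that λ + S carries its connection to
that of u (`IsSolution.exists_darboux`).

Decay. The diagonal entries of π satisfy a replicator equation perturbed by rapidly decreasing terms
(`replicator_decay`). Its mean is almost monotone, hence converges, and products q_k q_l with a_k ≠
a_l decay rapidly. As |π_kl|² = q_k q_l for rank one, [S, a] decays, and S_x = S u - u' S bootstraps
the derivatives (`isSchwartz_darboux`).

Flow. The wave function m is nonlocal in u, but the series m⁻¹ e m, with e a spectral projection of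
a, is not. It is the only idempotent series with constant term e that commutes with ∂ + aλ + u
(`IsLaxProjection.unique`): commutation gives the entries with a_i ≠ a_j, idempotency the others,
without integration. Conjugation by 1 + Sλ⁻¹ therefore takes the series of u to those of u'. Since b
is a combination of the projections e, this intertwines the polynomials B, B' = bλ^j + ⋯ + Q_{b,j}
of u and u' up to the constant remainder Q_{b,j+1}(u) - Q_{b,j+1}(u') (`timeOp_darboux`). Evaluation
at λ = z and λ = z̄ identifies this remainder with -S_t. The flow can be written u_t = [Q_{b,j+1},
a], so u' is a solution.

Trivializations exist because the flow equation makes the connection flat: parallel transport along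
the t-axis and then along horizontal lines solves both equations.

Group law. An element of G_+ ∩ G_-^m is entire with limit I at infinity, hence I by Liouville.
Factorizations are therefore unique, u' depends on g and u only, and since factorizations compose,
dressing by products of simple elements defines an action. -/

noncomputable section

namespace UnHierarchy

variable {n : ℕ}

/-! ### Calculus of matrix-valued functions -/

namespace HasMatDerivAt

variable {F G : ℝ → Mat n} {F' G' : Mat n} {x : ℝ}

theorem const (M : Mat n) (x : ℝ) : HasMatDerivAt (fun _ => M) 0 x := fun i j => by
  simpa using! hasDerivAt_const x (M i j)

theorem add (hF : HasMatDerivAt F F' x) (hG : HasMatDerivAt G G' x) :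
    HasMatDerivAt (fun y => F y + G y) (F' + G') x := fun i j => (hF i j).add (hG i j)

theorem sub (hF : HasMatDerivAt F F' x) (hG : HasMatDerivAt G G' x) :
    HasMatDerivAt (fun y => F y - G y) (F' - G') x := fun i j => (hF i j).sub (hG i j)

theorem mul (hF : HasMatDerivAt F F' x) (hG : HasMatDerivAt G G' x) :
    HasMatDerivAt (fun y => F y * G y) (F' * G x + F x * G') x := fun i j => by
  simp only [Matrix.mul_apply, Matrix.add_apply, ← Finset.sum_add_distrib]
  exact HasDerivAt.fun_sum fun k _ => (hF i k).mul (hG k j)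

theorem const_mul (M : Mat n) (hF : HasMatDerivAt F F' x) :
    HasMatDerivAt (fun y => M * F y) (M * F') x := by
  simpa using (const M x).mul hF

theorem mul_const (hF : HasMatDerivAt F F' x) (M : Mat n) :
    HasMatDerivAt (fun y => F y * M) (F' * M) x := by
  simpa using hF.mul (const M x)

theorem const_smul (c : ℂ) (hF : HasMatDerivAt F F' x) :
    HasMatDerivAt (fun y => c • F y) (c • F') x := fun i j => (hF i j).const_mul c

theorem sum {ι : Type*} {s : Finset ι} {F : ι → ℝ → Mat n} {F' : ι → Mat n}
    (h : ∀ k ∈ s, HasMatDerivAt (F k) (F' k) x) :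
    HasMatDerivAt (fun y => ∑ k ∈ s, F k y) (∑ k ∈ s, F' k) x := fun i j => by
  simp only [Matrix.sum_apply]
  exact HasDerivAt.fun_sum fun k hk => h k hk i j

theorem conjTranspose (hF : HasMatDerivAt F F' x) :
    HasMatDerivAt (fun y => (F y)ᴴ) F'ᴴ x := fun i j => (hF j i).star

theorem transpose (hF : HasMatDerivAt F F' x) :
    HasMatDerivAt (fun y => (F y)ᵀ) F'ᵀ x := fun i j => hF j i

theorem unique (hF : HasMatDerivAt F F' x) (hG : HasMatDerivAt F G' x) : F' = G' := by
  ext i j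
  exact (hF i j).unique (hG i j)

theorem matDeriv (hF : HasMatDerivAt F F' x) : matDeriv F x = F' := by
  ext i j
  exact (hF i j).deriv

theorem congr_deriv (hF : HasMatDerivAt F F' x) (h : F' = G') : HasMatDerivAt F G' x := h ▸ hF

theorem eq_of_zero {F : ℝ → Mat n} (hF : ∀ x, HasMatDerivAt F 0 x) (x y : ℝ) : F x = F y := by
  ext i j
  exact is_const_of_deriv_eq_zero (fun z => (hF z i j).differentiableAt)
    (fun z => (hF z i j).deriv) x y

end HasMatDerivAt

/-! ### Linear differential equations with a parameter -/

section LinearODE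

variable {P 𝔸 : Type*} [NormedRing 𝔸] [NormedAlgebra ℝ 𝔸]

/-- The terms of the Dyson series of the equation `Y' = Y A`. -/
def dysonTerm (A : ℝ → P → 𝔸) : ℕ → ℝ → P → 𝔸
  | 0 => fun _ _ => 1
  | k + 1 => fun x p => ∫ s in (0 : ℝ)..x, dysonTerm A k s p * A s p

/-- The Dyson series: the solution of `Y' = Y A`, `Y(0) = 1`. -/
def dyson (A : ℝ → P → 𝔸) (x : ℝ) (p : P) : 𝔸 := ∑' k, dysonTerm A k x p

variable {A : ℝ → P → 𝔸}

theorem dyson_zero (A : ℝ → P → 𝔸) (p : P) : dyson A 0 p = 1 := by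
  rw [dyson, tsum_eq_single 0]
  · rfl
  · intro k hk
    obtain ⟨k, rfl⟩ := Nat.exists_eq_succ_of_ne_zero hk
    simp [dysonTerm]

/-- Each further integration contributes a factor M|x|/(k + 1), so the terms are dominated by the
exponential series of M|x|. -/
theorem norm_dysonTerm_le {M R : ℝ} {p : P} (hM : ∀ s, |s| ≤ R → ‖A s p‖ ≤ M)
    (hc : Continuous fun s => A s p) (hd : ∀ k, Continuous fun s => dysonTerm A k s p)
    (k : ℕ) : ∀ x, |x| ≤ R → ‖dysonTerm A k x p‖ ≤ ‖(1 : 𝔸)‖ * ((M * |x|) ^ k / k.factorial) := by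
  induction k with
  | zero => intro x _; simp [dysonTerm]
  | succ k ih =>
    intro x hx
    have hM0 : 0 ≤ M := (norm_nonneg _).trans (hM x hx)
    have hsub : ∀ s ∈ Set.uIoc 0 x, |s| ≤ |x| := fun s hs => by
      simpa using Set.abs_sub_left_of_mem_uIcc (Set.uIoc_subset_uIcc hs)
    have hfin : IsFiniteMeasure (volume.restrict (Set.uIoc 0 x)) := by
      refine ⟨?_⟩
      simp [Set.uIoc]
    calc ‖dysonTerm A (k + 1) x p‖
        ≤ ∫ s in Set.uIoc 0 x, ‖dysonTerm A k s p * A s p‖ :=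
          intervalIntegral.norm_integral_le_integral_norm_uIoc
      _ ≤ ∫ s in Set.uIoc 0 x, ‖(1 : 𝔸)‖ * (M ^ (k + 1) / k.factorial) * |s - 0| ^ k := by
          refine setIntegral_mono_on ?_ ?_ measurableSet_uIoc fun s hs => ?_
          · exact (((hd k).mul hc).norm.continuousOn.integrableOn_compact isCompact_uIcc).mono_set
              Set.uIoc_subset_uIcc
          · exact ((by fun_prop : Continuous fun s : ℝ =>
              ‖(1 : 𝔸)‖ * (M ^ (k + 1) / k.factorial) * |s - 0| ^ k).continuousOn.integrableOn_compact
                isCompact_uIcc).mono_set Set.uIoc_subset_uIcc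
          · have h1 := ih s ((hsub s hs).trans hx)
            have h2 := hM s ((hsub s hs).trans hx)
            calc ‖dysonTerm A k s p * A s p‖ ≤ ‖dysonTerm A k s p‖ * ‖A s p‖ := norm_mul_le _ _
              _ ≤ (‖(1 : 𝔸)‖ * ((M * |s|) ^ k / k.factorial)) * M := by gcongr
              _ = _ := by rw [sub_zero, mul_pow]; ring
      _ = ‖(1 : 𝔸)‖ * ((M * |x|) ^ (k + 1) / (k + 1).factorial) := by
          rw [integral_const_mul, integral_pow_abs_sub_uIoc, Nat.factorial_succ, mul_pow]
          push_cast
          rw [sub_zero]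
          field_simp

variable [TopologicalSpace P]

theorem continuous_dysonTerm (hA : Continuous fun q : ℝ × P => A q.1 q.2) (k : ℕ) :
    Continuous fun q : ℝ × P => dysonTerm A k q.1 q.2 := by
  induction k with
  | zero => exact continuous_const
  | succ k ih =>
    refine intervalIntegral.continuous_parametric_intervalIntegral_of_continuous
      (f := fun (q : ℝ × P) s => dysonTerm A k s q.2 * A s q.2) ?_ continuous_fst
    have h : Continuous fun r : (ℝ × P) × ℝ => (r.2, r.1.2) := by fun_prop
    exact (ih.comp h).mul (hA.comp h)

/-- The majorant for the Weierstrass test, uniform for |s| ≤ R and for parameters in a compact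
neighbourhood of p; continuity and termwise differentiation of the series both rest on it. -/
theorem exists_dyson_bound [WeaklyLocallyCompactSpace P]
    (hA : Continuous fun q : ℝ × P => A q.1 q.2) (R : ℝ) (p : P) :
    ∃ K ∈ 𝓝 p, ∃ M : ℝ, 0 ≤ M ∧ ∀ s, |s| ≤ R → ∀ q ∈ K, ‖A s q‖ ≤ M ∧
      ∀ k, ‖dysonTerm A k s q‖ ≤ ‖(1 : 𝔸)‖ * ((M * R) ^ k / k.factorial) := by
  obtain ⟨K, hK, hp⟩ := exists_compact_mem_nhds p
  obtain ⟨M, hM⟩ := ((isCompact_Icc (a := -R) (b := R)).prod hK).exists_bound_of_continuousOn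
    hA.continuousOn
  have hM' : ∀ s, |s| ≤ R → ∀ q ∈ K, ‖A s q‖ ≤ max M 0 := fun s hs q hq =>
    (hM (s, q) ⟨abs_le.1 hs, hq⟩).trans (le_max_left _ _)
  refine ⟨K, hp, max M 0, le_max_right _ _, fun s hs q hq => ⟨hM' s hs q hq, fun k => ?_⟩⟩
  have hq' : Continuous fun s : ℝ => (s, q) := by fun_prop
  refine (norm_dysonTerm_le (R := R) (fun s hs => hM' s hs q hq) (hA.comp hq')
    (fun k => (continuous_dysonTerm hA k).comp hq') k s hs).trans ?_
  gcongr

variable [WeaklyLocallyCompactSpace P] [CompleteSpace 𝔸]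

theorem continuous_dyson (hA : Continuous fun q : ℝ × P => A q.1 q.2) :
    Continuous fun q : ℝ × P => dyson A q.1 q.2 := by
  refine continuous_iff_continuousAt.2 fun ⟨x, p⟩ => ?_
  obtain ⟨K, hK, M, hM, h⟩ := exists_dyson_bound hA (|x| + 1) p
  have hs : Set.Icc (-(|x| + 1)) (|x| + 1) ∈ 𝓝 x :=
    Icc_mem_nhds (by linarith [neg_abs_le x]) (by linarith [le_abs_self x])
  refine ContinuousOn.continuousAt (s := Set.Icc (-(|x| + 1)) (|x| + 1) ×ˢ K) ?_
    (prod_mem_nhds hs hK)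
  refine continuousOn_tsum (fun k => (continuous_dysonTerm hA k).continuousOn)
    ((Real.summable_pow_div_factorial (M * (|x| + 1))).mul_left ‖(1 : 𝔸)‖) ?_
  rintro k ⟨s, q⟩ ⟨hs, hq⟩
  exact (h s (abs_le.2 hs) q hq).2 k

theorem hasDerivAt_dyson (hA : Continuous fun q : ℝ × P => A q.1 q.2) (x : ℝ) (p : P) :
    HasDerivAt (fun y => dyson A y p) (dyson A x p * A x p) x := by
  obtain ⟨K, hK, M, hM, h⟩ := exists_dyson_bound hA (|x| + 1) p
  have hp := mem_of_mem_nhds hK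
  have hsum := (Real.summable_pow_div_factorial (M * (|x| + 1))).mul_left ‖(1 : 𝔸)‖
  have hc : Continuous fun s : ℝ => (s, p) := by fun_prop
  have hx : |x| ≤ |x| + 1 := by linarith
  have habs : ∀ y ∈ Set.Ioo (-(|x| + 1)) (|x| + 1), |y| ≤ |x| + 1 := fun y hy =>
    (abs_lt.2 hy).le
  have hxm : x ∈ Set.Ioo (-(|x| + 1)) (|x| + 1) := abs_lt.1 (by linarith)
  have hS : ∀ y ∈ Set.Ioo (-(|x| + 1)) (|x| + 1), Summable fun k => dysonTerm A k y p :=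
    fun y hy => .of_norm_bounded hsum fun k => (h y (habs y hy) p hp).2 k
  -- Term k + 1 has derivative term k times A, and term 0 is constant. The derived series is thus
  -- the original one shifted by one index, which explains the case split here and in the majorant
  -- B.
  let g' : ℕ → ℝ → 𝔸 := fun k y => Nat.casesOn k 0 fun k => dysonTerm A k y p * A y p
  have hd : ∀ k y, HasDerivAt (fun y => dysonTerm A k y p) (g' k y) y := by
    intro k y
    cases k with
    | zero => exact hasDerivAt_const _ _
    | succ k =>
      have hcont : Continuous fun s => dysonTerm A k s p * A s p :=
        ((continuous_dysonTerm hA k).comp hc).mul (hA.comp hc)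
      exact intervalIntegral.integral_hasDerivAt_right (hcont.intervalIntegrable _ _)
        (hcont.stronglyMeasurableAtFilter _ _) hcont.continuousAt
  let B : ℕ → ℝ := fun k => Nat.casesOn k 0
    fun k => ‖(1 : 𝔸)‖ * ((M * (|x| + 1)) ^ k / k.factorial) * M
  have hB : Summable B := (summable_nat_add_iff 1).1 (hsum.mul_right M)
  have key := hasDerivAt_tsum_of_isPreconnected (g := fun k y => dysonTerm A k y p) (g' := g') hB
    isOpen_Ioo isPreconnected_Ioo (fun k y _ => hd k y) (fun k y hy => ?_) hxm (hS x hxm) hxm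
  · refine key.congr_deriv ?_
    have hg' : Summable fun k => g' k x :=
      (summable_nat_add_iff 1).1 ((hS x hxm).mul_right (A x p))
    rw [hg'.tsum_eq_zero_add]
    change 0 + ∑' k, dysonTerm A k x p * A x p = _
    rw [zero_add, (hS x hxm).tsum_mul_right, dyson]
  · cases k with
    | zero => simp [g', B]
    | succ k =>
      have h1 := h y (habs y hy) p hp
      exact (norm_mul_le _ _).trans (mul_le_mul (h1.2 k) h1.1 (norm_nonneg _)
        ((norm_nonneg _).trans (h1.2 k)))

end LinearODE

/-! ### Fundamental matrices and their dependence on parameters -/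

section Matrix

attribute [local instance] Matrix.linftyOpNormedRing Matrix.linftyOpNormedAlgebra

/-- The entries of solutions of `Y' = Y A`, `Y(0) = 1`, for matrices `A(x, p)` that depend
continuously on a parameter. -/
theorem exists_linear_ode {P : Type*} [TopologicalSpace P] [WeaklyLocallyCompactSpace P]
    (A : ℝ → P → Mat n) (hA : ∀ i j, Continuous fun q : ℝ × P => A q.1 q.2 i j) :
    ∃ Y : ℝ → P → Mat n, (∀ i j, Continuous fun q : ℝ × P => Y q.1 q.2 i j) ∧
      (∀ x p, HasMatDerivAt (fun y => Y y p) (Y x p * A x p) x) ∧ ∀ p, Y 0 p = 1 := by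
  have hA' : Continuous fun q : ℝ × P => A q.1 q.2 :=
    continuous_matrix hA
  refine ⟨dyson A, fun i j => ?_, fun x p i j => ?_, dyson_zero A⟩
  · exact (continuous_dyson hA').matrix_elem i j
  · let φ : Mat n →ₗ[ℝ] ℂ := (Matrix.entryLinearMap ℝ ℂ i j)
    exact φ.toContinuousLinearMap.hasFDerivAt.comp_hasDerivAt x (hasDerivAt_dyson hA' x p)

end Matrix

/-- Fundamental solutions of `Y' = Y A`, `Y(0) = 1`, and their inverses. -/
theorem exists_fundamental_solution {P : Type*} [TopologicalSpace P] [WeaklyLocallyCompactSpace P]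
    (A : ℝ → P → Mat n) (hA : ∀ i j, Continuous fun q : ℝ × P => A q.1 q.2 i j) :
    ∃ Y Z : ℝ → P → Mat n, (∀ i j, Continuous fun q : ℝ × P => Y q.1 q.2 i j) ∧
      (∀ i j, Continuous fun q : ℝ × P => Z q.1 q.2 i j) ∧
      (∀ x p, HasMatDerivAt (fun y => Y y p) (Y x p * A x p) x) ∧
      (∀ x p, HasMatDerivAt (fun y => Z y p) (-(A x p * Z x p)) x) ∧
      (∀ p, Y 0 p = 1) ∧ (∀ x p, Y x p * Z x p = 1) ∧ (∀ x p, Z x p * Y x p = 1) := by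
  obtain ⟨Y, hYc, hY, hY0⟩ := exists_linear_ode A hA
  -- The inverse must satisfy Z' = -A Z; transposition turns this into W' = -W Aᵀ, an equation of
  -- the type already solved. That Wᵀ is the inverse follows because Y Wᵀ has derivative zero.
  obtain ⟨W, hWc, hW, hW0⟩ := exists_linear_ode (fun x p => -(A x p)ᵀ) fun i j => (hA j i).neg
  have hZ : ∀ x p, HasMatDerivAt (fun y => (W y p)ᵀ) (-(A x p * (W x p)ᵀ)) x := fun x p =>
    (hW x p).transpose.congr_deriv (by simp [Matrix.transpose_mul])
  have hYZ : ∀ x p, Y x p * (W x p)ᵀ = 1 := fun x p => by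
    have h0 : ∀ x, HasMatDerivAt (fun x => Y x p * (W x p)ᵀ) 0 x := fun x =>
      ((hY x p).mul (hZ x p)).congr_deriv (by noncomm_ring)
    rw [HasMatDerivAt.eq_of_zero h0 x 0]
    simp [hY0, hW0]
  exact ⟨Y, fun x p => (W x p)ᵀ, hYc, fun i j => hWc j i, hY, hZ, hY0, hYZ,
    fun x p => mul_eq_one_comm.1 (hYZ x p)⟩

/-- Carathéodory's form of differentiability: G is the difference quotient, already extended to q =
p. -/
theorem hasDerivAt_of_sub_eq_smul {𝕜 E : Type*} [NontriviallyNormedField 𝕜] [NormedAddCommGroup E]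
    [NormedSpace 𝕜 E] {f G : 𝕜 → E} {p : 𝕜} (h : ∀ q, f q - f p = (q - p) • G q)
    (hG : ContinuousAt G p) : HasDerivAt f (G p) p := by
  rw [hasDerivAt_iff_tendsto_slope]
  refine (hG.tendsto.mono_left nhdsWithin_le_nhds).congr' ?_
  filter_upwards [self_mem_nhdsWithin] with q hq
  rw [slope_def_module, h, smul_smul, inv_mul_cancel₀ (sub_ne_zero.2 hq), one_smul]

/-- The scalar lives in 𝕜 so that one argument serves the derivatives in λ (𝕜 = ℂ) and in t (𝕜 = ℝ).
-/
theorem sub_eq_smul_integral {𝕜 : Type*} [NontriviallyNormedField 𝕜] [NormedAlgebra 𝕜 ℂ]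
    [SMulCommClass ℝ 𝕜 ℂ] {F N : ℝ → Mat n} {c : 𝕜} (hF : ∀ s, HasMatDerivAt F (c • N s) s)
    (hN : ∀ i j, Continuous fun s => N s i j) (x : ℝ) :
    F x - F 0 = c • Matrix.of fun i j => ∫ s in (0 : ℝ)..x, N s i j := by
  ext i j
  have h := intervalIntegral.integral_eq_sub_of_hasDerivAt (a := 0) (b := x)
    (fun s _ => hF s i j) (((hN i j).const_smul c).intervalIntegrable _ _)
  rw [Matrix.sub_apply, ← h]
  exact intervalIntegral.integral_smul c fun s => N s i j

/-- Differentiation of solutions of `Y' = Y A` with respect to a parameter. -/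
theorem hasDerivAt_parameter {𝕜 : Type*} [NontriviallyNormedField 𝕜] [NormedAlgebra 𝕜 ℂ]
    [SMulCommClass ℝ 𝕜 ℂ]
    {A Y Z : ℝ → 𝕜 → Mat n} {D : ℝ → 𝕜 → Mat n} {p : 𝕜}
    (hYc : ∀ i j, Continuous fun q : ℝ × 𝕜 => Y q.1 q.2 i j)
    (hZc : ∀ i j, Continuous fun q : ℝ × 𝕜 => Z q.1 q.2 i j)
    (hDc : ∀ i j, Continuous fun q : ℝ × 𝕜 => D q.1 q.2 i j)
    (hY : ∀ x q, HasMatDerivAt (fun y => Y y q) (Y x q * A x q) x)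
    (hZ : ∀ x q, HasMatDerivAt (fun y => Z y q) (-(A x q * Z x q)) x)
    (hY0 : ∀ q, Y 0 q = 1) (hYZ : ∀ x q, Y x q * Z x q = 1) (hZY : ∀ x q, Z x q * Y x q = 1)
    (hD : ∀ x q, A x q - A x p = (q - p) • D x q) (x : ℝ) (i j : Fin n) :
    HasDerivAt (fun q => Y x q i j)
      (((Matrix.of fun i j => ∫ s in (0 : ℝ)..x, (Y s p * D s p * Z s p) i j) * Y x p) i j) p := by
  obtain ⟨N, hNdef⟩ : ∃ N : ℝ → 𝕜 → Mat n, ∀ s q, N s q = Y s q * D s q * Z s p :=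
    ⟨_, fun _ _ => rfl⟩
  have hN : ∀ i j, Continuous fun r : ℝ × 𝕜 => N r.1 r.2 i j := by
    intro i j
    simp only [hNdef, Matrix.mul_apply]
    have hp : Continuous fun q : ℝ × 𝕜 => (q.1, p) := by fun_prop
    exact continuous_finsetSum _ fun k _ => (continuous_finsetSum _ fun l _ =>
      (hYc i l).mul (hDc l k)).mul ((hZc k j).comp hp)
  have hint : ∀ q, Y x q - Y x p =
      (q - p) • ((Matrix.of fun i j => ∫ s in (0 : ℝ)..x, N s q i j) * Y x p) := by
    intro q
    -- Y(q) Y(p)⁻¹ has derivative Y(q)(A(q) - A(p))Y(p)⁻¹, which contains the factor q - p.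
    -- Integration gives an exact formula for the difference quotient of Y, with no error term to
    -- estimate.
    have h1 : ∀ s, HasMatDerivAt (fun s => Y s q * Z s p) ((q - p) • N s q) s := fun s =>
      ((hY s q).mul (hZ s p)).congr_deriv (by
        have : (q - p) • N s q = Y s q * (A s q - A s p) * Z s p := by
          rw [hNdef, hD, Matrix.mul_smul, Matrix.smul_mul]
        rw [this]; noncomm_ring)
    have h4 : Y 0 q * Z 0 p = 1 := by
      have := hYZ 0 p
      rw [hY0, one_mul] at this
      rw [hY0, this, one_mul]
    have hq : Continuous fun s : ℝ => (s, q) := by fun_prop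
    have hNq : ∀ i j, Continuous fun s => N s q i j := fun i j => (hN i j).comp hq
    have h2 := sub_eq_smul_integral (F := fun s => Y s q * Z s p) (N := fun s => N s q) h1 hNq x
    simp only [h4] at h2
    rw [← Matrix.smul_mul, ← h2, Matrix.sub_mul, Matrix.mul_assoc, hZY]
    simp
  simp only [← hNdef]
  refine hasDerivAt_of_sub_eq_smul (f := fun q => Y x q i j)
    (G := fun q => ((Matrix.of fun i j => ∫ s in (0 : ℝ)..x, N s q i j) * Y x p) i j)
    (fun q => congrFun (congrFun (hint q) i) j) (Continuous.continuousAt ?_)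
  simp only [Matrix.mul_apply, Matrix.of_apply]
  refine continuous_finsetSum _ fun k _ => Continuous.mul ?_ continuous_const
  exact intervalIntegral.continuous_parametric_intervalIntegral_of_continuous'
    (f := fun q s => N s q i k)
    ((hN i k).comp (by fun_prop : Continuous fun r : 𝕜 × ℝ => (r.2, r.1))) 0 x

/-- Hadamard's lemma: the difference quotient with respect to the second variable is continuous. -/
theorem exists_continuous_difference_quotient {f f' : ℝ → ℝ → ℂ}
    (hf : ∀ x t, HasDerivAt (f x) (f' x t) t) (hc : Continuous fun q : ℝ × ℝ => f' q.1 q.2)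
    (p : ℝ) : ∃ D : ℝ → ℝ → ℂ, (Continuous fun q : ℝ × ℝ => D q.1 q.2) ∧
      (∀ x q, f x q - f x p = (q - p) • D x q) ∧ ∀ x, D x p = f' x p := by
  refine ⟨fun x q => ∫ θ in (0 : ℝ)..1, f' x (p + θ * (q - p)), ?_, fun x q => ?_, fun x => ?_⟩
  · exact intervalIntegral.continuous_parametric_intervalIntegral_of_continuous'
      (f := fun (r : ℝ × ℝ) θ => f' r.1 (p + θ * (r.2 - p)))
      (hc.comp (by fun_prop : Continuous fun r : (ℝ × ℝ) × ℝ => (r.1.1, p + r.2 * (r.1.2 - p)))) 0 1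
  · have h1 : ∀ θ : ℝ, HasDerivAt (fun θ => f x (p + θ * (q - p)))
        ((q - p) • f' x (p + θ * (q - p))) θ := fun θ =>
      (hf x _).scomp θ (by simpa using ((hasDerivAt_id θ).mul_const (q - p)).const_add p)
    have hcc : Continuous fun θ : ℝ => f' x (p + θ * (q - p)) :=
      hc.comp (by fun_prop : Continuous fun θ : ℝ => (x, p + θ * (q - p)))
    have h3 := intervalIntegral.integral_eq_sub_of_hasDerivAt (a := 0) (b := 1)
      (fun θ _ => h1 θ) ((hcc.const_smul (q - p)).intervalIntegrable _ _)
    rw [intervalIntegral.integral_smul] at h3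
    rw [h3]
    simp
  · simp

/-! ### Bounded and rapidly decreasing functions -/

/-- The bounded functions on the line. -/
def boundedFun : Submodule ℂ (ℝ → ℂ) where
  carrier := {f | ∃ C, ∀ x, ‖f x‖ ≤ C}
  add_mem' := by
    rintro f g ⟨C, hC⟩ ⟨D, hD⟩
    exact ⟨C + D, fun x => (norm_add_le _ _).trans (add_le_add (hC x) (hD x))⟩
  zero_mem' := ⟨0, fun x => by simp⟩
  smul_mem' := by
    rintro c f ⟨C, hC⟩
    refine ⟨‖c‖ * C, fun x => ?_⟩
    rw [Pi.smul_apply, norm_smul]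
    gcongr
    exact hC x

/-- The rapidly decreasing functions on the line. -/
def rapidFun : Submodule ℂ (ℝ → ℂ) where
  carrier := {f | ∀ N : ℕ, ∃ C, ∀ x, |x| ^ N * ‖f x‖ ≤ C}
  add_mem' := by
    intro f g hf hg N
    obtain ⟨C, hC⟩ := hf N
    obtain ⟨D, hD⟩ := hg N
    refine ⟨C + D, fun x => ?_⟩
    calc |x| ^ N * ‖f x + g x‖ ≤ |x| ^ N * (‖f x‖ + ‖g x‖) := by
          gcongr; exact norm_add_le _ _
      _ ≤ C + D := by rw [mul_add]; exact add_le_add (hC x) (hD x)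
  zero_mem' := fun N => ⟨0, fun x => by simp⟩
  smul_mem' := by
    intro c f hf N
    obtain ⟨C, hC⟩ := hf N
    refine ⟨‖c‖ * C, fun x => ?_⟩
    rw [Pi.smul_apply, norm_smul, mul_left_comm]
    gcongr
    exact hC x

theorem boundedFun_mul_rapidFun {f g : ℝ → ℂ} (hf : f ∈ boundedFun) (hg : g ∈ rapidFun) :
    (fun x => f x * g x) ∈ rapidFun := by
  obtain ⟨C, hC⟩ := hf
  intro N
  obtain ⟨D, hD⟩ := hg N
  refine ⟨C * D, fun x => ?_⟩
  rw [norm_mul, mul_left_comm]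
  exact mul_le_mul (hC x) (hD x) (by positivity) ((norm_nonneg _).trans (hC x))

theorem rapidFun_mul_boundedFun {f g : ℝ → ℂ} (hf : f ∈ rapidFun) (hg : g ∈ boundedFun) :
    (fun x => f x * g x) ∈ rapidFun := by
  simpa only [mul_comm] using boundedFun_mul_rapidFun hg hf

theorem rapidFun_le_boundedFun : rapidFun ≤ boundedFun := fun f hf => by
  obtain ⟨C, hC⟩ := hf 0
  exact ⟨C, fun x => by simpa using hC x⟩

/-- `f` and its derivatives of order at most `m` lie in `K`. -/
def DerivsIn (K : Submodule ℂ (ℝ → ℂ)) : ℕ → (ℝ → ℂ) → Prop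
  | 0, f => f ∈ K
  | m + 1, f => f ∈ K ∧ Differentiable ℝ f ∧ DerivsIn K m (deriv f)

namespace DerivsIn

variable {K K₁ K₂ : Submodule ℂ (ℝ → ℂ)} {m : ℕ} {f g : ℝ → ℂ}

theorem mem (h : DerivsIn K m f) : f ∈ K := by
  cases m with
  | zero => exact h
  | succ m => exact h.1

theorem of_succ (h : DerivsIn K (m + 1) f) : DerivsIn K m f := by
  induction m generalizing f with
  | zero => exact h.1
  | succ m ih => exact ⟨h.1, h.2.1, ih h.2.2⟩

theorem mono (hK : K₁ ≤ K₂) (h : DerivsIn K₁ m f) : DerivsIn K₂ m f := by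
  induction m generalizing f with
  | zero => exact hK h
  | succ m ih => exact ⟨hK h.1, h.2.1, ih h.2.2⟩

theorem add (hf : DerivsIn K m f) (hg : DerivsIn K m g) : DerivsIn K m (fun x => f x + g x) := by
  induction m generalizing f g with
  | zero => exact K.add_mem hf hg
  | succ m ih =>
    refine ⟨K.add_mem hf.1 hg.1, hf.2.1.add hg.2.1, ?_⟩
    have : deriv (fun x => f x + g x) = fun x => deriv f x + deriv g x :=
      funext fun x => deriv_fun_add (hf.2.1 x) (hg.2.1 x)
    rw [this]
    exact ih hf.2.2 hg.2.2

theorem const_mul (c : ℂ) (hf : DerivsIn K m f) : DerivsIn K m (fun x => c * f x) := by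
  induction m generalizing f with
  | zero => exact K.smul_mem c hf
  | succ m ih =>
    refine ⟨K.smul_mem c hf.1, hf.2.1.const_mul c, ?_⟩
    have : deriv (fun x => c * f x) = fun x => c * deriv f x :=
      funext fun x => deriv_const_mul c (hf.2.1 x)
    rw [this]
    exact ih hf.2.2

theorem neg (hf : DerivsIn K m f) : DerivsIn K m (fun x => -f x) := by
  simpa using hf.const_mul (-1)

theorem sub (hf : DerivsIn K m f) (hg : DerivsIn K m g) : DerivsIn K m (fun x => f x - g x) := by
  simpa only [sub_eq_add_neg] using hf.add hg.neg

theorem zero : DerivsIn K m (fun _ => 0) := by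
  induction m with
  | zero => exact K.zero_mem
  | succ m ih => exact ⟨K.zero_mem, differentiable_const _, by simpa using ih⟩

theorem sum {ι : Type*} {s : Finset ι} {f : ι → ℝ → ℂ} (h : ∀ i ∈ s, DerivsIn K m (f i)) :
    DerivsIn K m (fun x => ∑ i ∈ s, f i x) := by
  classical
  induction s using Finset.induction_on with
  | empty => simpa using zero
  | insert i s hi ih =>
    simp only [Finset.sum_insert hi]
    exact (h i (Finset.mem_insert_self _ _)).add
      (ih fun k hk => h k (Finset.mem_insert_of_mem hk))

theorem mul {K₃ : Submodule ℂ (ℝ → ℂ)}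
    (hK : ∀ f ∈ K₁, ∀ g ∈ K₂, (fun x => f x * g x) ∈ K₃)
    (hf : DerivsIn K₁ m f) (hg : DerivsIn K₂ m g) : DerivsIn K₃ m (fun x => f x * g x) := by
  induction m generalizing f g with
  | zero => exact hK f hf g hg
  | succ m ih =>
    refine ⟨hK f hf.1 g hg.1, hf.2.1.mul hg.2.1, ?_⟩
    have : deriv (fun x => f x * g x) = fun x => deriv f x * g x + f x * deriv g x :=
      funext fun x => deriv_fun_mul (hf.2.1 x) (hg.2.1 x)
    rw [this]
    exact (ih hf.2.2 hg.of_succ).add (ih hf.of_succ hg.2.2)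

theorem const (c : ℂ) : DerivsIn boundedFun m (fun _ => c) := by
  cases m with
  | zero => exact ⟨‖c‖, fun _ => le_rfl⟩
  | succ m =>
    exact ⟨⟨‖c‖, fun _ => le_rfl⟩, differentiable_const _, by simpa using zero⟩

theorem contDiff (h : ∀ m, DerivsIn K m f) : ContDiff ℝ ∞ f := by
  rw [contDiff_infty]
  intro m
  induction m generalizing f with
  | zero => exact contDiff_zero.2 (h 1).2.1.continuous
  | succ m ih =>
    push_cast
    exact contDiff_succ_iff_deriv.2 ⟨(h 1).2.1, by simp, ih fun m => (h (m + 1)).2.2⟩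

theorem iteratedDeriv_mem (h : DerivsIn K m f) : iteratedDeriv m f ∈ K := by
  induction m generalizing f with
  | zero => simpa using h.mem
  | succ m ih => rw [iteratedDeriv_succ']; exact ih h.2.2

theorem of_schwartz (f : 𝓢(ℝ, ℂ)) (m : ℕ) : DerivsIn rapidFun m f := by
  induction m generalizing f with
  | zero =>
    intro N
    obtain ⟨C, _, hC⟩ := f.decay N 0
    exact ⟨C, fun x => by simpa using hC x⟩
  | succ m ih =>
    refine ⟨(ih f).mem, f.differentiable, ?_⟩
    exact ih (SchwartzMap.derivCLM ℝ ℂ f)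

theorem exists_schwartz (h : ∀ m, DerivsIn rapidFun m f) : ∃ F : 𝓢(ℝ, ℂ), ∀ x, F x = f x := by
  refine ⟨⟨f, contDiff h, fun k m => ?_⟩, fun x => rfl⟩
  obtain ⟨C, hC⟩ := (h m).iteratedDeriv_mem k
  refine ⟨C, fun x => ?_⟩
  rw [norm_iteratedFDeriv_eq_norm_iteratedDeriv]
  exact hC x

/-- The primitive, vanishing at `-∞`, of a smooth rapidly decreasing function. -/
theorem integral_Iic (h : ∀ m, DerivsIn rapidFun m f) :
    (∀ m, DerivsIn boundedFun m (fun x => ∫ y in Set.Iic x, f y)) ∧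
      ∀ x, HasDerivAt (fun x => ∫ y in Set.Iic x, f y) (f x) x := by
  obtain ⟨F, hF⟩ := exists_schwartz h
  have hint : Integrable f := by
    have := F.integrable (μ := volume)
    rwa [show (F : ℝ → ℂ) = f from funext hF] at this
  have hcont : Continuous f := (contDiff h).continuous
  have hd : ∀ x, HasDerivAt (fun x => ∫ y in Set.Iic x, f y) (f x) x := by
    intro x
    have h1 : (fun x => ∫ y in Set.Iic x, f y) =
        fun x => (∫ y in Set.Iic 0, f y) + ∫ y in (0 : ℝ)..x, f y := funext fun x => by
      rw [← intervalIntegral.integral_Iic_sub_Iic hint.integrableOn hint.integrableOn]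
      ring
    rw [h1]
    exact (intervalIntegral.integral_hasDerivAt_right (hcont.intervalIntegrable _ _)
        (hcont.stronglyMeasurableAtFilter _ _) hcont.continuousAt).const_add _
  have h0 : (fun x => ∫ y in Set.Iic x, f y) ∈ boundedFun :=
    ⟨∫ y, ‖f y‖, fun x => (norm_integral_le_integral_norm _).trans
      (setIntegral_le_integral hint.norm (Eventually.of_forall fun y => norm_nonneg _))⟩
  refine ⟨fun m => ?_, hd⟩
  cases m with
  | zero => exact h0
  | succ m =>
    refine ⟨h0, fun x => (hd x).differentiableAt, ?_⟩
    rw [show deriv (fun x => ∫ y in Set.Iic x, f y) = f from funext fun x => (hd x).deriv]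
    exact (h m).mono rapidFun_le_boundedFun

end DerivsIn

/-- The entries of `F` and their derivatives of order at most `m` lie in `K`. -/
def MatDerivsIn (K : Submodule ℂ (ℝ → ℂ)) (m : ℕ) (F : ℝ → Mat n) : Prop :=
  ∀ i j, DerivsIn K m (fun x => F x i j)

namespace MatDerivsIn

variable {K K₁ K₂ : Submodule ℂ (ℝ → ℂ)} {m : ℕ} {F G : ℝ → Mat n}

theorem mono (hK : K₁ ≤ K₂) (h : MatDerivsIn K₁ m F) : MatDerivsIn K₂ m F :=
  fun i j => (h i j).mono hK

theorem add (hF : MatDerivsIn K m F) (hG : MatDerivsIn K m G) :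
    MatDerivsIn K m (fun x => F x + G x) := fun i j => (hF i j).add (hG i j)

theorem sub (hF : MatDerivsIn K m F) (hG : MatDerivsIn K m G) :
    MatDerivsIn K m (fun x => F x - G x) := fun i j => (hF i j).sub (hG i j)

theorem const (M : Mat n) : MatDerivsIn boundedFun m (fun _ => M) := fun i j => .const (M i j)

theorem mul {K₃ : Submodule ℂ (ℝ → ℂ)}
    (hK : ∀ f ∈ K₁, ∀ g ∈ K₂, (fun x => f x * g x) ∈ K₃)
    (hF : MatDerivsIn K₁ m F) (hG : MatDerivsIn K₂ m G) :
    MatDerivsIn K₃ m (fun x => F x * G x) := fun i j => by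
  simp only [Matrix.mul_apply]
  exact .sum fun k _ => (hF i k).mul hK (hG k j)

theorem bounded_mul_rapid (hF : MatDerivsIn boundedFun m F) (hG : MatDerivsIn rapidFun m G) :
    MatDerivsIn rapidFun m (fun x => F x * G x) :=
  hF.mul (fun _ hf _ hg => boundedFun_mul_rapidFun hf hg) hG

theorem rapid_mul_bounded (hF : MatDerivsIn rapidFun m F) (hG : MatDerivsIn boundedFun m G) :
    MatDerivsIn rapidFun m (fun x => F x * G x) :=
  hF.mul (fun _ hf _ hg => rapidFun_mul_boundedFun hf hg) hG

theorem succ {F' : ℝ → Mat n} (hF : MatDerivsIn K 0 F) (hd : ∀ x, HasMatDerivAt F (F' x) x)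
    (hF' : MatDerivsIn K m F') : MatDerivsIn K (m + 1) F := fun i j => by
  refine ⟨hF i j, fun x => (hd x i j).differentiableAt, ?_⟩
  rw [show deriv (fun x => F x i j) = fun x => F' x i j from funext fun x => (hd x i j).deriv]
  exact hF' i j

theorem hasMatDerivAt (h : MatDerivsIn K (m + 1) F) (x : ℝ) :
    HasMatDerivAt F (matDeriv F x) x := fun i j => ((h i j).2.1 x).hasDerivAt

theorem matDeriv (h : MatDerivsIn K (m + 1) F) : MatDerivsIn K m (matDeriv F) :=
  fun i j => (h i j).2.2

end MatDerivsIn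

theorem isSchwartz_iff {F : ℝ → Mat n} : IsSchwartz F ↔ ∀ m, MatDerivsIn rapidFun m F := by
  refine ⟨fun h m i j => ?_, fun h i j => DerivsIn.exists_schwartz fun m => h m i j⟩
  obtain ⟨f, hf⟩ := h i j
  rw [← show (f : ℝ → ℂ) = fun x => F x i j from funext hf]
  exact .of_schwartz f m

/-! ### Power series with matrix coefficients that depend on a variable -/

/-- Coefficientwise derivative of a power series of matrix-valued functions. -/
def HasSeriesDerivAt (F : ℝ → PowerSeries (Mat n)) (F' : PowerSeries (Mat n)) (x : ℝ) : Prop :=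
  ∀ k, HasMatDerivAt (fun y => PowerSeries.coeff k (F y)) (PowerSeries.coeff k F') x

namespace HasSeriesDerivAt

variable {F G : ℝ → PowerSeries (Mat n)} {F' G' : PowerSeries (Mat n)} {x : ℝ}

theorem const (M : PowerSeries (Mat n)) (x : ℝ) : HasSeriesDerivAt (fun _ => M) 0 x := fun k => by
  simpa using HasMatDerivAt.const (PowerSeries.coeff k M) x

theorem mul (hF : HasSeriesDerivAt F F' x) (hG : HasSeriesDerivAt G G' x) :
    HasSeriesDerivAt (fun y => F y * G y) (F' * G x + F x * G') x := fun k => by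
  simp only [PowerSeries.coeff_mul, map_add, ← Finset.sum_add_distrib]
  exact .sum fun p _ => (hF p.1).mul (hG p.2)

theorem unique (hF : HasSeriesDerivAt F F' x) (hG : HasSeriesDerivAt F G' x) : F' = G' :=
  PowerSeries.ext fun k => (hF k).unique (hG k)

theorem congr_deriv (hF : HasSeriesDerivAt F F' x) (h : F' = G') : HasSeriesDerivAt F G' x :=
  h ▸ hF

theorem inv (h1 : ∀ y, PowerSeries.constantCoeff (F y) = 1) (hF : HasSeriesDerivAt F F' x) :
    HasSeriesDerivAt (fun y => PowerSeries.invOfUnit (F y) 1)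
      (-(PowerSeries.invOfUnit (F x) 1 * F' * PowerSeries.invOfUnit (F x) 1)) x := by
  -- The recursion for the coefficients of the inverse is used only for differentiability; the value
  -- of the derivative then comes from differentiating F F⁻¹ = 1.
  have hd : ∀ k, ∃ D, HasMatDerivAt
      (fun y => PowerSeries.coeff k (PowerSeries.invOfUnit (F y) 1)) D x := by
    intro k
    induction k using Nat.strong_induction_on with
    | _ k ih =>
      rcases Nat.eq_zero_or_pos k with rfl | hk
      · refine ⟨0, ?_⟩
        have h : (fun y => PowerSeries.coeff 0 (PowerSeries.invOfUnit (F y) 1)) = fun _ => 1 :=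
          funext fun y => by simp
        rw [h]
        exact HasMatDerivAt.const _ x
      · choose! D hD using ih
        have h : (fun y => PowerSeries.coeff k (PowerSeries.invOfUnit (F y) 1)) = fun y => -1 *
            ∑ p ∈ Finset.HasAntidiagonal.antidiagonal k, if p.2 < k then PowerSeries.coeff p.1 (F y) *
              PowerSeries.coeff p.2 (PowerSeries.invOfUnit (F y) 1) else 0 :=
          funext fun y => by rw [PowerSeries.coeff_invOfUnit, if_neg hk.ne']; simp
        rw [h]
        refine ⟨_, HasMatDerivAt.const_mul (-1) (HasMatDerivAt.sum (F' := fun p =>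
          if p.2 < k then PowerSeries.coeff p.1 F' *
            PowerSeries.coeff p.2 (PowerSeries.invOfUnit (F x) 1) +
            PowerSeries.coeff p.1 (F x) * D p.2 else 0) fun p _ => ?_)⟩
        split_ifs with hp
        · exact (hF p.1).mul (hD p.2 hp)
        · exact HasMatDerivAt.const _ x
  choose D hD using hd
  have hw : HasSeriesDerivAt (fun y => PowerSeries.invOfUnit (F y) 1) (PowerSeries.mk D) x :=
    fun k => by simpa using hD k
  refine hw.congr_deriv ?_
  have h2 : HasSeriesDerivAt (fun y => F y * PowerSeries.invOfUnit (F y) 1) 0 x := by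
    have : (fun y => F y * PowerSeries.invOfUnit (F y) 1) = fun _ => 1 :=
      funext fun y => PowerSeries.mul_invOfUnit _ _ (h1 y)
    rw [this]
    exact const _ x
  have h3 := (hF.mul hw).unique h2
  have h4 := PowerSeries.invOfUnit_mul (F x) 1 (h1 x)
  calc PowerSeries.mk D
      = PowerSeries.invOfUnit (F x) 1 * F x * PowerSeries.mk D := by rw [h4, one_mul]
    _ = PowerSeries.invOfUnit (F x) 1 * (F' * PowerSeries.invOfUnit (F x) 1 +
          F x * PowerSeries.mk D) -
          PowerSeries.invOfUnit (F x) 1 * F' * PowerSeries.invOfUnit (F x) 1 := by noncomm_ring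
    _ = _ := by rw [h3]; simp

end HasSeriesDerivAt

/-! ### Gauge transformations of the Lax operator -/

/-- The operator `a λ + u`, multiplied by `X = λ⁻¹`. -/
def laxSeries (a : Fin n → ℂ) (u : Mat n) : PowerSeries (Mat n) :=
  PowerSeries.C (Matrix.diagonal a) + PowerSeries.C u * PowerSeries.X

/-- `K` is a power series in `λ⁻¹`, with constant term `I`, which transforms `aλ + u` to `aλ + v`:
`K_x = K (aλ + u) - (aλ + v) K`. -/
def IsGauge (a : Fin n → ℂ) (u v : ℝ → Mat n) (K : ℝ → PowerSeries (Mat n)) : Prop :=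
  ∀ x, PowerSeries.constantCoeff (K x) = 1 ∧ ∃ K', HasSeriesDerivAt K K' x ∧
    K' * PowerSeries.X = K x * laxSeries a (u x) - laxSeries a (v x) * K x

theorem IsGauge.inv {a : Fin n → ℂ} {u v : ℝ → Mat n} {K : ℝ → PowerSeries (Mat n)}
    (hK : IsGauge a u v K) : IsGauge a v u (fun x => PowerSeries.invOfUnit (K x) 1) := by
  intro x
  obtain ⟨h0, K', hd, hX⟩ := hK x
  refine ⟨by simp, _, hd.inv fun y => (hK y).1, ?_⟩
  have h1 := PowerSeries.invOfUnit_mul (K x) 1 h0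
  have h2 := PowerSeries.mul_invOfUnit (K x) 1 h0
  beta_reduce
  generalize PowerSeries.invOfUnit (K x) 1 = W at *
  calc -(W * K' * W) * PowerSeries.X = -(W * (K' * PowerSeries.X) * W) := by
        rw [neg_mul, mul_assoc, ← PowerSeries.X_mul, mul_assoc, mul_assoc, mul_assoc]
    _ = -((W * K x) * laxSeries a (u x) * W - W * laxSeries a (v x) * (K x * W)) := by
        rw [hX]; noncomm_ring
    _ = _ := by rw [h1, h2]; noncomm_ring

/-- `P` is an idempotent power series in `λ⁻¹`, with constant term `e`, which commutes with
`∂ + aλ + u`. -/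
structure IsLaxProjection (a : Fin n → ℂ) (e : Mat n) (u : ℝ → Mat n)
    (P : ℝ → PowerSeries (Mat n)) : Prop where
  coeff_zero : ∀ x, PowerSeries.coeff 0 (P x) = e
  idem : ∀ x, P x * P x = P x
  deriv : ∀ k x, HasMatDerivAt (fun y => PowerSeries.coeff k (P y))
    (PowerSeries.coeff (k + 1) (P x) * Matrix.diagonal a -
      Matrix.diagonal a * PowerSeries.coeff (k + 1) (P x) +
      (PowerSeries.coeff k (P x) * u x - u x * PowerSeries.coeff k (P x))) x

theorem coeff_mul_laxSeries (a : Fin n → ℂ) (u : Mat n) (P : PowerSeries (Mat n)) (k : ℕ) :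
    PowerSeries.coeff (k + 1) (P * laxSeries a u - laxSeries a u * P) =
      PowerSeries.coeff (k + 1) P * Matrix.diagonal a -
      Matrix.diagonal a * PowerSeries.coeff (k + 1) P +
      (PowerSeries.coeff k P * u - u * PowerSeries.coeff k P) := by
  have h : P * laxSeries a u - laxSeries a u * P =
      P * PowerSeries.C (Matrix.diagonal a) - PowerSeries.C (Matrix.diagonal a) * P +
        (P * PowerSeries.C u - PowerSeries.C u * P) * PowerSeries.X := by
    have h1 : PowerSeries.C u * PowerSeries.X * P = PowerSeries.C u * P * PowerSeries.X := by
      rw [mul_assoc, PowerSeries.X_mul, mul_assoc]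
    rw [laxSeries, mul_add, add_mul, h1]
    noncomm_ring
  rw [h, map_add, PowerSeries.coeff_succ_mul_X]
  simp

/-- Gauge transformations carry series commuting with one Lax operator to series commuting with the
other. The derivative of coefficient k involves coefficient k + 1, so the argument multiplies P_x by
X and compares power series; `he` takes care of the constant term, which corresponds to the power
λ¹. -/
theorem IsLaxProjection.conj {a : Fin n → ℂ} {e : Mat n} {u v : ℝ → Mat n}
    {P K W : ℝ → PowerSeries (Mat n)}
    (he : e * Matrix.diagonal a = Matrix.diagonal a * e) (hP : IsLaxProjection a e u P) (hK : IsGauge a u v K)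
    (hW : IsGauge a v u W) (hWK : ∀ x, W x * K x = 1) :
    IsLaxProjection a e v (fun x => K x * P x * W x) where
  coeff_zero x := by
    have h := hP.coeff_zero x
    rw [PowerSeries.coeff_zero_eq_constantCoeff_apply] at h ⊢
    rw [map_mul, map_mul, (hK x).1, (hW x).1, h]
    simp
  idem x := by
    calc K x * P x * W x * (K x * P x * W x) = K x * P x * (W x * K x) * P x * W x := by
          noncomm_ring
      _ = K x * (P x * P x) * W x := by rw [hWK]; noncomm_ring
      _ = _ := by rw [hP.idem]
  deriv k x := by
    obtain ⟨-, K', hK', hKX⟩ := hK x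
    obtain ⟨-, W', hW', hWX⟩ := hW x
    let P' : PowerSeries (Mat n) := PowerSeries.mk fun k =>
      PowerSeries.coeff (k + 1) (P x) * Matrix.diagonal a -
      Matrix.diagonal a * PowerSeries.coeff (k + 1) (P x) +
      (PowerSeries.coeff k (P x) * u x - u x * PowerSeries.coeff k (P x))
    have hP' : HasSeriesDerivAt P P' x := fun k => by simpa [P'] using hP.deriv k x
    have hPX : P' * PowerSeries.X = P x * laxSeries a (u x) - laxSeries a (u x) * P x := by
      refine PowerSeries.ext fun k => ?_
      cases k with
      | zero =>
        have h := hP.coeff_zero x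
        rw [PowerSeries.coeff_zero_eq_constantCoeff_apply] at h ⊢
        simp [laxSeries, h, he]
      | succ k => rw [PowerSeries.coeff_succ_mul_X, coeff_mul_laxSeries, PowerSeries.coeff_mk]
    have key := ((hK'.mul hP').mul hW') k
    refine key.congr_deriv ?_
    rw [← PowerSeries.coeff_succ_mul_X, ← coeff_mul_laxSeries]
    congr 1
    have hXW : ∀ φ ψ : PowerSeries (Mat n), φ * ψ * PowerSeries.X = φ * PowerSeries.X * ψ :=
      fun φ ψ => by rw [mul_assoc, ← PowerSeries.X_mul, mul_assoc]
    calc ((K' * P x + K x * P') * W x + K x * P x * W') * PowerSeries.X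
        = (K' * PowerSeries.X) * P x * W x + K x * (P' * PowerSeries.X) * W x +
            K x * P x * (W' * PowerSeries.X) := by
          rw [add_mul, hXW _ (W x), add_mul, hXW K', mul_assoc (K x) P', add_mul,
            mul_assoc (K x * P x)]
      _ = _ := by rw [hKX, hWX, hPX]; noncomm_ring

/-! ### The phase space, entry by entry -/

/-- If a_i = a_j, then E_ij - E_ji and i(E_ij + E_ji) lie in u(n)_a. The traces against them give
y_ji - y_ij = 0 and y_ji + y_ij = 0. -/
theorem centralizerPerp_apply_eq_zero {a : Fin n → ℂ} {y : Mat n} (hy : y ∈ centralizerPerp a)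
    {i j : Fin n} (hij : a i = a j) : y i j = 0 := by
  have hc : ∀ c d : ℂ, Matrix.diagonal a * (Matrix.single i j c + Matrix.single j i d) =
      (Matrix.single i j c + Matrix.single j i d) * Matrix.diagonal a := by
    intro c d
    ext k l
    simp only [Matrix.diagonal_mul, Matrix.mul_diagonal, Matrix.add_apply, Matrix.single_apply]
    split_ifs with h1 h2 h2
    · rw [← h1.1, ← h1.2, hij]; ring
    · rw [← h1.1, ← h1.2, hij]; ring
    · rw [← h2.1, ← h2.2, hij]; ring
    · ring
  have ht : ∀ c d : ℂ, ((Matrix.single i j c + Matrix.single j i d) * y).trace =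
      c * y j i + d * y i j := by
    intro c d
    rw [Matrix.add_mul, Matrix.trace_add, Matrix.trace_single_mul, Matrix.trace_single_mul,
      smul_eq_mul, smul_eq_mul]
  have hs : ∀ c d : ℂ, conj c = -d → (Matrix.single i j c + Matrix.single j i d)ᴴ =
      -(Matrix.single i j c + Matrix.single j i d) := by
    intro c d h
    have h' : conj d = -c := by rw [eq_neg_iff_add_eq_zero, ← Complex.conj_conj c, h, map_neg]; ring
    ext k l
    simp only [Matrix.conjTranspose_add, Matrix.conjTranspose_single, RCLike.star_def, h, h',
      Matrix.add_apply, Matrix.neg_apply, Matrix.single_apply]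
    split_ifs <;> ring
  have h1 := hy.2 _ (hs 1 (-1) (by simp)) (hc 1 (-1))
  have h2 := hy.2 _ (hs Complex.I Complex.I (by simp)) (hc Complex.I Complex.I)
  rw [ht] at h1 h2
  have h3 : y j i + y i j = 0 := by
    have : Complex.I * (y j i + y i j) = 0 := by rw [← h2]; ring
    simpa using this
  linear_combination (1 / 2) * h3 - (1 / 2) * h1

/-- A matrix commuting with diag(a) vanishes at the entries with a_i ≠ a_j, so every product in
tr(zy) has a zero factor. -/
theorem mem_centralizerPerp {a : Fin n → ℂ} {y : Mat n} (hy : yᴴ = -y)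
    (h : ∀ i j, a i = a j → y i j = 0) : y ∈ centralizerPerp a := by
  refine ⟨hy, fun z _ hz => ?_⟩
  simp only [Matrix.trace, Matrix.diag_apply, Matrix.mul_apply]
  refine Finset.sum_eq_zero fun i _ => Finset.sum_eq_zero fun j _ => ?_
  by_cases hij : a j = a i
  · rw [h j i hij, mul_zero]
  · have h1 := congrFun (congrFun hz i) j
    rw [Matrix.diagonal_mul, Matrix.mul_diagonal] at h1
    have h2 : (a j - a i) * z i j = 0 := by linear_combination -h1
    rcases mul_eq_zero.1 h2 with h3 | h3
    · exact absurd (sub_eq_zero.1 h3) hij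
    · rw [h3, zero_mul]

/-! ### The expansion of the reduced wave function -/

section Wave

variable {a : Fin n → ℂ} {u : ℝ → Mat n}

theorem waveOff_derivsIn (hu : IsSchwartz u) {m : ℝ → Mat n}
    (hm : ∀ r, MatDerivsIn boundedFun r m) (r : ℕ) : MatDerivsIn boundedFun r (waveOff a u m) := by
  intro i j
  simp only [waveOff, Matrix.of_apply]
  split_ifs with h
  · exact .zero
  · have h1 := ((hm r).bounded_mul_rapid (isSchwartz_iff.1 hu r)).mono rapidFun_le_boundedFun
    have h2 := ((h1 i j).sub ((hm (r + 1)).matDeriv i j)).const_mul (a i - a j)⁻¹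
    simpa only [div_eq_inv_mul] using h2

/-- Boundedness is the right class: m_k need not tend to 0 at +∞. The integrals converge because
their integrands contain the rapidly decreasing factor u. -/
theorem waveCoeff_derivsIn (hu : IsSchwartz u) (k r : ℕ) :
    MatDerivsIn boundedFun r (waveCoeff a u k) := by
  induction k generalizing r with
  | zero => exact .const 1
  | succ k ih =>
    refine (waveOff_derivsIn hu ih r).add fun i j => ?_
    simp only [Matrix.of_apply]
    split_ifs with h
    · exact (DerivsIn.integral_Iic fun r =>
        ((waveOff_derivsIn hu ih r).bounded_mul_rapid (isSchwartz_iff.1 hu r)) i j).1 r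
    · exact .zero

/-- The recursion [a, m_{k+1}] + (m_k)_x = m_k u holds at entries with a_i ≠ a_j by the choice of
`waveOff`. At entries with a_i = a_j the commutator drops out. There the block-diagonal part of m_k
contributes nothing to m_k u, since u has no block-diagonal entries; so the integral, which involves
only the remaining part, has the right derivative. -/
theorem hasMatDerivAt_waveCoeff (hu : IsSchwartz u) (hp : ∀ x, u x ∈ centralizerPerp a)
    (k : ℕ) (x : ℝ) :
    HasMatDerivAt (waveCoeff a u k) (waveCoeff a u k x * u x -
      (Matrix.diagonal a * waveCoeff a u (k + 1) x -
        waveCoeff a u (k + 1) x * Matrix.diagonal a)) x := by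
  have hd := (waveCoeff_derivsIn (a := a) hu k 1).hasMatDerivAt x
  intro i j
  by_cases hij : a i = a j
  · have h1 : (waveCoeff a u k x * u x - (Matrix.diagonal a * waveCoeff a u (k + 1) x -
        waveCoeff a u (k + 1) x * Matrix.diagonal a)) i j = (waveCoeff a u k x * u x) i j := by
      simp only [Matrix.sub_apply, Matrix.diagonal_mul, Matrix.mul_diagonal, hij]
      ring
    rw [h1]
    cases k with
    | zero =>
      have h2 : (waveCoeff a u 0 x * u x) i j = 0 := by
        simp [waveCoeff, centralizerPerp_apply_eq_zero (hp x) hij]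
      rw [h2]
      exact hasDerivAt_const _ _
    | succ k =>
      have h2 : (waveCoeff a u (k + 1) x * u x) i j =
          (waveOff a u (waveCoeff a u k) x * u x) i j := by
        simp only [waveCoeff, Matrix.add_mul, Matrix.add_apply, add_eq_left]
        rw [Matrix.mul_apply]
        refine Finset.sum_eq_zero fun l _ => ?_
        simp only [Matrix.of_apply]
        split_ifs with hl
        · rw [centralizerPerp_apply_eq_zero (hp x) (hl.symm.trans hij), mul_zero]
        · rw [zero_mul]
      have h3 := (DerivsIn.integral_Iic fun r => ((waveOff_derivsIn (a := a) hu
        (waveCoeff_derivsIn (a := a) hu k) r).bounded_mul_rapid (isSchwartz_iff.1 hu r)) i j).2 x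
      have h4 : (fun y => waveCoeff a u (k + 1) y i j) =
          fun y => ∫ z in Set.Iic y, (waveOff a u (waveCoeff a u k) z * u z) i j := by
        ext y
        simp [waveCoeff, waveOff, hij]
      rw [h2, h4]
      exact h3
  · refine (hd i j).congr_deriv ?_
    have h5 : a i - a j ≠ 0 := sub_ne_zero.2 hij
    have h6 : waveCoeff a u (k + 1) x i j = ((waveCoeff a u k x * u x) i j -
        matDeriv (waveCoeff a u k) x i j) / (a i - a j) := by
      simp [waveCoeff, waveOff, hij]
    simp only [Matrix.sub_apply, Matrix.diagonal_mul, Matrix.mul_diagonal, h6]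
    field_simp
    ring

/-- The wave function undresses u: it takes aλ + u to the free operator aλ, for which commuting
projections are constants. -/
theorem isGauge_waveSeries (hu : IsSchwartz u) (hp : ∀ x, u x ∈ centralizerPerp a) :
    IsGauge a u 0 (waveSeries a u) := by
  intro x
  refine ⟨by simp [waveSeries, waveCoeff], PowerSeries.mk fun k => waveCoeff a u k x * u x -
      (Matrix.diagonal a * waveCoeff a u (k + 1) x -
        waveCoeff a u (k + 1) x * Matrix.diagonal a), fun k => ?_, ?_⟩
  · simpa [waveSeries] using hasMatDerivAt_waveCoeff hu hp k x
  · refine PowerSeries.ext fun k => ?_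
    have h : waveSeries a u x * laxSeries a (u x) - laxSeries a ((0 : ℝ → Mat n) x) *
        waveSeries a u x = waveSeries a u x * PowerSeries.C (Matrix.diagonal a) -
        PowerSeries.C (Matrix.diagonal a) * waveSeries a u x +
        waveSeries a u x * PowerSeries.C (u x) * PowerSeries.X := by
      simp only [laxSeries, Pi.zero_apply, map_zero]
      noncomm_ring
    rw [h]
    cases k with
    | zero => simp [waveSeries, waveCoeff]
    | succ k =>
      rw [PowerSeries.coeff_succ_mul_X, map_add, PowerSeries.coeff_succ_mul_X]
      simp only [map_sub, PowerSeries.coeff_mul_C, PowerSeries.coeff_C_mul, waveSeries,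
        PowerSeries.coeff_mk]
      abel

end Wave

/-! ### Spectral projections -/

/-- The spectral projection of `diag(a₁, …, aₙ)` for the eigenvalue `c`. -/
def specProj (a : Fin n → ℂ) (c : ℂ) : Mat n := Matrix.diagonal fun i => if a i = c then 1 else 0

theorem specProj_mul_self (a : Fin n → ℂ) (c : ℂ) : specProj a c * specProj a c = specProj a c := by
  simp [specProj, Matrix.diagonal_mul_diagonal]

theorem specProj_comm (a : Fin n → ℂ) (c : ℂ) :
    specProj a c * Matrix.diagonal a = Matrix.diagonal a * specProj a c := by
  simp [specProj, Matrix.diagonal_mul_diagonal, mul_comm]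

theorem conjTranspose_specProj (a : Fin n → ℂ) (c : ℂ) : (specProj a c)ᴴ = specProj a c := by
  rw [specProj, Matrix.diagonal_conjTranspose]
  congr 1
  ext i
  by_cases h : a i = c <;> simp [h]

/-- The power series `m⁻¹ e m`, where `e` is a spectral projection of `diag(a₁, …, aₙ)`. -/
def projSeries (a : Fin n → ℂ) (c : ℂ) (u : ℝ → Mat n) (x : ℝ) : PowerSeries (Mat n) :=
  PowerSeries.invOfUnit (waveSeries a u x) 1 * PowerSeries.C (specProj a c) * waveSeries a u x

/-- The constant e commutes with ∂ + aλ; conjugation by the gauge transformation m⁻¹ transports it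
from potential 0 to u. -/
theorem isLaxProjection_projSeries {a : Fin n → ℂ} (c : ℂ) {u : ℝ → Mat n} (hu : IsSchwartz u)
    (hp : ∀ x, u x ∈ centralizerPerp a) :
    IsLaxProjection a (specProj a c) u (projSeries a c u) := by
  have hg := isGauge_waveSeries hu hp
  have h0 : IsLaxProjection a (specProj a c) 0 fun _ => PowerSeries.C (specProj a c) :=
    { coeff_zero := fun x => by simp
      idem := fun x => by rw [← map_mul, specProj_mul_self]
      deriv := fun k x => by
        refine (HasMatDerivAt.const _ x).congr_deriv ?_
        simp [PowerSeries.coeff_succ_C] }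
  exact h0.conj (specProj_comm a c) hg.inv hg fun x => PowerSeries.mul_invOfUnit _ _ (hg x).1

theorem conjTranspose_diagonal {a : Fin n → ℂ} (ha : ∀ i, (a i).re = 0) :
    (Matrix.diagonal a)ᴴ = -Matrix.diagonal a := by
  rw [Matrix.diagonal_conjTranspose]
  ext i j
  rw [Matrix.neg_apply, Matrix.diagonal_apply, Matrix.diagonal_apply]
  split_ifs
  · apply Complex.ext <;> simp [ha i]
  · simp

/-! ### Lax projections are determined by local formulas -/

section Local

variable {a : Fin n → ℂ} {c : ℂ} {u : ℝ → Mat n} {P P' : ℝ → PowerSeries (Mat n)}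

namespace IsLaxProjection

/-- At these entries the commutator with a in the equation for the derivative of coefficient k can
be inverted. -/
theorem coeff_succ_of_ne (hP : IsLaxProjection a (specProj a c) u P) (k : ℕ) (x : ℝ) {i j : Fin n}
    (hij : a i ≠ a j) : PowerSeries.coeff (k + 1) (P x) i j =
      (_root_.deriv (fun y => PowerSeries.coeff k (P y) i j) x -
        (PowerSeries.coeff k (P x) * u x - u x * PowerSeries.coeff k (P x)) i j) *
          (a j - a i)⁻¹ := by
  rw [(hP.deriv k x i j).deriv, Matrix.add_apply, add_sub_cancel_right, Matrix.sub_apply,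
    Matrix.mul_diagonal, Matrix.diagonal_mul]
  have : a j - a i ≠ 0 := sub_ne_zero.2 hij.symm
  field_simp

/-- Order k + 1 of P² = P reads P_{k+1} e + e P_{k+1} + (products of lower coefficients) = P_{k+1}.
At entries with a_i = a_j, e acts on both sides as 1 or on both sides as 0, whence the sign. No
integration occurs, so m⁻¹ e m is local in u although m is not. -/
theorem coeff_succ_of_eq (hP : IsLaxProjection a (specProj a c) u P) (k : ℕ) (x : ℝ) {i j : Fin n}
    (hij : a i = a j) : PowerSeries.coeff (k + 1) (P x) i j =
      (if a i = c then -1 else 1) * (∑ l ∈ Finset.range k,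
        PowerSeries.coeff (l + 1) (P x) * PowerSeries.coeff (k - l) (P x)) i j := by
  have h1 := congrArg (PowerSeries.coeff (k + 1)) (hP.idem x)
  rw [PowerSeries.coeff_mul, Finset.Nat.sum_antidiagonal_eq_sum_range_succ
    (fun p q => PowerSeries.coeff p (P x) * PowerSeries.coeff q (P x)), Finset.sum_range_succ,
    Finset.sum_range_succ'] at h1
  simp only [Nat.sub_self, Nat.sub_zero, hP.coeff_zero, Nat.add_sub_add_right] at h1
  have h2 := congrFun (congrFun h1 i) j
  simp only [Matrix.add_apply, specProj, Matrix.diagonal_mul, Matrix.mul_diagonal] at h2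
  rw [← hij] at h2
  split_ifs at h2 ⊢ with h
  · linear_combination h2
  · linear_combination -h2

/-- The two recursions leave no constants of integration. Gauge relations can thus be transferred to
`projSeries` without following the normalization of the wave functions at -∞. -/
theorem unique (hP : IsLaxProjection a (specProj a c) u P)
    (hP' : IsLaxProjection a (specProj a c) u P') : P = P' := by
  have h : ∀ k x, PowerSeries.coeff k (P x) = PowerSeries.coeff k (P' x) := by
    intro k
    induction k using Nat.strong_induction_on with
    | _ k ih =>
      intro x
      cases k with
      | zero => rw [hP.coeff_zero, hP'.coeff_zero]
      | succ k =>
        ext i j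
        by_cases hij : a i = a j
        · rw [hP.coeff_succ_of_eq k x hij, hP'.coeff_succ_of_eq k x hij]
          have hsum : ∑ l ∈ Finset.range k,
              PowerSeries.coeff (l + 1) (P x) * PowerSeries.coeff (k - l) (P x) =
              ∑ l ∈ Finset.range k,
                PowerSeries.coeff (l + 1) (P' x) * PowerSeries.coeff (k - l) (P' x) := by
            refine Finset.sum_congr rfl fun l hl => ?_
            have hl := Finset.mem_range.1 hl
            rw [ih (l + 1) (by omega), ih (k - l) (by omega)]
          rw [hsum]
        · rw [hP.coeff_succ_of_ne k x hij, hP'.coeff_succ_of_ne k x hij]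
          simp only [ih k (by omega)]
  exact funext fun x => PowerSeries.ext fun k => h k x

theorem conjTranspose (ha : ∀ i, (a i).re = 0) (hu : ∀ x, (u x)ᴴ = -u x)
    (hP : IsLaxProjection a (specProj a c) u P) :
    IsLaxProjection a (specProj a c) u
      (fun x => PowerSeries.mk fun k => (PowerSeries.coeff k (P x))ᴴ) where
  coeff_zero x := by simp [hP.coeff_zero, conjTranspose_specProj]
  idem x := by
    refine PowerSeries.ext fun k => ?_
    conv_rhs => rw [PowerSeries.coeff_mk, ← hP.idem x]
    rw [PowerSeries.coeff_mul, PowerSeries.coeff_mul, Matrix.conjTranspose_sum,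
      ← Finset.Nat.sum_antidiagonal_swap]
    simp
  deriv k x := by
    have haH := conjTranspose_diagonal ha
    simp only [PowerSeries.coeff_mk]
    refine (hP.deriv k x).conjTranspose.congr_deriv ?_
    simp only [Matrix.conjTranspose_add, Matrix.conjTranspose_sub, Matrix.conjTranspose_mul, haH,
      hu x]
    noncomm_ring

/-- The adjoint series is a Lax projection for the same u and e, so uniqueness applies. -/
theorem coeff_conjTranspose (ha : ∀ i, (a i).re = 0) (hu : ∀ x, (u x)ᴴ = -u x)
    (hP : IsLaxProjection a (specProj a c) u P) (k : ℕ) (x : ℝ) :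
    (PowerSeries.coeff k (P x))ᴴ = PowerSeries.coeff k (P x) := by
  conv_rhs => rw [hP.unique (hP.conjTranspose ha hu)]
  simp

end IsLaxProjection

theorem contDiff_deriv_fst {f : ℝ × ℝ → ℂ} (hf : ContDiff ℝ ∞ f) :
    ContDiff ℝ ∞ fun p : ℝ × ℝ => deriv (fun y => f (y, p.2)) p.1 := by
  have h : (fun p : ℝ × ℝ => deriv (fun y => f (y, p.2)) p.1) = fun p => fderiv ℝ f p (1, 0) := by
    ext p
    have h1 : HasFDerivAt f (fderiv ℝ f p) p := (hf.differentiable (by simp) p).hasFDerivAt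
    have h2 : HasDerivAt (fun y : ℝ => (y, p.2)) ((1 : ℝ), (0 : ℝ)) p.1 :=
      (hasDerivAt_id _).prodMk (hasDerivAt_const _ _)
    exact (h1.comp_hasDerivAt p.1 h2).deriv
  rw [h]
  exact (hf.fderiv_right (m := ∞) (by simp)).clm_apply contDiff_const

theorem contDiff_mul_apply {F G : ℝ × ℝ → Mat n} {m : WithTop ℕ∞}
    (hF : ∀ i j, ContDiff ℝ m fun p => F p i j)
    (hG : ∀ i j, ContDiff ℝ m fun p => G p i j) (i j : Fin n) :
    ContDiff ℝ m fun p => (F p * G p) i j := by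
  simp only [Matrix.mul_apply]
  exact ContDiff.sum fun k _ => (hF i k).mul (hG k j)

/-- Joint smoothness is read off the local recursions. The integrals from -∞ in `waveCoeff` would
call for decay uniform in t, whereas the Schwartz condition is imposed for each t separately. -/
theorem IsLaxProjection.contDiff {u : ℝ → ℝ → Mat n} {P : ℝ → ℝ → PowerSeries (Mat n)}
    (hu : ∀ i j, ContDiff ℝ ∞ fun p : ℝ × ℝ => u p.1 p.2 i j)
    (hP : ∀ t, IsLaxProjection a (specProj a c) (fun x => u x t) (fun x => P x t)) (k : ℕ)
    (i j : Fin n) : ContDiff ℝ ∞ fun p : ℝ × ℝ => PowerSeries.coeff k (P p.1 p.2) i j := by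
  induction k using Nat.strong_induction_on generalizing i j with
  | _ k ih =>
    cases k with
    | zero =>
      have h : (fun p : ℝ × ℝ => PowerSeries.coeff 0 (P p.1 p.2) i j) =
          fun _ => specProj a c i j := funext fun p => by rw [(hP p.2).coeff_zero]
      rw [h]
      exact contDiff_const
    | succ k =>
      by_cases hij : a i = a j
      · simp only [fun p : ℝ × ℝ => (hP p.2).coeff_succ_of_eq k p.1 hij, Matrix.sum_apply]
        refine contDiff_const.mul (ContDiff.sum fun l hl => ?_)
        have hl := Finset.mem_range.1 hl
        exact contDiff_mul_apply (ih (l + 1) (by omega)) (ih (k - l) (by omega)) i j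
      · simp only [fun p : ℝ × ℝ => (hP p.2).coeff_succ_of_ne k p.1 hij]
        have hk := ih k (by omega)
        exact ((contDiff_deriv_fst (hk i j)).sub ((contDiff_mul_apply hk hu i j).sub
          (contDiff_mul_apply hu hk i j))).mul contDiff_const

/-- Dressing of Lax projections by `λ + S`. -/
theorem projSeries_darboux {u v S : ℝ → Mat n} (hu : IsSchwartz u)
    (hpu : ∀ x, u x ∈ centralizerPerp a) (hv : IsSchwartz v) (hpv : ∀ x, v x ∈ centralizerPerp a)
    (hS : ∀ x, HasMatDerivAt S (S x * u x - v x * S x) x)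
    (huv : ∀ x, v x = u x + (S x * Matrix.diagonal a - Matrix.diagonal a * S x)) (k : ℕ) (x : ℝ) :
    PowerSeries.coeff (k + 1) (projSeries a c v x) + PowerSeries.coeff k (projSeries a c v x) * S x =
      PowerSeries.coeff (k + 1) (projSeries a c u x) +
        S x * PowerSeries.coeff k (projSeries a c u x) := by
  -- This is λ⁻¹(λ + S). The coefficients of the gauge condition are exactly `hS` and `huv`.
  let K : ℝ → PowerSeries (Mat n) := fun x => 1 + PowerSeries.C (S x) * PowerSeries.X
  have hK : IsGauge a u v K := by
    intro x
    refine ⟨by simp [K], PowerSeries.C (S x * u x - v x * S x) * PowerSeries.X, fun k => ?_, ?_⟩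
    · cases k with
      | zero => simpa [K] using HasMatDerivAt.const 1 x
      | succ k =>
        simp only [K, map_add, PowerSeries.coeff_succ_mul_X, PowerSeries.coeff_one]
        cases k with
        | zero => simpa using hS x
        | succ k => simpa [PowerSeries.coeff_succ_C] using HasMatDerivAt.const 0 x
    · have hX : ∀ M N : Mat n, PowerSeries.C M * PowerSeries.X * PowerSeries.C N =
          PowerSeries.C M * PowerSeries.C N * PowerSeries.X := fun M N => by
        rw [mul_assoc, PowerSeries.X_mul, mul_assoc]
      have hX' : ∀ M N : Mat n, PowerSeries.C M * PowerSeries.X * (PowerSeries.C N * PowerSeries.X) =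
          PowerSeries.C M * PowerSeries.C N * PowerSeries.X * PowerSeries.X := fun M N => by
        rw [← mul_assoc, hX]
      simp only [K, laxSeries, mul_add, add_mul, hX, hX', one_mul, mul_one]
      rw [huv x]
      simp only [map_add, map_sub, map_mul, sub_mul, add_mul, mul_assoc]
      abel
  have h := (isLaxProjection_projSeries c hu hpu).conj (specProj_comm a c) hK hK.inv
    fun x => PowerSeries.invOfUnit_mul _ _ (hK x).1
  have h1 := congrFun ((isLaxProjection_projSeries c hv hpv).unique h) x
  have h2 : projSeries a c v x * K x = K x * projSeries a c u x := by
    rw [h1, mul_assoc, PowerSeries.invOfUnit_mul _ _ (hK x).1, mul_one]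
  have h3 := congrArg (PowerSeries.coeff (k + 1)) h2
  have h4 : PowerSeries.C (S x) * PowerSeries.X * projSeries a c u x =
      PowerSeries.C (S x) * projSeries a c u x * PowerSeries.X := by
    rw [mul_assoc, PowerSeries.X_mul, mul_assoc]
  simp only [K, mul_add, add_mul, mul_one, one_mul, h4, ← mul_assoc, map_add,
    PowerSeries.coeff_succ_mul_X, PowerSeries.coeff_mul_C, PowerSeries.coeff_C_mul] at h3
  exact h3

end Local

/-! ### Properties of `Q` -/

/-- `b` is a combination `∑ β_c e_c`, with imaginary coefficients, of the spectral projections of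
`diag(a₁, …, aₙ)`. -/
def IsSpectral (a : Fin n → ℂ) (b : Mat n) : Prop :=
  ∃ (s : Finset ℂ) (β : ℂ → ℂ), (∀ c ∈ s, conj (β c) = -β c) ∧ b = ∑ c ∈ s, β c • specProj a c

/-- A polynomial in diag(a) is diagonal with entries p(a_i), hence constant on the eigenspaces of a,
and skew-adjointness makes the values imaginary. This splits Q_{b,k} into coefficients of the series
m⁻¹ e m, for which idempotency is available. -/
theorem isSpectral_aeval {a : Fin n → ℂ} {b : Mat n} (hb : bᴴ = -b) {p : Polynomial ℂ}
    (hp : b = Polynomial.aeval (Matrix.diagonal a) p) : IsSpectral a b := by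
  have h1 : b = Matrix.diagonal fun i => p.eval (a i) := by
    rw [hp]
    have h := Polynomial.aeval_algHom_apply (Matrix.diagonalAlgHom ℂ (n := Fin n) (α := ℂ)) a p
    rw [Matrix.diagonalAlgHom_apply] at h
    rw [h, Matrix.diagonalAlgHom_apply]
    congr 1
    ext i
    have h2 := Polynomial.aeval_algHom_apply (Pi.evalAlgHom ℂ (fun _ : Fin n => ℂ) i) a p
    simp only [Pi.evalAlgHom_apply] at h2
    rw [← h2, Polynomial.coe_aeval_eq_eval]
  refine ⟨Finset.univ.image a, fun c => p.eval c, fun c hc => ?_, ?_⟩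
  · obtain ⟨i, -, rfl⟩ := Finset.mem_image.1 hc
    have h2 := congrFun (congrFun hb i) i
    rw [h1] at h2
    simpa using h2
  · rw [h1]
    ext i j
    simp only [Matrix.sum_apply, Matrix.smul_apply, specProj, Matrix.diagonal_apply, smul_eq_mul]
    split_ifs with hij
    · rw [Finset.sum_eq_single (a i)]
      · simp
      · intro c _ hc
        rw [if_neg hc.symm, mul_zero]
      · intro h
        exact absurd (Finset.mem_image_of_mem a (Finset.mem_univ i)) h
    · simp

section Q

variable {a : Fin n → ℂ} {b : Mat n} {u : ℝ → Mat n}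

theorem Q_sum (s : Finset ℂ) (β : ℂ → ℂ) (k : ℕ) (x : ℝ) :
    Q a (∑ c ∈ s, β c • specProj a c) u k x =
      ∑ c ∈ s, β c • PowerSeries.coeff k (projSeries a c u x) := by
  have h : ∀ (z : ℂ) (M : Mat n), PowerSeries.C (z • M) = z • PowerSeries.C M := fun z M => by
    refine PowerSeries.ext fun k => ?_
    cases k <;> simp [PowerSeries.coeff_C]
  simp only [Q, map_sum, Finset.mul_sum, Finset.sum_mul, projSeries]
  refine Finset.sum_congr rfl fun c _ => ?_
  rw [h, mul_smul_comm, smul_mul_assoc, PowerSeries.coeff_smul]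

theorem Q_zero (hb : IsSpectral a b) (hu : IsSchwartz u) (hp : ∀ x, u x ∈ centralizerPerp a)
    (x : ℝ) : Q a b u 0 x = b := by
  obtain ⟨s, β, -, rfl⟩ := hb
  simp only [Q_sum, (isLaxProjection_projSeries _ hu hp).coeff_zero]

theorem hasMatDerivAt_Q (hb : IsSpectral a b) (hu : IsSchwartz u)
    (hp : ∀ x, u x ∈ centralizerPerp a) (k : ℕ) (x : ℝ) :
    HasMatDerivAt (Q a b u k) (Q a b u (k + 1) x * Matrix.diagonal a -
      Matrix.diagonal a * Q a b u (k + 1) x + (Q a b u k x * u x - u x * Q a b u k x)) x := by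
  obtain ⟨s, β, -, rfl⟩ := hb
  have h : HasMatDerivAt (fun x => ∑ c ∈ s, β c • PowerSeries.coeff k (projSeries a c u x)) _ x :=
    .sum fun c _ => ((isLaxProjection_projSeries c hu hp).deriv k x).const_smul (β c)
  rw [show Q a (∑ c ∈ s, β c • specProj a c) u k =
    fun x => ∑ c ∈ s, β c • PowerSeries.coeff k (projSeries a c u x) from funext (Q_sum s β k)]
  refine h.congr_deriv ?_
  simp only [Q_sum, Finset.sum_mul, Finset.mul_sum, smul_add, smul_sub, Finset.sum_add_distrib,
    Finset.sum_sub_distrib, Matrix.smul_mul, Matrix.mul_smul]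

theorem conjTranspose_Q (ha : ∀ i, (a i).re = 0) (hb : IsSpectral a b) (hu : IsSchwartz u)
    (hp : ∀ x, u x ∈ centralizerPerp a) (k : ℕ) (x : ℝ) : (Q a b u k x)ᴴ = -Q a b u k x := by
  obtain ⟨s, β, hβ, rfl⟩ := hb
  rw [Q_sum, Matrix.conjTranspose_sum, ← Finset.sum_neg_distrib]
  refine Finset.sum_congr rfl fun c hc => ?_
  rw [Matrix.conjTranspose_smul, (isLaxProjection_projSeries c hu hp).coeff_conjTranspose ha
    fun x => (hp x).1]
  rw [RCLike.star_def, hβ c hc, neg_smul]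

theorem contDiff_Q (hb : IsSpectral a b) {u : ℝ → ℝ → Mat n}
    (hu : ∀ i j, ContDiff ℝ ∞ fun p : ℝ × ℝ => u p.1 p.2 i j)
    (hs : ∀ t, IsSchwartz fun x => u x t) (hp : ∀ x t, u x t ∈ centralizerPerp a) (k : ℕ)
    (i j : Fin n) : ContDiff ℝ ∞ fun p : ℝ × ℝ => Q a b (fun x => u x p.2) k p.1 i j := by
  obtain ⟨s, β, -, rfl⟩ := hb
  simp only [Q_sum, Matrix.sum_apply, Matrix.smul_apply]
  refine ContDiff.sum fun c _ => ContDiff.const_smul _ ?_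
  exact IsLaxProjection.contDiff (P := fun x t => projSeries a c (fun y => u y t) x) hu
    (fun t => isLaxProjection_projSeries c (hs t) fun x => hp x t) k i j

theorem Q_darboux (hb : IsSpectral a b) {u v S : ℝ → Mat n} (hu : IsSchwartz u)
    (hpu : ∀ x, u x ∈ centralizerPerp a) (hv : IsSchwartz v) (hpv : ∀ x, v x ∈ centralizerPerp a)
    (hS : ∀ x, HasMatDerivAt S (S x * u x - v x * S x) x)
    (huv : ∀ x, v x = u x + (S x * Matrix.diagonal a - Matrix.diagonal a * S x)) (k : ℕ) (x : ℝ) :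
    Q a b v (k + 1) x + Q a b v k x * S x = Q a b u (k + 1) x + S x * Q a b u k x := by
  obtain ⟨s, β, -, rfl⟩ := hb
  simp only [Q_sum, Finset.sum_mul, Finset.mul_sum, Matrix.smul_mul, Matrix.mul_smul,
    ← Finset.sum_add_distrib, ← smul_add, projSeries_darboux hu hpu hv hpv hS huv k x]

end Q

/-! ### The time component of the connection -/

/-- The polynomial `q₀ λ^j + q₁ λ^{j-1} + ⋯ + q_j`. -/
def timeOp (q : ℕ → Mat n) (j : ℕ) (l : ℂ) : Mat n := ∑ k ∈ Finset.range (j + 1), l ^ (j - k) • q k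

theorem timeOp_zero (q : ℕ → Mat n) (l : ℂ) : timeOp q 0 l = q 0 := by simp [timeOp]

theorem timeOp_succ (q : ℕ → Mat n) (j : ℕ) (l : ℂ) :
    timeOp q (j + 1) l = l • timeOp q j l + q (j + 1) := by
  rw [timeOp, Finset.sum_range_succ, timeOp, Finset.smul_sum]
  simp only [Nat.sub_self, pow_zero, one_smul]
  congr 1
  refine Finset.sum_congr rfl fun k hk => ?_
  have hk := Finset.mem_range.1 hk
  rw [smul_smul, ← pow_succ', show j - k + 1 = j + 1 - k by omega]

theorem conjTranspose_timeOp {q : ℕ → Mat n} (hq : ∀ k, (q k)ᴴ = -q k) (j : ℕ) (l : ℂ) :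
    (timeOp q j (conj l))ᴴ = -timeOp q j l := by
  simp [timeOp, Matrix.conjTranspose_sum, Matrix.conjTranspose_smul, hq]

/-- A telescoping sum: [q_{k+1}, a] in the derivative of q_k matches the commutator of q_{k+1} with
aλ, and `h0` handles the highest power of λ. Only [q_{j+1}, a], one index beyond the truncation, is
left over. -/
theorem hasMatDerivAt_timeOp {a : Fin n → ℂ} {u : ℝ → Mat n} {q : ℕ → ℝ → Mat n} {x : ℝ}
    (h0 : q 0 x * Matrix.diagonal a = Matrix.diagonal a * q 0 x)
    (hq : ∀ k, HasMatDerivAt (q k) (q (k + 1) x * Matrix.diagonal a -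
      Matrix.diagonal a * q (k + 1) x + (q k x * u x - u x * q k x)) x) (j : ℕ) (l : ℂ) :
    HasMatDerivAt (fun x => timeOp (fun k => q k x) j l)
      (timeOp (fun k => q k x) j l * (l • Matrix.diagonal a + u x) -
        (l • Matrix.diagonal a + u x) * timeOp (fun k => q k x) j l +
        (q (j + 1) x * Matrix.diagonal a - Matrix.diagonal a * q (j + 1) x)) x := by
  induction j with
  | zero =>
    simp only [timeOp_zero]
    refine (hq 0).congr_deriv ?_
    rw [Matrix.mul_add, Matrix.add_mul, Matrix.mul_smul, Matrix.smul_mul, h0]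
    abel
  | succ j ih =>
    simp only [timeOp_succ]
    refine ((ih.const_smul l).add (hq (j + 1))).congr_deriv ?_
    simp only [Matrix.mul_add, Matrix.add_mul, Matrix.mul_smul, Matrix.smul_mul, smul_add, smul_sub]
    abel

/-- The difference of two values of a polynomial in `λ`. -/
theorem timeOp_sub (q : ℕ → Mat n) (j : ℕ) (l l' : ℂ) :
    timeOp q j l' - timeOp q j l = (l' - l) • ∑ k ∈ Finset.range (j + 1),
      (∑ i ∈ Finset.range (j - k), l' ^ i * l ^ (j - k - 1 - i)) • q k := by
  rw [timeOp, timeOp, ← Finset.sum_sub_distrib, Finset.smul_sum]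
  refine Finset.sum_congr rfl fun k _ => ?_
  rw [smul_smul, mul_comm, geom_sum₂_mul, sub_smul]

/-- Continuous partial derivatives give a Fréchet derivative, which is assembled from f₁ and f₂ and
so is as smooth as they are. This gain of one order drives the bootstrap for linear systems. -/
theorem contDiff_of_partial {f f₁ f₂ : ℝ → ℝ → ℂ} {m : ℕ}
    (h₁ : ∀ x t, HasDerivAt (fun y => f y t) (f₁ x t) x)
    (h₂ : ∀ x t, HasDerivAt (fun s => f x s) (f₂ x t) t)
    (hc₁ : ContDiff ℝ m fun p : ℝ × ℝ => f₁ p.1 p.2)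
    (hc₂ : ContDiff ℝ m fun p : ℝ × ℝ => f₂ p.1 p.2) :
    ContDiff ℝ (m + 1) fun p : ℝ × ℝ => f p.1 p.2 := by
  let L : ℂ → ℝ →L[ℝ] ℂ := fun z => (1 : ℝ →L[ℝ] ℝ).smulRight z
  have hL : ∀ {g : ℝ × ℝ → ℂ}, ContDiff ℝ m g → ContDiff ℝ m fun p => L (g p) := fun hg =>
    contDiff_const.smulRight hg
  rw [contDiff_succ_iff_hasFDerivAt]
  refine ⟨fun p => (L (f₁ p.1 p.2)).coprod (L (f₂ p.1 p.2)), ?_, fun p => ?_⟩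
  · have h : (fun p : ℝ × ℝ => (L (f₁ p.1 p.2)).coprod (L (f₂ p.1 p.2))) = fun p =>
        (ContinuousLinearMap.fst ℝ ℝ ℝ).smulRight (f₁ p.1 p.2) +
          (ContinuousLinearMap.snd ℝ ℝ ℝ).smulRight (f₂ p.1 p.2) := by
      ext p <;> simp [L]
    rw [h]
    exact (contDiff_const.smulRight hc₁).add (contDiff_const.smulRight hc₂)
  · exact (hasStrictFDerivAt_uncurry_coprod (f := f) (f₁ := fun x t => L (f₁ x t))
      (f₂ := fun x t => L (f₂ x t))
      (Eventually.of_forall fun v => (h₁ v.1 v.2).hasFDerivAt)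
      (Eventually.of_forall fun v => (h₂ v.1 v.2).hasFDerivAt)
      (hL hc₁).continuous.continuousAt (hL hc₂).continuous.continuousAt).hasFDerivAt

/-- A continuous solution of `E_x = E A`, `E_t = E B` with smooth `A`, `B` is smooth. -/
theorem contDiff_of_linear_system {E A B : ℝ → ℝ → Mat n}
    (hc : ∀ i j, Continuous fun p : ℝ × ℝ => E p.1 p.2 i j)
    (hA : ∀ i j, ContDiff ℝ ∞ fun p : ℝ × ℝ => A p.1 p.2 i j)
    (hB : ∀ i j, ContDiff ℝ ∞ fun p : ℝ × ℝ => B p.1 p.2 i j)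
    (hx : ∀ x t, HasMatDerivAt (fun y => E y t) (E x t * A x t) x)
    (ht : ∀ x t, HasMatDerivAt (fun s => E x s) (E x t * B x t) t) (i j : Fin n) :
    ContDiff ℝ ∞ fun p : ℝ × ℝ => E p.1 p.2 i j := by
  rw [contDiff_infty]
  intro m
  induction m generalizing i j with
  | zero => exact contDiff_zero.2 (hc i j)
  | succ m ih =>
    exact contDiff_of_partial (fun x t => hx x t i j) (fun x t => ht x t i j)
      (contDiff_mul_apply (F := fun p => E p.1 p.2) (G := fun p => A p.1 p.2) ih
        (fun i j => contDiff_infty.1 (hA i j) m) i j)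
      (contDiff_mul_apply (F := fun p => E p.1 p.2) (G := fun p => B p.1 p.2) ih
        (fun i j => contDiff_infty.1 (hB i j) m) i j)

/-! ### Trivializations -/

section Trivialization

variable {a : Fin n → ℂ} {b : Mat n} {j : ℕ} {u : ℝ → ℝ → Mat n}

/-- The time component of the connection of `u`. -/
def flowOp (a : Fin n → ℂ) (b : Mat n) (j : ℕ) (u : ℝ → ℝ → Mat n) (x t : ℝ) (l : ℂ) : Mat n :=
  timeOp (fun k => Q a b (fun y => u y t) k x) j l

theorem specProj_sum_comm (hb : IsSpectral a b) :
    b * Matrix.diagonal a = Matrix.diagonal a * b := by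
  obtain ⟨s, β, -, rfl⟩ := hb
  simp only [Finset.sum_mul, Finset.mul_sum, Matrix.smul_mul, Matrix.mul_smul, specProj_comm]

/-- Since (Q_j)_x = [Q_{j+1}, a] + [Q_j, u], the right-hand side of the flow collapses to [Q_{j+1},
a]. -/
theorem IsSolution.flow' (hb : IsSpectral a b) (hu : IsSolution a b j u) (x t : ℝ) :
    HasMatDerivAt (fun s => u x s) (Q a b (fun y => u y t) (j + 1) x * Matrix.diagonal a -
      Matrix.diagonal a * Q a b (fun y => u y t) (j + 1) x) t := by
  refine (hu.flow x t).congr_deriv ?_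
  rw [(hasMatDerivAt_Q hb (hu.schwartz t) (fun x => hu.mem_perp x t) j x).matDeriv]
  abel

/-- Zero curvature: by `IsSolution.flow'` the last commutator is u_t, so the connection with
components aλ + u and `flowOp` is flat. -/
theorem IsSolution.flowOp_deriv (hb : IsSpectral a b) (hu : IsSolution a b j u) (x t : ℝ) (l : ℂ) :
    HasMatDerivAt (fun x => flowOp a b j u x t l)
      (flowOp a b j u x t l * (l • Matrix.diagonal a + u x t) -
        (l • Matrix.diagonal a + u x t) * flowOp a b j u x t l +
        (Q a b (fun y => u y t) (j + 1) x * Matrix.diagonal a -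
          Matrix.diagonal a * Q a b (fun y => u y t) (j + 1) x)) x := by
  have hp := fun x => hu.mem_perp x t
  refine hasMatDerivAt_timeOp (u := fun x => u x t) ?_
    (hasMatDerivAt_Q hb (hu.schwartz t) hp · x) j l
  rw [Q_zero hb (hu.schwartz t) hp]
  exact specProj_sum_comm hb

theorem IsSolution.contDiff_Q (hb : IsSpectral a b) (hu : IsSolution a b j u) (k : ℕ)
    (i i' : Fin n) : ContDiff ℝ ∞ fun p : ℝ × ℝ => Q a b (fun x => u x p.2) k p.1 i i' :=
  UnHierarchy.contDiff_Q hb hu.smooth hu.schwartz hu.mem_perp k i i'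

theorem IsSolution.contDiff_flowOp (hb : IsSpectral a b) (hu : IsSolution a b j u) (l : ℂ)
    (i i' : Fin n) : ContDiff ℝ ∞ fun p : ℝ × ℝ => flowOp a b j u p.1 p.2 l i i' := by
  simp only [flowOp, timeOp, Matrix.sum_apply, Matrix.smul_apply]
  exact ContDiff.sum fun k _ => (hu.contDiff_Q hb k i i').const_smul _

theorem IsSolution.conjTranspose_flowOp (ha : ∀ i, (a i).re = 0) (hb : IsSpectral a b)
    (hu : IsSolution a b j u) (x t : ℝ) (l : ℂ) :
    (flowOp a b j u x t (conj l))ᴴ = -flowOp a b j u x t l :=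
  conjTranspose_timeOp (fun k => conjTranspose_Q ha hb (hu.schwartz t)
    (fun x => hu.mem_perp x t) k x) j l

theorem IsSolution.conjTranspose_lax (ha : ∀ i, (a i).re = 0)
    (hu : IsSolution a b j u) (x t : ℝ) (l : ℂ) :
    (conj l • Matrix.diagonal a + u x t)ᴴ = -(l • Matrix.diagonal a + u x t) := by
  rw [Matrix.conjTranspose_add, Matrix.conjTranspose_smul, conjTranspose_diagonal ha,
    (hu.mem_perp x t).1]
  simp only [RCLike.star_def, Complex.conj_conj, smul_neg]
  abel

section

variable {E : ℝ → ℝ → ℂ → Mat n}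

/-- The connection is skew-adjoint under λ ↦ λ̄, so E(λ̄)* satisfies the equation of E(λ)⁻¹. It
serves as the inverse throughout. -/
theorem IsTrivialization.inv_deriv_x (ha : ∀ i, (a i).re = 0) (hu : IsSolution a b j u)
    (hE : IsTrivialization a b j u E) (x t : ℝ) (l : ℂ) :
    HasMatDerivAt (fun y => (E y t (conj l))ᴴ)
      (-((l • Matrix.diagonal a + u x t) * (E x t (conj l))ᴴ)) x := by
  refine (hE.deriv_x x t (conj l)).conjTranspose.congr_deriv ?_
  rw [Matrix.conjTranspose_mul, hu.conjTranspose_lax ha, Matrix.neg_mul]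

theorem IsTrivialization.inv_deriv_t (ha : ∀ i, (a i).re = 0) (hb : IsSpectral a b)
    (hu : IsSolution a b j u) (hE : IsTrivialization a b j u E) (x t : ℝ) (l : ℂ) :
    HasMatDerivAt (fun s => (E x s (conj l))ᴴ)
      (-(flowOp a b j u x t l * (E x t (conj l))ᴴ)) t := by
  refine (hE.deriv_t x t (conj l)).conjTranspose.congr_deriv ?_
  rw [Matrix.conjTranspose_mul, ← Matrix.neg_mul, ← hu.conjTranspose_flowOp ha hb]
  rfl

/-- Parallel sections `F` of the connection of `u` satisfy `F E⁻¹ = const`. -/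
theorem IsTrivialization.mul_inv_eq (ha : ∀ i, (a i).re = 0) (hb : IsSpectral a b)
    (hu : IsSolution a b j u) (hE : IsTrivialization a b j u E) {F : ℝ → ℝ → Mat n} {l : ℂ}
    (hx : ∀ x t, HasMatDerivAt (fun y => F y t) (F x t * (l • Matrix.diagonal a + u x t)) x)
    (ht : ∀ x t, HasMatDerivAt (fun s => F x s) (F x t * flowOp a b j u x t l) t) (x t : ℝ) :
    F x t * (E x t (conj l))ᴴ = F 0 0 := by
  have h1 : ∀ t x, HasMatDerivAt (fun x => F x t * (E x t (conj l))ᴴ) 0 x := fun t x =>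
    ((hx x t).mul (hE.inv_deriv_x ha hu x t l)).congr_deriv (by noncomm_ring)
  have h2 : ∀ x t, HasMatDerivAt (fun t => F x t * (E x t (conj l))ᴴ) 0 t := fun x t =>
    ((ht x t).mul (hE.inv_deriv_t ha hb hu x t l)).congr_deriv (by noncomm_ring)
  rw [HasMatDerivAt.eq_of_zero (h1 t) x 0, HasMatDerivAt.eq_of_zero (h2 0) t 0, hE.base]
  simp

theorem IsTrivialization.mul_inv (ha : ∀ i, (a i).re = 0) (hb : IsSpectral a b)
    (hu : IsSolution a b j u) (hE : IsTrivialization a b j u E) (x t : ℝ) (l : ℂ) :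
    E x t l * (E x t (conj l))ᴴ = 1 := by
  rw [hE.mul_inv_eq ha hb hu (F := fun x t => E x t l) (fun x t => hE.deriv_x x t l)
    (fun x t => hE.deriv_t x t l), hE.base]

theorem IsTrivialization.inv_mul (ha : ∀ i, (a i).re = 0) (hb : IsSpectral a b)
    (hu : IsSolution a b j u) (hE : IsTrivialization a b j u E) (x t : ℝ) (l : ℂ) :
    (E x t (conj l))ᴴ * E x t l = 1 :=
  mul_eq_one_comm.1 (hE.mul_inv ha hb hu x t l)

theorem IsTrivialization.eq_mul (ha : ∀ i, (a i).re = 0) (hb : IsSpectral a b)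
    (hu : IsSolution a b j u) (hE : IsTrivialization a b j u E) {F : ℝ → ℝ → Mat n} {l : ℂ}
    (hx : ∀ x t, HasMatDerivAt (fun y => F y t) (F x t * (l • Matrix.diagonal a + u x t)) x)
    (ht : ∀ x t, HasMatDerivAt (fun s => F x s) (F x t * flowOp a b j u x t l) t) (x t : ℝ) :
    F x t = F 0 0 * E x t l := by
  rw [← hE.mul_inv_eq ha hb hu hx ht x t, Matrix.mul_assoc, hE.inv_mul ha hb hu, Matrix.mul_one]

theorem IsTrivialization.unique (ha : ∀ i, (a i).re = 0) (hb : IsSpectral a b)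
    (hu : IsSolution a b j u) (hE : IsTrivialization a b j u E) {E' : ℝ → ℝ → ℂ → Mat n}
    (hE' : IsTrivialization a b j u E') : E' = E := by
  funext x t l
  rw [hE.eq_mul ha hb hu (F := fun x t => E' x t l) (fun x t => hE'.deriv_x x t l)
    (fun x t => hE'.deriv_t x t l), hE'.base, Matrix.one_mul]

end

end Trivialization

/-! ### Existence and smoothness of trivializations -/

section Existence

variable {a : Fin n → ℂ} {b : Mat n} {j : ℕ} {u : ℝ → ℝ → Mat n}

theorem continuous_flowOp (hb : IsSpectral a b) (hu : IsSolution a b j u) (i i' : Fin n) :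
    Continuous fun q : (ℝ × ℝ) × ℂ => flowOp a b j u q.1.1 q.1.2 q.2 i i' := by
  simp only [flowOp, timeOp, Matrix.sum_apply, Matrix.smul_apply, smul_eq_mul]
  refine continuous_finsetSum _ fun k _ => (continuous_snd.pow _).mul ?_
  exact (hu.contDiff_Q hb k i i').continuous.comp continuous_fst

/-- Solutions along the `t`-axis. -/
theorem exists_solution_axis (hb : IsSpectral a b) (hu : IsSolution a b j u) :
    ∃ G : ℝ → ℂ → Mat n, (∀ i i', Continuous fun q : ℝ × ℂ => G q.1 q.2 i i') ∧
      (∀ t l, HasMatDerivAt (fun s => G s l) (G t l * flowOp a b j u 0 t l) t) ∧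
      (∀ l, G 0 l = 1) ∧ ∀ t i i', Differentiable ℂ fun l => G t l i i' := by
  have hc0 : Continuous fun q : ℝ × ℂ => ((((0 : ℝ), q.1), q.2) : (ℝ × ℝ) × ℂ) := by fun_prop
  obtain ⟨G, Z, hGc, hZc, hG, hZ, hG0, hGZ, hZG⟩ :=
    exists_fundamental_solution (fun t l => flowOp a b j u 0 t l)
      (fun i i' => by simpa only [Function.comp_def] using (continuous_flowOp hb hu i i').comp hc0)
  refine ⟨G, hGc, hG, hG0, fun t i i' l => ?_⟩
  let D : ℝ → ℂ → Mat n := fun t l' => ∑ k ∈ Finset.range (j + 1),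
    (∑ i ∈ Finset.range (j - k), l' ^ i * l ^ (j - k - 1 - i)) • Q a b (fun y => u y t) k 0
  have hDc : ∀ i i', Continuous fun q : ℝ × ℂ => D q.1 q.2 i i' := by
    intro i i'
    simp only [D, Matrix.sum_apply, Matrix.smul_apply, smul_eq_mul]
    have h0 : Continuous fun q : ℝ × ℂ => ((0 : ℝ), q.1) := by fun_prop
    refine continuous_finsetSum _ fun k _ => Continuous.mul (by fun_prop) ?_
    simpa only [Function.comp_def] using (hu.contDiff_Q hb k i i').continuous.comp h0
  have hD : ∀ t l', flowOp a b j u 0 t l' - flowOp a b j u 0 t l = (l' - l) • D t l' :=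
    fun t l' => timeOp_sub _ j l l'
  exact (hasDerivAt_parameter (𝕜 := ℂ) (D := D) hGc hZc hDc hG hZ hG0 hGZ hZG
    hD t i i').differentiableAt

/-- Solutions along the lines `t = const`. -/
theorem exists_solution_lines (hb : IsSpectral a b) (hu : IsSolution a b j u) :
    ∃ F : ℝ → ℝ → ℂ → Mat n,
      (∀ i i', Continuous fun q : ℝ × (ℝ × ℂ) => F q.1 q.2.1 q.2.2 i i') ∧
      (∀ x t l, HasMatDerivAt (fun y => F y t l) (F x t l * (l • Matrix.diagonal a + u x t)) x) ∧
      (∀ t l, F 0 t l = 1) ∧ (∀ x t i i', Differentiable ℂ fun l => F x t l i i') ∧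
      ∀ x t l, HasMatDerivAt (fun s => F x s l)
        (F x t l * flowOp a b j u x t l - flowOp a b j u 0 t l * F x t l) t := by
  have huc : ∀ i i', Continuous fun p : ℝ × ℝ => u p.1 p.2 i i' := fun i i' =>
    (hu.smooth i i').continuous
  have hAc : ∀ i i', Continuous fun q : ℝ × (ℝ × ℂ) =>
      (q.2.2 • Matrix.diagonal a + u q.1 q.2.1) i i' := by
    intro i i'
    simp only [Matrix.add_apply, Matrix.smul_apply, smul_eq_mul]
    exact ((continuous_snd.comp continuous_snd).mul continuous_const).add ((huc i i').comp
      (by fun_prop : Continuous fun q : ℝ × (ℝ × ℂ) => (q.1, q.2.1)))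
  obtain ⟨F, Z, hFc, hZc, hF, hZ, hF0, hFZ, hZF⟩ := exists_fundamental_solution
    (fun x (p : ℝ × ℂ) => p.2 • Matrix.diagonal a + u x p.1) hAc
  refine ⟨fun x t l => F x (t, l), hFc, fun x t l => hF x (t, l), fun t l => hF0 (t, l),
    fun x t i i' l => ?_, fun x t l => ?_⟩
  · have hc : Continuous fun q : ℝ × ℂ => (q.1, (t, q.2)) := by fun_prop
    exact (hasDerivAt_parameter (𝕜 := ℂ) (A := fun x l => l • Matrix.diagonal a + u x t)
      (Y := fun x l => F x (t, l)) (Z := fun x l => Z x (t, l)) (D := fun _ _ => Matrix.diagonal a)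
      (fun i i' => (hFc i i').comp hc) (fun i i' => (hZc i i').comp hc)
      (fun i i' => continuous_const) (fun x l => hF x (t, l)) (fun x l => hZ x (t, l))
      (fun l => hF0 (t, l)) (fun x l => hFZ x (t, l)) (fun x l => hZF x (t, l))
      (fun x l' => by rw [add_sub_add_right_eq_sub, sub_smul]) x i i').differentiableAt
  · have hut : ∀ i i', ∃ D : ℝ → ℝ → ℂ, (Continuous fun q : ℝ × ℝ => D q.1 q.2) ∧
        (∀ x q, u x q i i' - u x t i i' = (q - t) • D x q) ∧ ∀ x, D x t =
          (Q a b (fun y => u y t) (j + 1) x * Matrix.diagonal a -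
            Matrix.diagonal a * Q a b (fun y => u y t) (j + 1) x) i i' := by
      intro i i'
      refine exists_continuous_difference_quotient (f := fun x s => u x s i i') (f' := fun x s =>
        (Q a b (fun y => u y s) (j + 1) x * Matrix.diagonal a -
            Matrix.diagonal a * Q a b (fun y => u y s) (j + 1) x) i i')
        (fun x s => hu.flow' hb x s i i') ?_ t
      simp only [Matrix.sub_apply, Matrix.mul_diagonal, Matrix.diagonal_mul]
      have := (hu.contDiff_Q hb (j + 1) i i').continuous
      fun_prop
    choose D hDc hD hDt using hut
    have hc : Continuous fun q : ℝ × ℝ => (q.1, (q.2, l)) := by fun_prop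
    -- M is the t-derivative of aλ + u. Flatness says that F B F⁻¹ has x-derivative F M F⁻¹, so the
    -- integral in the parameter derivative of F equals F B F⁻¹ - B(0).
    let B : ℝ → Mat n := fun x => flowOp a b j u x t l
    let M : ℝ → Mat n := fun x => Matrix.of fun i i' => D i i' x t
    have hM : ∀ x, M x = Q a b (fun y => u y t) (j + 1) x * Matrix.diagonal a -
            Matrix.diagonal a * Q a b (fun y => u y t) (j + 1) x := fun x => by
      ext i i'
      exact hDt i i' x
    have key := hasDerivAt_parameter (𝕜 := ℝ) (A := fun x s => l • Matrix.diagonal a + u x s)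
      (Y := fun x s => F x (s, l)) (Z := fun x s => Z x (s, l)) (p := t)
      (D := fun x s => Matrix.of fun i i' => D i i' x s)
      (fun i i' => (hFc i i').comp hc) (fun i i' => (hZc i i').comp hc)
      (fun i i' => hDc i i') (fun x s => hF x (s, l)) (fun x s => hZ x (s, l))
      (fun s => hF0 (s, l)) (fun x s => hFZ x (s, l)) (fun x s => hZF x (s, l))
      (fun x s => by
        rw [add_sub_add_left_eq_sub]
        ext i i'
        exact hD i i' x s) x
    have hFBZ : ∀ s, HasMatDerivAt (fun s => F s (t, l) * B s * Z s (t, l))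
        ((1 : ℝ) • (F s (t, l) * M s * Z s (t, l))) s := fun s =>
      (((hF s (t, l)).mul (hu.flowOp_deriv hb s t l)).mul (hZ s (t, l))).congr_deriv (by
        simp only [one_smul, hM]
        noncomm_ring)
    have ht : Continuous fun s : ℝ => (s, (t, l)) := by fun_prop
    have ht' : Continuous fun s : ℝ => (s, t) := by fun_prop
    have hNc : ∀ i i', Continuous fun s => (F s (t, l) * M s * Z s (t, l)) i i' := by
      intro i i'
      simp only [Matrix.mul_apply]
      exact continuous_finsetSum _ fun k _ => (continuous_finsetSum _ fun k' _ =>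
        ((hFc i k').comp ht).mul ((hDc k' k).comp ht')).mul ((hZc k i').comp ht)
    have hint := sub_eq_smul_integral (𝕜 := ℝ) hFBZ hNc x
    have h0 : F 0 (t, l) * B 0 * Z 0 (t, l) = B 0 := by
      have h1 := hFZ 0 (t, l)
      rw [hF0, one_mul] at h1
      rw [hF0, h1, one_mul, mul_one]
    simp only [h0, one_smul] at hint
    have h2 : F x (t, l) * flowOp a b j u x t l - flowOp a b j u 0 t l * F x (t, l) =
        (F x (t, l) * B x * Z x (t, l) - B 0) * F x (t, l) := by
      rw [Matrix.sub_mul, Matrix.mul_assoc _ (Z x (t, l)), hZF, Matrix.mul_one]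
    rw [h2, hint]
    exact key

/-- Every solution of the flow has a trivialization; its values lie in `G_+` and it is smooth
in `(x, t)`. -/
theorem IsSolution.exists_trivialization (ha : ∀ i, (a i).re = 0) (hb : IsSpectral a b)
    (hu : IsSolution a b j u) : ∃ E : ℝ → ℝ → ℂ → Mat n, IsTrivialization a b j u E ∧
      (∀ x t, IsGPlus (E x t)) ∧
      ∀ l i i', ContDiff ℝ ∞ fun p : ℝ × ℝ => E p.1 p.2 l i i' := by
  obtain ⟨G, hGc, hG, hG0, hGd⟩ := exists_solution_axis hb hu
  obtain ⟨F, hFc, hF, hF0, hFd, hFt⟩ := exists_solution_lines hb hu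
  -- The boundary term -B(0) F in F_t is cancelled by G_t = G B(0).
  have hE : IsTrivialization a b j u fun x t l => G t l * F x t l :=
    { deriv_x := fun x t l => ((hF x t l).const_mul (G t l)).congr_deriv (by noncomm_ring)
      deriv_t := fun x t l => ((hG t l).mul (hFt x t l)).congr_deriv (by
        change _ = G t l * F x t l * flowOp a b j u x t l
        noncomm_ring)
      base := fun l => by rw [hG0, hF0, one_mul] }
  refine ⟨_, hE, fun x t => ⟨fun i i' => ?_, hE.inv_mul ha hb hu x t⟩, fun l => ?_⟩
  · simp only [Matrix.mul_apply]
    exact Differentiable.fun_sum fun k _ => (hGd t i k).mul (hFd x t k i')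
  · refine contDiff_of_linear_system (fun i i' => ?_) (fun i i' => ?_)
      (hu.contDiff_flowOp hb l) (fun x t => hE.deriv_x x t l) (fun x t => hE.deriv_t x t l)
    · simp only [Matrix.mul_apply]
      have h1 : Continuous fun p : ℝ × ℝ => (p.2, l) := by fun_prop
      have h2 : Continuous fun p : ℝ × ℝ => (p.1, (p.2, l)) := by fun_prop
      exact continuous_finsetSum _ fun k _ => ((hGc i k).comp h1).mul ((hFc k i').comp h2)
    · exact contDiff_const.add (hu.smooth i i')

end Existence

/-! ### Decay of solutions of perturbed replicator equations -/

theorem monotoneOn_Ici_of_hasDerivAt {f f' : ℝ → ℝ} {x₀ : ℝ}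
    (h : ∀ x ≥ x₀, HasDerivAt f (f' x) x) (h0 : ∀ x ≥ x₀, 0 ≤ f' x) :
    MonotoneOn f (Set.Ici x₀) := by
  refine monotoneOn_of_deriv_nonneg (convex_Ici _)
    (fun x hx => (h x hx).continuousAt.continuousWithinAt) (fun x hx => ?_) fun x hx => ?_
  · rw [interior_Ici] at hx
    exact (h x (le_of_lt hx)).differentiableAt.differentiableWithinAt
  · rw [interior_Ici] at hx
    rw [(h x (le_of_lt hx)).deriv]
    exact h0 x (le_of_lt hx)

theorem hasDerivAt_const_mul_zpow_neg (K : ℝ) (N : ℕ) {x : ℝ} (hx : 0 < x) :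
    HasDerivAt (fun x : ℝ => K * x ^ (-(N : ℤ))) (-(N / x) * (K * x ^ (-(N : ℤ)))) x := by
  refine ((hasDerivAt_zpow (-(N : ℤ)) x (Or.inl hx.ne')).const_mul K).congr_deriv ?_
  rw [zpow_sub_one₀ hx.ne']
  push_cast
  field_simp

/-- A bounded function that grows exponentially, up to a small error, is small. -/
theorem le_zpow_of_deriv_ge {q q' : ℝ → ℝ} {x₀ δ C : ℝ} (N : ℕ) (hx₀ : 0 < x₀) (hδ : 0 < δ)
    (hC : 0 ≤ C) (hq : ∀ x, q x ≤ 1) (hd : ∀ x ≥ x₀, HasDerivAt q (q' x) x)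
    (hge : ∀ x ≥ x₀, δ * q x - C * x ^ (-(N : ℤ)) ≤ q' x) :
    ∃ K, ∀ x ≥ x₀, q x ≤ K * x ^ (-(N : ℤ)) := by
  refine ⟨C / δ, fun x hx => ?_⟩
  -- w is nondecreasing on [x₀, ∞) and, because q ≤ 1, is bounded at y by e^{-δy}, which tends to 0.
  -- Hence w ≤ 0, which is the bound with K = C/δ.
  let w : ℝ → ℝ := fun x => Real.exp (-δ * x) * (q x - C / δ * x ^ (-(N : ℤ)))
  have hw : ∀ x ≥ x₀, HasDerivAt w (Real.exp (-δ * x) * (-δ) * (q x - C / δ * x ^ (-(N : ℤ))) +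
      Real.exp (-δ * x) * (q' x - -(N / x) * (C / δ * x ^ (-(N : ℤ))))) x := by
    intro x hx
    have h1 : HasDerivAt (fun x => Real.exp (-δ * x)) (Real.exp (-δ * x) * (-δ)) x := by
      simpa using ((hasDerivAt_id x).const_mul (-δ)).exp
    exact h1.mul ((hd x hx).sub (hasDerivAt_const_mul_zpow_neg _ N (hx₀.trans_le hx)))
  have hmono : MonotoneOn w (Set.Ici x₀) := by
    refine monotoneOn_Ici_of_hasDerivAt hw fun x hx => ?_
    have hx' : 0 < x := hx₀.trans_le hx
    have h1 := hge x hx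
    have h2 : 0 ≤ N / x * (C / δ * x ^ (-(N : ℤ))) := by positivity
    have h3 : δ * (C / δ * x ^ (-(N : ℤ))) = C * x ^ (-(N : ℤ)) := by field_simp
    have h4 : 0 ≤ Real.exp (-δ * x) * ((q' x - (δ * q x - C * x ^ (-(N : ℤ)))) +
      N / x * (C / δ * x ^ (-(N : ℤ)))) := by
      have : 0 ≤ q' x - (δ * q x - C * x ^ (-(N : ℤ))) := by linarith
      positivity
    rw [← h3] at h4
    linarith
  have hlim : Tendsto (fun y => Real.exp (-δ * y)) atTop (𝓝 0) := by
    have : Tendsto (fun y : ℝ => δ * y) atTop atTop := tendsto_id.const_mul_atTop hδ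
    simpa [Function.comp_def, neg_mul] using Real.tendsto_exp_neg_atTop_nhds_zero.comp this
  have hle : w x ≤ 0 := by
    refine ge_of_tendsto hlim ?_
    filter_upwards [eventually_ge_atTop x] with y hy
    refine (hmono hx (hx.trans hy) hy).trans ?_
    have hy' : 0 < y := hx₀.trans_le (hx.trans hy)
    have h1 : 0 ≤ C / δ * y ^ (-(N : ℤ)) := by positivity
    calc w y ≤ Real.exp (-δ * y) * 1 := by
          refine mul_le_mul_of_nonneg_left ?_ (Real.exp_pos _).le
          linarith [hq y]
      _ = _ := mul_one _
  have h1 : 0 < Real.exp (-δ * x) := Real.exp_pos _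
  by_contra! hcon
  have : 0 < w x := mul_pos h1 (by linarith)
  linarith

/-- A function that decays exponentially, up to a small error, is small. -/
theorem le_zpow_of_deriv_le {q q' : ℝ → ℝ} {x₀ δ C : ℝ} (N : ℕ) (hx₀ : 0 < x₀) (hδ : 0 < δ)
    (hq : ∀ x, q x ≤ 1) (hd : ∀ x ≥ x₀, HasDerivAt q (q' x) x)
    (hle : ∀ x ≥ x₀, q' x ≤ -δ * q x + C * x ^ (-(N : ℤ))) :
    ∃ K, ∃ x₁ ≥ x₀, ∀ x ≥ x₁, q x ≤ K * x ^ (-(N : ℤ)) := by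
  -- Past 2N/δ the logarithmic derivative of x⁻ᴺ is at most δ/2 in size, so K x⁻ᴺ is a supersolution
  -- once K ≥ 2C/δ. The other condition K ≥ x₁ᴺ gives K x₁⁻ᴺ ≥ 1 ≥ q(x₁) at the start.
  let x₁ : ℝ := max x₀ (2 * N / δ)
  let K : ℝ := max (2 * C / δ) (x₁ ^ N)
  have hx₁ : 0 < x₁ := hx₀.trans_le (le_max_left _ _)
  have hK : 0 ≤ K := (by positivity : 0 ≤ x₁ ^ N).trans (le_max_right _ _)
  refine ⟨K, x₁, le_max_left _ _, fun x hx => ?_⟩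
  let w : ℝ → ℝ := fun x => Real.exp (δ * x) * (K * x ^ (-(N : ℤ)) - q x)
  have hw : ∀ x ≥ x₁, HasDerivAt w (Real.exp (δ * x) * δ * (K * x ^ (-(N : ℤ)) - q x) +
      Real.exp (δ * x) * (-(N / x) * (K * x ^ (-(N : ℤ))) - q' x)) x := by
    intro x hx
    have h1 : HasDerivAt (fun x => Real.exp (δ * x)) (Real.exp (δ * x) * δ) x := by
      simpa using ((hasDerivAt_id x).const_mul δ).exp
    exact h1.mul ((hasDerivAt_const_mul_zpow_neg _ N (hx₁.trans_le hx)).sub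
      (hd x ((le_max_left _ _).trans hx)))
  have hmono : MonotoneOn w (Set.Ici x₁) := by
    refine monotoneOn_Ici_of_hasDerivAt hw fun x hx => ?_
    have hx' : 0 < x := hx₁.trans_le hx
    have h1 := hle x ((le_max_left _ _).trans hx)
    have hz : 0 < x ^ (-(N : ℤ)) := by positivity
    have h2 : N / x ≤ δ / 2 := by
      rw [div_le_div_iff₀ hx' two_pos]
      have : 2 * N / δ ≤ x := (le_max_right _ _).trans hx
      rw [div_le_iff₀ hδ] at this
      linarith
    have h3 : C ≤ δ / 2 * K := by
      have : 2 * C / δ ≤ K := le_max_left _ _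
      rw [div_le_iff₀ hδ] at this
      linarith
    have h4 : C * x ^ (-(N : ℤ)) ≤ δ / 2 * K * x ^ (-(N : ℤ)) :=
      mul_le_mul_of_nonneg_right h3 hz.le
    have h5 : N / x * (K * x ^ (-(N : ℤ))) ≤ δ / 2 * (K * x ^ (-(N : ℤ))) :=
      mul_le_mul_of_nonneg_right h2 (by positivity)
    have h6 : 0 ≤ δ * (K * x ^ (-(N : ℤ)) - q x) + (-(N / x) * (K * x ^ (-(N : ℤ))) - q' x) := by
      linarith
    have h7 := mul_nonneg (Real.exp_pos (δ * x)).le h6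
    linarith
  have h0 : 0 ≤ w x₁ := by
    refine mul_nonneg (Real.exp_pos _).le ?_
    have h1 : x₁ ^ N * x₁ ^ (-(N : ℤ)) ≤ K * x₁ ^ (-(N : ℤ)) :=
      mul_le_mul_of_nonneg_right (le_max_right _ _) (by positivity)
    have h2 : x₁ ^ N * x₁ ^ (-(N : ℤ)) = 1 := by
      rw [← zpow_natCast, ← zpow_add₀ hx₁.ne', add_neg_cancel, zpow_zero]
    linarith [hq x₁]
  have h1 := h0.trans (hmono Set.self_mem_Ici hx hx)
  by_contra! hcon
  have : w x < 0 := mul_neg_of_pos_of_neg (Real.exp_pos _) (by linarith)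
  linarith

section Replicator

variable {ι : Type*} [Fintype ι] {q e : ι → ℝ → ℝ} {ρ : ι → ℝ}

/-- The mean f = ∑ ρ_l q_l has derivative twice the variance of ρ under q, plus an integrable error,
so it converges to some f₀. If ρ_k ≠ f₀, the rate 2(ρ_k - f) is eventually bounded away from 0. If
it is negative, q_k decays; if it is positive, a bounded q_k cannot grow and must already be small.
Of two distinct values ρ_k, ρ_l, at least one differs from f₀. -/
theorem replicator_decay_atTop (hq0 : ∀ k x, 0 ≤ q k x) (hq1 : ∀ x, ∑ k, q k x = 1)
    (hd : ∀ k x, HasDerivAt (q k) (2 * (ρ k - ∑ l, ρ l * q l x) * q k x + e k x) x)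
    (he : ∀ k (N : ℕ), ∃ C, ∀ x, |x| ^ N * |e k x| ≤ C) {k l : ι} (hkl : ρ k ≠ ρ l) (N : ℕ) :
    ∃ K, ∃ x₁ > 0, ∀ x ≥ x₁, q k x * q l x ≤ K * x ^ (-(N : ℤ)) := by
  have hle1 : ∀ k x, q k x ≤ 1 := fun k x => by
    rw [← hq1 x]
    exact Finset.single_le_sum (f := fun k => q k x) (fun i _ => hq0 i x) (Finset.mem_univ k)
  have heN : ∀ k (N : ℕ), ∃ C, 0 ≤ C ∧ ∀ x > 0, |e k x| ≤ C * x ^ (-(N : ℤ)) := by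
    intro k N
    obtain ⟨C, hC⟩ := he k N
    refine ⟨C, (by positivity : 0 ≤ |(0 : ℝ)| ^ N * |e k 0|).trans (hC 0), fun x hx => ?_⟩
    have h := hC x
    rw [abs_of_pos hx] at h
    rw [zpow_neg, zpow_natCast, ← div_eq_mul_inv, le_div_iff₀ (by positivity)]
    linarith
  let f : ℝ → ℝ := fun x => ∑ l, ρ l * q l x
  have hfd : ∀ x, HasDerivAt f (2 * ∑ l, (ρ l - f x) ^ 2 * q l x + ∑ l, ρ l * e l x) x := by
    intro x
    refine (HasDerivAt.fun_sum fun l _ => (hd l x).const_mul (ρ l)).congr_deriv ?_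
    have h1 : ∑ l, ρ l * (2 * (ρ l - f x) * q l x + e l x) =
        2 * (∑ l, (ρ l - f x) ^ 2 * q l x) + 2 * f x * ((∑ l, ρ l * q l x) - f x * ∑ l, q l x) +
          ∑ l, ρ l * e l x := by
      simp only [Finset.mul_sum, ← Finset.sum_add_distrib, ← Finset.sum_sub_distrib]
      exact Finset.sum_congr rfl fun l _ => by ring
    rw [hq1, mul_one, show (∑ l, ρ l * q l x) - f x = 0 from sub_self _] at h1
    rw [h1]
    ring
  obtain ⟨A, hA0, hA⟩ : ∃ A, 0 ≤ A ∧ ∀ x, |∑ l, ρ l * e l x| ≤ A / (1 + x ^ 2) := by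
    choose C hC using he
    refine ⟨∑ l, |ρ l| * (C l 0 + C l 2), Finset.sum_nonneg fun l _ => ?_, fun x => ?_⟩
    · have h1 : 0 ≤ C l 0 := (by positivity : 0 ≤ |(0 : ℝ)| ^ 0 * |e l 0|).trans (hC l 0 0)
      have h2 : 0 ≤ C l 2 := (by positivity : 0 ≤ |(0 : ℝ)| ^ 2 * |e l 0|).trans (hC l 2 0)
      positivity
    · rw [le_div_iff₀ (by positivity)]
      calc |∑ l, ρ l * e l x| * (1 + x ^ 2) ≤ (∑ l, |ρ l * e l x|) * (1 + x ^ 2) := by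
            gcongr; exact Finset.abs_sum_le_sum_abs _ _
        _ ≤ _ := by
            rw [Finset.sum_mul]
            refine Finset.sum_le_sum fun l _ => ?_
            rw [abs_mul, mul_assoc]
            refine mul_le_mul_of_nonneg_left ?_ (abs_nonneg _)
            have h1 := hC l 0 x
            have h2 := hC l 2 x
            rw [sq_abs] at h2
            rw [pow_zero, one_mul] at h1
            linarith
  obtain ⟨f₀, hf₀⟩ : ∃ f₀, Tendsto f atTop (𝓝 f₀) := by
    -- The derivative A/(1 + x²) of the added term dominates the error in f', so F is monotone, and
    -- it is still bounded.
    let F : ℝ → ℝ := fun x => f x + A * Real.arctan x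
    have hF : Monotone F := by
      have hFd : ∀ x, HasDerivAt F _ x := fun x =>
        (hfd x).add ((Real.hasDerivAt_arctan x).const_mul A)
      refine monotone_of_deriv_nonneg (fun x => (hFd x).differentiableAt) fun x => ?_
      rw [(hFd x).deriv]
      have h1 : 0 ≤ ∑ l, (ρ l - f x) ^ 2 * q l x :=
        Finset.sum_nonneg fun l _ => mul_nonneg (sq_nonneg _) (hq0 l x)
      have h2 := (abs_le.1 (hA x)).1
      rw [mul_one_div]
      linarith
    have hbdd : BddAbove (Set.range F) := by
      refine ⟨(∑ l, |ρ l|) + A * (Real.pi / 2), ?_⟩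
      rintro _ ⟨x, rfl⟩
      refine add_le_add (Finset.sum_le_sum fun l _ => ?_)
        (mul_le_mul_of_nonneg_left (Real.arctan_lt_pi_div_two x).le hA0)
      calc ρ l * q l x ≤ |ρ l| * 1 :=
            mul_le_mul (le_abs_self _) (hle1 l x) (hq0 l x) (abs_nonneg _)
        _ = _ := mul_one _
    have h1 := tendsto_atTop_ciSup hF hbdd
    have h2 : Tendsto Real.arctan atTop (𝓝 (Real.pi / 2)) :=
      Real.tendsto_arctan_atTop.mono_right nhdsWithin_le_nhds
    refine ⟨_, (h1.sub (h2.const_mul A)).congr fun x => ?_⟩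
    simp only [F]
    ring
  have hdecay : ∀ k, ρ k ≠ f₀ → ∃ K, ∃ x₁ > 0, ∀ x ≥ x₁, q k x ≤ K * x ^ (-(N : ℤ)) := by
    intro k hk
    obtain ⟨C, hC0, hC⟩ := heN k N
    rcases lt_or_gt_of_ne hk with h | h
    · have hev : ∀ᶠ x in atTop, (ρ k + f₀) / 2 < f x := hf₀.eventually_const_lt (by linarith)
      obtain ⟨x₀, hx₀⟩ := eventually_atTop.1 hev
      obtain ⟨K, x₁, hx₁, hK⟩ := le_zpow_of_deriv_le (q := q k) (x₀ := max x₀ 1) (δ := f₀ - ρ k)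
        N (lt_max_of_lt_right one_pos) (by linarith) (hle1 k) (fun x _ => hd k x)
        fun x hx => by
          have hx0 : 0 < x := one_pos.trans_le ((le_max_right _ _).trans hx)
          have h1 := hx₀ x ((le_max_left _ _).trans hx)
          have h2 := (abs_le.1 (hC x hx0)).2
          have h3 : 2 * (ρ k - f x) * q k x ≤ -(f₀ - ρ k) * q k x :=
            mul_le_mul_of_nonneg_right (by linarith) (hq0 k x)
          exact add_le_add h3 h2
      exact ⟨K, x₁, (lt_max_of_lt_right one_pos).trans_le hx₁, hK⟩
    · have hev : ∀ᶠ x in atTop, f x < (ρ k + f₀) / 2 := hf₀.eventually_lt_const (by linarith)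
      obtain ⟨x₀, hx₀⟩ := eventually_atTop.1 hev
      obtain ⟨K, hK⟩ := le_zpow_of_deriv_ge (q := q k) (x₀ := max x₀ 1) (δ := ρ k - f₀)
        N (lt_max_of_lt_right one_pos) (by linarith) hC0 (hle1 k) (fun x _ => hd k x)
        fun x hx => by
          have hx0 : 0 < x := one_pos.trans_le ((le_max_right _ _).trans hx)
          have h1 := hx₀ x ((le_max_left _ _).trans hx)
          have h2 := (abs_le.1 (hC x hx0)).1
          have h3 : (ρ k - f₀) * q k x ≤ 2 * (ρ k - f x) * q k x :=
            mul_le_mul_of_nonneg_right (by linarith) (hq0 k x)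
          linarith
      exact ⟨K, max x₀ 1, lt_max_of_lt_right one_pos, hK⟩
  by_cases hk : ρ k = f₀
  · obtain ⟨K, x₁, hx₁, hK⟩ := hdecay l fun h => hkl (hk.trans h.symm)
    refine ⟨K, x₁, hx₁, fun x hx => le_trans ?_ (hK x hx)⟩
    exact mul_le_of_le_one_left (hq0 l x) (hle1 k x)
  · obtain ⟨K, x₁, hx₁, hK⟩ := hdecay k hk
    refine ⟨K, x₁, hx₁, fun x hx => le_trans ?_ (hK x hx)⟩
    exact mul_le_of_le_one_right (hq0 k x) (hle1 l x)

/-- Solutions of the replicator equation `q_k' = 2 (ρ_k - ∑ ρ_l q_l) q_k`, perturbed by rapidly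
decreasing terms, concentrate rapidly on one value of `ρ`. -/
theorem replicator_decay (hq0 : ∀ k x, 0 ≤ q k x) (hq1 : ∀ x, ∑ k, q k x = 1)
    (hd : ∀ k x, HasDerivAt (q k) (2 * (ρ k - ∑ l, ρ l * q l x) * q k x + e k x) x)
    (he : ∀ k (N : ℕ), ∃ C, ∀ x, |x| ^ N * |e k x| ≤ C) {k l : ι} (hkl : ρ k ≠ ρ l) (N : ℕ) :
    ∃ C, ∀ x, |x| ^ N * (q k x * q l x) ≤ C := by
  obtain ⟨K, x₁, hx₁, hK⟩ := replicator_decay_atTop hq0 hq1 hd he hkl N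
  -- The behaviour at -∞: the reflection x ↦ -x gives an equation of the same form with ρ and e
  -- negated.
  obtain ⟨K', x₂, hx₂, hK'⟩ := replicator_decay_atTop (q := fun k x => q k (-x))
    (e := fun k x => -e k (-x)) (ρ := fun k => -ρ k) (fun k x => hq0 k (-x)) (fun x => hq1 (-x))
    (fun k x => by
      refine ((hd k (-x)).scomp x (hasDerivAt_neg x)).congr_deriv ?_
      simp only [neg_mul, Finset.sum_neg_distrib, smul_eq_mul]
      ring)
    (fun k N => by
      obtain ⟨C, hC⟩ := he k N
      exact ⟨C, fun x => by simpa using hC (-x)⟩) (fun h => hkl (neg_injective h)) N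
  have hle1 : ∀ k x, q k x ≤ 1 := fun k x => by
    rw [← hq1 x]
    exact Finset.single_le_sum (f := fun k => q k x) (fun i _ => hq0 i x) (Finset.mem_univ k)
  have key : ∀ {x s B : ℝ}, 0 < x → s ≤ B * x ^ (-(N : ℤ)) → x ^ N * s ≤ B := by
    intro x s B hx h
    rw [zpow_neg, zpow_natCast, ← div_eq_mul_inv, le_div_iff₀ (by positivity)] at h
    linarith
  refine ⟨max (max K K') ((max x₁ x₂) ^ N), fun x => ?_⟩
  by_cases h1 : x₁ ≤ x
  · rw [abs_of_pos (hx₁.trans_le h1)]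
    exact (key (hx₁.trans_le h1) (hK x h1)).trans ((le_max_left _ _).trans (le_max_left _ _))
  · by_cases h2 : x₂ ≤ -x
    · rw [abs_of_neg (by linarith)]
      have h3 := hK' (-x) h2
      rw [neg_neg] at h3
      exact (key (hx₂.trans_le h2) h3).trans ((le_max_right _ _).trans (le_max_left _ _))
    · push Not at h1 h2
      have h3 : |x| ≤ max x₁ x₂ := abs_le.2
        ⟨by linarith [le_max_right x₁ x₂], h1.le.trans (le_max_left _ _)⟩
      calc |x| ^ N * (q k x * q l x) ≤ (max x₁ x₂) ^ N * (1 * 1) := by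
            refine mul_le_mul (pow_le_pow_left₀ (abs_nonneg _) h3 N)
              (mul_le_mul (hle1 k x) (hle1 l x) (hq0 l x) zero_le_one)
              (mul_nonneg (hq0 k x) (hq0 l x)) (by positivity)
        _ ≤ _ := by rw [mul_one, mul_one]; exact le_max_right _ _

end Replicator

/-! ### Rank one projections -/

/-- The squared length of a vector. -/
def sqLen (w : Fin n → ℂ) : ℝ := ∑ i, Complex.normSq (w i)

/-- The orthogonal projection onto the line spanned by `w`. -/
def rankOneProj (w : Fin n → ℂ) : Mat n := Matrix.of fun i j => (sqLen w : ℂ)⁻¹ * (w i * conj (w j))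

section RankOne

variable {w : Fin n → ℂ}

theorem sqLen_pos (hw : w ≠ 0) : 0 < sqLen w := by
  obtain ⟨i, hi⟩ := Function.ne_iff.1 hw
  exact Finset.sum_pos' (fun i _ => Complex.normSq_nonneg _)
    ⟨i, Finset.mem_univ i, Complex.normSq_pos.2 hi⟩

theorem sqLen_cast (w : Fin n → ℂ) : (sqLen w : ℂ) = ∑ i, w i * conj (w i) := by
  simp [sqLen, Complex.mul_conj]

theorem sqLen_ne_zero (hw : w ≠ 0) : (sqLen w : ℂ) ≠ 0 :=
  Complex.ofReal_ne_zero.2 (sqLen_pos hw).ne'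

theorem conjTranspose_rankOneProj (w : Fin n → ℂ) : (rankOneProj w)ᴴ = rankOneProj w := by
  ext i j
  simp only [rankOneProj, Matrix.conjTranspose_apply, Matrix.of_apply, RCLike.star_def, map_mul,
    map_inv₀, Complex.conj_ofReal, Complex.conj_conj]
  ring

theorem trace_rankOneProj (hw : w ≠ 0) : (rankOneProj w).trace = 1 := by
  simp only [Matrix.trace, Matrix.diag_apply, rankOneProj, Matrix.of_apply]
  rw [← Finset.mul_sum, ← sqLen_cast, inv_mul_cancel₀ (sqLen_ne_zero hw)]

theorem rankOneProj_mul_mul (w : Fin n → ℂ) (M : Mat n) :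
    rankOneProj w * M * rankOneProj w = (M * rankOneProj w).trace • rankOneProj w := by
  ext i j
  simp only [Matrix.mul_apply, Matrix.trace, Matrix.diag_apply, rankOneProj, Matrix.of_apply,
    Matrix.smul_apply, smul_eq_mul, Finset.sum_mul]
  rw [Finset.sum_comm]
  exact Finset.sum_congr rfl fun k _ => Finset.sum_congr rfl fun l _ => by ring

theorem rankOneProj_mul_self (hw : w ≠ 0) : rankOneProj w * rankOneProj w = rankOneProj w := by
  have h := rankOneProj_mul_mul w 1
  rwa [Matrix.mul_one, Matrix.one_mul, trace_rankOneProj hw, one_smul] at h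

theorem rankOneProj_diag (w : Fin n → ℂ) (k : Fin n) :
    rankOneProj w k k = ((Complex.normSq (w k) / sqLen w : ℝ) : ℂ) := by
  simp only [rankOneProj, Matrix.of_apply, Complex.mul_conj]
  push_cast
  ring

/-- This consequence of rank one lets the diagonal entries, which obey a closed system up to small
errors, control the off-diagonal ones. -/
theorem normSq_rankOneProj (w : Fin n → ℂ) (k l : Fin n) : Complex.normSq (rankOneProj w k l) =
    (rankOneProj w k k).re * (rankOneProj w l l).re := by
  rw [rankOneProj_diag, rankOneProj_diag, Complex.ofReal_re, Complex.ofReal_re]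
  simp only [rankOneProj, Matrix.of_apply, map_mul, map_inv₀, Complex.normSq_ofReal,
    Complex.normSq_conj]
  ring

theorem rankOneProj_diag_nonneg (w : Fin n → ℂ) (k : Fin n) : 0 ≤ (rankOneProj w k k).re := by
  rw [rankOneProj_diag, Complex.ofReal_re]
  exact div_nonneg (Complex.normSq_nonneg _) (Finset.sum_nonneg fun i _ => Complex.normSq_nonneg _)

theorem sum_rankOneProj_diag (hw : w ≠ 0) : ∑ k, (rankOneProj w k k).re = 1 := by
  rw [← Complex.re_sum]
  exact congrArg Complex.re (trace_rankOneProj hw)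

theorem norm_rankOneProj_le (hw : w ≠ 0) (k l : Fin n) : ‖rankOneProj w k l‖ ≤ 1 := by
  have h1 : ∀ k, (rankOneProj w k k).re ≤ 1 := fun k => by
    rw [← sum_rankOneProj_diag hw]
    exact Finset.single_le_sum (f := fun k => (rankOneProj w k k).re)
      (fun i _ => rankOneProj_diag_nonneg w i) (Finset.mem_univ k)
  have h2 : ‖rankOneProj w k l‖ ^ 2 ≤ 1 := by
    rw [← Complex.normSq_eq_norm_sq, normSq_rankOneProj]
    exact mul_le_one₀ (h1 k) (rankOneProj_diag_nonneg w l) (h1 l)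
  exact (sq_le_one_iff₀ (norm_nonneg _)).1 h2

/-- The line spanned by a solution of `w' = -A w`. -/
theorem hasMatDerivAt_rankOneProj {w : ℝ → Fin n → ℂ} {A : Mat n} {x : ℝ}
    (hw : ∀ i, HasDerivAt (fun y => w y i) (-(A.mulVec (w x) i)) x) (h0 : w x ≠ 0) :
    HasMatDerivAt (fun y => rankOneProj (w y))
      (rankOneProj (w x) * (A + Aᴴ) * rankOneProj (w x) -
        (A * rankOneProj (w x) + rankOneProj (w x) * Aᴴ)) x := by
  have hc : ∀ i, HasDerivAt (fun y => conj (w y i)) (-conj (A.mulVec (w x) i)) x := fun i => by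
    simpa using (hw i).star
  have hs : HasDerivAt (fun y => (sqLen (w y) : ℂ))
      (∑ i, (-(A.mulVec (w x) i) * conj (w x i) + w x i * -conj (A.mulVec (w x) i))) x := by
    simp only [sqLen_cast]
    exact HasDerivAt.fun_sum fun i _ => (hw i).mul (hc i)
  have hne := sqLen_ne_zero h0
  intro i j
  refine ((hs.inv hne).mul ((hw i).mul (hc j))).congr_deriv ?_
  have h1 : ∀ i j, (A * rankOneProj (w x)) i j =
      (sqLen (w x) : ℂ)⁻¹ * (A.mulVec (w x) i * conj (w x j)) := by
    intro i j
    simp only [Matrix.mul_apply, rankOneProj, Matrix.of_apply, Matrix.mulVec, dotProduct,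
      Finset.sum_mul, Finset.mul_sum]
    exact Finset.sum_congr rfl fun k _ => by ring
  have h2 : ∀ i j, (rankOneProj (w x) * Aᴴ) i j =
      (sqLen (w x) : ℂ)⁻¹ * (w x i * conj (A.mulVec (w x) j)) := by
    intro i j
    have h3 : rankOneProj (w x) * Aᴴ = (A * rankOneProj (w x))ᴴ := by
      rw [Matrix.conjTranspose_mul, conjTranspose_rankOneProj]
    rw [h3, Matrix.conjTranspose_apply, h1]
    simp only [RCLike.star_def, map_mul, map_inv₀, Complex.conj_ofReal, Complex.conj_conj]
    ring
  have h3 : ((A + Aᴴ) * rankOneProj (w x)).trace = (sqLen (w x) : ℂ)⁻¹ *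
      ∑ i, (A.mulVec (w x) i * conj (w x i) + w x i * conj (A.mulVec (w x) i)) := by
    rw [Matrix.add_mul, Matrix.trace_add, Matrix.trace_mul_comm Aᴴ, Finset.sum_add_distrib, mul_add,
      Finset.mul_sum, Finset.mul_sum]
    simp only [Matrix.trace, Matrix.diag_apply, h1, h2]
  rw [Matrix.sub_apply, Matrix.add_apply, rankOneProj_mul_mul, Matrix.smul_apply, h3, h1, h2]
  have h4 : ∑ i, (-(A.mulVec (w x) i) * conj (w x i) + w x i * -conj (A.mulVec (w x) i)) =
      -∑ i, (A.mulVec (w x) i * conj (w x i) + w x i * conj (A.mulVec (w x) i)) := by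
    rw [← Finset.sum_neg_distrib]
    exact Finset.sum_congr rfl fun k _ => by ring
  rw [h4]
  generalize ∑ i, (A.mulVec (w x) i * conj (w x i) + w x i * conj (A.mulVec (w x) i)) = T
  simp only [rankOneProj, Matrix.of_apply, smul_eq_mul, Pi.mul_apply, Pi.inv_apply]
  field_simp
  ring

theorem contDiff_rankOneProj {w : ℝ × ℝ → Fin n → ℂ} (hw : ∀ i, ContDiff ℝ ∞ fun p => w p i)
    (h0 : ∀ p, w p ≠ 0) (i j : Fin n) : ContDiff ℝ ∞ fun p => rankOneProj (w p) i j := by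
  have hc : ∀ i, ContDiff ℝ ∞ fun p => conj (w p i) := fun i =>
    Complex.conjCLE.contDiff.comp (hw i)
  simp only [rankOneProj, Matrix.of_apply]
  refine ContDiff.mul (ContDiff.inv ?_ fun p => sqLen_ne_zero (h0 p)) ((hw i).mul (hc j))
  simp only [sqLen_cast]
  exact ContDiff.sum fun i _ => (hw i).mul (hc i)

end RankOne

/-! ### Darboux matrices -/

/-- The matrix `S` such that `λ + S = (λ - z) π + (λ - z̄) (1 - π)`, where `π` is the projection onto
the line spanned by `w`. -/
def darboux (z : ℂ) (w : Fin n → ℂ) : Mat n := (conj z - z) • rankOneProj w - conj z • 1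

theorem darboux_comm_sub (z : ℂ) (w : Fin n → ℂ) (a : Fin n → ℂ) (k l : Fin n) :
    (darboux z w * Matrix.diagonal a - Matrix.diagonal a * darboux z w) k l =
      (conj z - z) * (a l - a k) * rankOneProj w k l := by
  have h : darboux z w * Matrix.diagonal a - Matrix.diagonal a * darboux z w =
      (conj z - z) • (rankOneProj w * Matrix.diagonal a - Matrix.diagonal a * rankOneProj w) := by
    simp only [darboux, Matrix.sub_mul, Matrix.mul_sub, Matrix.smul_mul, Matrix.mul_smul,
      Matrix.one_mul, Matrix.mul_one]
    module
  rw [h, Matrix.smul_apply, Matrix.sub_apply, Matrix.mul_diagonal, Matrix.diagonal_mul, smul_eq_mul]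
  ring

theorem conjTranspose_darboux_comm {a : Fin n → ℂ} (ha : ∀ i, (a i).re = 0) (z : ℂ)
    (w : Fin n → ℂ) :
    (darboux z w * Matrix.diagonal a - Matrix.diagonal a * darboux z w)ᴴ =
      -(darboux z w * Matrix.diagonal a - Matrix.diagonal a * darboux z w) := by
  have h : ∀ i, conj (a i) = -a i := fun i => by apply Complex.ext <;> simp [ha i]
  have hπ : ∀ k l, conj (rankOneProj w l k) = rankOneProj w k l := fun k l =>
    congrFun (congrFun (conjTranspose_rankOneProj w) k) l
  ext k l
  rw [Matrix.conjTranspose_apply, Matrix.neg_apply, darboux_comm_sub, darboux_comm_sub]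
  simp only [RCLike.star_def, map_mul, map_sub, Complex.conj_conj, h, hπ]
  ring

/-- The derivative of the Darboux matrix in the `x`-direction. -/
theorem darboux_deriv_eq {a u π S : Mat n} {z z' : ℂ} (hπ : π * π = π)
    (hS : S = (z' - z) • π - z' • 1) :
    (z' - z) • (π * ((z • a + u) - (z' • a + u)) * π - ((z • a + u) * π - π * (z' • a + u))) =
      S * u - (u + (S * a - a * S)) * S := by
  subst hS
  simp only [Matrix.mul_add, Matrix.add_mul, Matrix.mul_sub, Matrix.sub_mul, Matrix.smul_mul,
    Matrix.mul_smul, Matrix.mul_assoc, Matrix.one_mul, Matrix.mul_one, hπ]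
  module

/-- The relation between the time components of two connections that are related by `λ + S`. -/
theorem timeOp_darboux {q q' : ℕ → Mat n} {S : Mat n} (h0 : q' 0 = q 0)
    (h : ∀ k, q' (k + 1) + q' k * S = q (k + 1) + S * q k) (j : ℕ) (l : ℂ) :
    timeOp q' j l * (l • 1 + S) - (l • 1 + S) * timeOp q j l = q (j + 1) - q' (j + 1) := by
  induction j with
  | zero =>
    have h1 := h 0
    simp only [timeOp_zero, Matrix.mul_add, Matrix.add_mul, Matrix.mul_smul, Matrix.smul_mul,
      Matrix.mul_one, Matrix.one_mul, h0] at h1 ⊢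
    rw [add_sub_add_left_eq_sub, sub_eq_sub_iff_add_eq_add, add_comm, h1]
  | succ j ih =>
    have h1 : q' (j + 1) * S - S * q (j + 1) = q (j + 1 + 1) - q' (j + 1 + 1) := by
      rw [sub_eq_sub_iff_add_eq_add, add_comm, h (j + 1)]
    rw [← h1, timeOp_succ, timeOp_succ]
    have h2 : (l • timeOp q' j l + q' (j + 1)) * (l • 1 + S) -
        (l • 1 + S) * (l • timeOp q j l + q (j + 1)) =
        l • (timeOp q' j l * (l • 1 + S) - (l • 1 + S) * timeOp q j l) +
          (q' (j + 1) * (l • 1 + S) - (l • 1 + S) * q (j + 1)) := by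
      simp only [Matrix.add_mul, Matrix.mul_add, Matrix.smul_mul, Matrix.mul_smul, smul_sub,
        smul_add]
      module
    rw [h2, ih]
    simp only [Matrix.add_mul, Matrix.mul_add, Matrix.smul_mul, Matrix.mul_smul, Matrix.one_mul,
      Matrix.mul_one]
    module

/-- The derivative of the Darboux matrix in the `t`-direction. -/
theorem darboux_deriv_time_eq {π W B B' C C' : Mat n} {z z' : ℂ} (hπ : π * π = π)
    (h1 : C * (z • 1 + ((z' - z) • π - z' • 1)) - (z • 1 + ((z' - z) • π - z' • 1)) * B = -W)
    (h2 : C' * (z' • 1 + ((z' - z) • π - z' • 1)) - (z' • 1 + ((z' - z) • π - z' • 1)) * B' = -W) :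
    (z' - z) • (π * (B - B') * π - (B * π - π * B')) = W := by
  -- With S = (z' - z)π - z' one has z + S = (z - z')(1 - π) and z' + S = (z' - z)π. So (z + S)π = 0
  -- and (z' + S)(1 - π) = 0: right multiplication of `h1` by π and of `h2` by 1 - π removes C and
  -- C', leaving W in terms of B and B'.
  have e1 : W * π = (z' - z) • (π * B * π - B * π) := by
    have h := congrArg (fun M => -(M * π)) h1
    simp only [neg_mul, neg_neg] at h
    rw [← h]
    simp only [Matrix.mul_add, Matrix.add_mul, Matrix.mul_sub, Matrix.sub_mul, Matrix.smul_mul,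
      Matrix.mul_smul, Matrix.mul_assoc, Matrix.one_mul, Matrix.mul_one, hπ]
    module
  have e2 : W * (1 - π) = (z' - z) • (π * B' - π * B' * π) := by
    have h := congrArg (fun M => -(M * (1 - π))) h2
    simp only [neg_mul, neg_neg] at h
    rw [← h]
    simp only [Matrix.mul_add, Matrix.add_mul, Matrix.mul_sub, Matrix.sub_mul, Matrix.smul_mul,
      Matrix.mul_smul, Matrix.mul_assoc, Matrix.one_mul, Matrix.mul_one, hπ]
    module
  have e3 : W = W * π + W * (1 - π) := by rw [← Matrix.mul_add]; simp
  rw [e3, e1, e2]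
  simp only [Matrix.mul_sub, Matrix.sub_mul]
  module

/-! ### Decay of the Darboux transform -/

section Decay

variable {a : Fin n → ℂ} {u : ℝ → Mat n} {z : ℂ} {w : ℝ → Fin n → ℂ}

/-- The diagonal entries q_k of π satisfy the replicator equation with ρ_k = Im z · Im a_k,
perturbed by the diagonal of [π, u], which decays because π is bounded. As z is not real, a_k ≠ a_l
gives ρ_k ≠ ρ_l. -/
theorem rankOneProj_rapid (ha : ∀ i, (a i).re = 0) (hz : z.im ≠ 0) (hu : IsSchwartz u)
    (hw0 : ∀ x, w x ≠ 0)
    (hd : ∀ x, HasMatDerivAt (fun x => rankOneProj (w x))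
      (rankOneProj (w x) * ((z • Matrix.diagonal a + u x) - (conj z • Matrix.diagonal a + u x)) *
        rankOneProj (w x) - ((z • Matrix.diagonal a + u x) * rankOneProj (w x) -
          rankOneProj (w x) * (conj z • Matrix.diagonal a + u x))) x)
    {k l : Fin n} (hkl : a k ≠ a l) : (fun x => rankOneProj (w x) k l) ∈ rapidFun := by
  let q : Fin n → ℝ → ℝ := fun k x => (rankOneProj (w x) k k).re
  let ρ : Fin n → ℝ := fun k => z.im * (a k).im
  let e : Fin n → ℝ → ℝ := fun k x =>
    ((rankOneProj (w x) * u x - u x * rankOneProj (w x)) k k).re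
  have hq : ∀ k x, rankOneProj (w x) k k = (q k x : ℂ) := fun k x => by
    simp only [q, rankOneProj_diag, Complex.ofReal_re]
  have hρ : ∀ k, (z - conj z) * a k = -2 * (ρ k : ℂ) := fun k => by
    apply Complex.ext <;> simp [ρ, ha k]
    ring
  have hqd : ∀ k x, HasDerivAt (q k) (2 * (ρ k - ∑ l, ρ l * q l x) * q k x + e k x) x := by
    intro k x
    have h1 : HasDerivAt (q k) _ x := Complex.reCLM.hasFDerivAt.comp_hasDerivAt x (hd x k k)
    refine h1.congr_deriv ?_
    have h2 : ∀ π A U : Mat n, π * ((z • A + U) - (conj z • A + U)) * π -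
        ((z • A + U) * π - π * (conj z • A + U)) = (z - conj z) • (π * A * π) -
        (z • (A * π) - conj z • (π * A)) + (π * U - U * π) := by
      intro π A U
      simp only [Matrix.mul_add, Matrix.add_mul, Matrix.mul_sub, Matrix.sub_mul, Matrix.smul_mul,
        Matrix.mul_smul]
      module
    have h3 : (Matrix.diagonal a * rankOneProj (w x)).trace = ∑ l, a l * (q l x : ℂ) := by
      simp only [Matrix.trace, Matrix.diag_apply, Matrix.diagonal_mul, hq]
    have h4 : ((z - conj z) • (rankOneProj (w x) * Matrix.diagonal a * rankOneProj (w x)) -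
        (z • (Matrix.diagonal a * rankOneProj (w x)) -
          conj z • (rankOneProj (w x) * Matrix.diagonal a))) k k =
        ((2 * (ρ k - ∑ l, ρ l * q l x) * q k x : ℝ) : ℂ) := by
      rw [rankOneProj_mul_mul, h3]
      simp only [Matrix.sub_apply, Matrix.smul_apply, Matrix.mul_diagonal, Matrix.diagonal_mul, hq,
        smul_eq_mul]
      have h5 : (z - conj z) * ∑ l, a l * (q l x : ℂ) = -2 * ∑ l, (ρ l : ℂ) * q l x := by
        rw [Finset.mul_sum, Finset.mul_sum]
        exact Finset.sum_congr rfl fun l _ => by rw [← mul_assoc, hρ]; ring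
      push_cast
      linear_combination (q k x : ℂ) * h5 - (q k x : ℂ) * hρ k
    rw [h2, Matrix.add_apply, h4]
    simp [e]
  have hB : MatDerivsIn boundedFun 0 fun x => rankOneProj (w x) :=
    fun i j => ⟨1, fun x => norm_rankOneProj_le (hw0 x) i j⟩
  have hu0 := isSchwartz_iff.1 hu 0
  have he : ∀ k (N : ℕ), ∃ C, ∀ x, |x| ^ N * |e k x| ≤ C := by
    intro k N
    obtain ⟨C, hC⟩ := ((hB.bounded_mul_rapid hu0).sub (hu0.rapid_mul_bounded hB)) k k N
    refine ⟨C, fun x => le_trans ?_ (hC x)⟩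
    gcongr
    exact Complex.abs_re_le_norm _
  have hρ' : ρ k ≠ ρ l := fun h => hkl (by
    have := mul_left_cancel₀ hz h
    apply Complex.ext <;> simp [ha, this])
  intro N
  -- The product q_k q_l is |π_kl|², hence the exponent 2N and the square root of C.
  obtain ⟨C, hC⟩ := replicator_decay (fun k x => rankOneProj_diag_nonneg (w x) k)
    (fun x => sum_rankOneProj_diag (hw0 x)) hqd he hρ' (2 * N)
  refine ⟨√C, fun x => Real.le_sqrt_of_sq_le ?_⟩
  rw [mul_pow, ← Complex.normSq_eq_norm_sq, normSq_rankOneProj, ← pow_mul, mul_comm N 2]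
  exact hC x

/-- The entries of [S, a] are multiples of (a_l - a_k) π_kl, so they decay by `rankOneProj_rapid`. S
itself is only bounded, but every term of S_x = S u - (u + [S, a]) S contains a rapidly decreasing
factor, and this equation bootstraps all derivatives of S and [S, a] together. -/
theorem isSchwartz_darboux (ha : ∀ i, (a i).re = 0) (hz : z.im ≠ 0) (hu : IsSchwartz u)
    (hw0 : ∀ x, w x ≠ 0)
    (hd : ∀ x, HasMatDerivAt (fun x => rankOneProj (w x))
      (rankOneProj (w x) * ((z • Matrix.diagonal a + u x) - (conj z • Matrix.diagonal a + u x)) *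
        rankOneProj (w x) - ((z • Matrix.diagonal a + u x) * rankOneProj (w x) -
          rankOneProj (w x) * (conj z • Matrix.diagonal a + u x))) x) :
    IsSchwartz fun x => u x + (darboux z (w x) * Matrix.diagonal a -
      Matrix.diagonal a * darboux z (w x)) := by
  let S : ℝ → Mat n := fun x => darboux z (w x)
  let R : ℝ → Mat n := fun x => S x * Matrix.diagonal a - Matrix.diagonal a * S x
  have hS : ∀ x, HasMatDerivAt S (S x * u x - (u x + R x) * S x) x := fun x =>
    (((hd x).const_smul (conj z - z)).sub (HasMatDerivAt.const (conj z • 1) x)).congr_deriv (by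
      rw [sub_zero, darboux_deriv_eq (rankOneProj_mul_self (hw0 x)) rfl]
      rfl)
  have hS0 : MatDerivsIn boundedFun 0 S := fun i j => by
    refine ((DerivsIn.const_mul (m := 0) (conj z - z) ?_).sub
      (DerivsIn.const ((conj z • (1 : Mat n)) i j)) :)
    exact ⟨1, fun x => norm_rankOneProj_le (hw0 x) i j⟩
  have hR0 : MatDerivsIn rapidFun 0 R := by
    intro k l
    have h : (fun x => R x k l) = fun x => (conj z - z) * (a l - a k) * rankOneProj (w x) k l :=
      funext fun x => darboux_comm_sub z (w x) a k l
    rw [h]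
    by_cases hkl : a k = a l
    · simpa [hkl] using DerivsIn.zero
    · exact DerivsIn.const_mul (m := 0) _ (rankOneProj_rapid ha hz hu hw0 hd hkl)
  have hu' := isSchwartz_iff.1 hu
  have key : ∀ m, MatDerivsIn boundedFun m S ∧ MatDerivsIn rapidFun m R := by
    intro m
    induction m with
    | zero => exact ⟨hS0, hR0⟩
    | succ m ih =>
      have h1 : MatDerivsIn rapidFun m fun x => S x * u x - (u x + R x) * S x :=
        (ih.1.bounded_mul_rapid (hu' m)).sub (((hu' m).add ih.2).rapid_mul_bounded ih.1)
      exact ⟨hS0.succ hS (h1.mono rapidFun_le_boundedFun),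
        hR0.succ (fun x => ((hS x).mul_const _).sub ((hS x).const_mul _))
          ((h1.rapid_mul_bounded (.const _)).sub ((MatDerivsIn.const _).bounded_mul_rapid h1))⟩
  exact isSchwartz_iff.2 fun m => (hu' m).add (key m).2

end Decay

/-! ### Darboux transforms of solutions -/

/-- The transform of a solution by a rank one Darboux matrix is a solution, and `λ + S` intertwines
the trivializations. -/
theorem IsSolution.exists_darboux {a : Fin n → ℂ} {b : Mat n} {j : ℕ} {u : ℝ → ℝ → Mat n}
    {E : ℝ → ℝ → ℂ → Mat n} (ha : ∀ i, (a i).re = 0) (hb : IsSpectral a b)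
    (hu : IsSolution a b j u) (hE : IsTrivialization a b j u E) {z : ℂ} (hz : z.im ≠ 0)
    {v : Fin n → ℂ} (hv : v ≠ 0) :
    ∃ (u' : ℝ → ℝ → Mat n) (E' : ℝ → ℝ → ℂ → Mat n) (w : ℝ → ℝ → Fin n → ℂ),
      IsSolution a b j u' ∧ IsTrivialization a b j u' E' ∧ (∀ x t, IsGPlus (E' x t)) ∧
      (∀ x t, w x t ≠ 0) ∧ ∀ x t l, (l • 1 + darboux z v) * E x t l =
        E' x t l * (l • 1 + darboux z (w x t)) := by
  -- By uniqueness E is the trivialization constructed by parallel transport, which is smooth.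
  have hsmooth : ∀ l i i', ContDiff ℝ ∞ fun p : ℝ × ℝ => E p.1 p.2 l i i' := by
    obtain ⟨E₀, hE₀, -, h⟩ := hu.exists_trivialization ha hb
    rwa [hE₀.unique ha hb hu hE]
  -- By the reality condition w = E(z)⁻¹v. The kernel of λ + S at λ = z is the line of w, and E(z)
  -- maps it to the line of v, as the intertwining relation at λ = z demands.
  let w : ℝ → ℝ → Fin n → ℂ := fun x t => (E x t (conj z))ᴴ.mulVec v
  have hw0 : ∀ x t, w x t ≠ 0 := fun x t h => hv (by
    have h1 := congrArg (E x t z).mulVec h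
    simpa only [w, Matrix.mulVec_mulVec, hE.mul_inv ha hb hu, Matrix.one_mulVec,
      Matrix.mulVec_zero] using h1)
  have hwsmooth : ∀ i, ContDiff ℝ ∞ fun p : ℝ × ℝ => w p.1 p.2 i := fun i => by
    simp only [w, Matrix.mulVec, dotProduct, Matrix.conjTranspose_apply]
    exact ContDiff.sum fun k _ =>
      (Complex.conjCLE.contDiff.comp (hsmooth (conj z) k i)).mul contDiff_const
  have hmulVec : ∀ {F : ℝ → Mat n} {A : Mat n} {x : ℝ}, HasMatDerivAt F (-(A * F x)) x → ∀ i,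
      HasDerivAt (fun y => (F y).mulVec v i) (-(A.mulVec ((F x).mulVec v) i)) x := by
    intro F A x hF i
    have h1 : -(A.mulVec ((F x).mulVec v) i) = ∑ k, (-(A * F x)) i k * v k := by
      rw [Matrix.mulVec_mulVec]
      simp [Matrix.mulVec, dotProduct]
    rw [h1]
    simp only [Matrix.mulVec, dotProduct]
    exact HasDerivAt.fun_sum fun k _ => (hF i k).mul_const (v k)
  have hlax : ∀ x t, (z • Matrix.diagonal a + u x t)ᴴ = -(conj z • Matrix.diagonal a + u x t) :=
    fun x t => by simpa using hu.conjTranspose_lax ha x t (conj z)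
  have hflow : ∀ x t, (flowOp a b j u x t z)ᴴ = -flowOp a b j u x t (conj z) :=
    fun x t => by simpa using hu.conjTranspose_flowOp ha hb x t (conj z)
  have hπx : ∀ x t, HasMatDerivAt (fun x => rankOneProj (w x t))
      (rankOneProj (w x t) *
        ((z • Matrix.diagonal a + u x t) - (conj z • Matrix.diagonal a + u x t)) *
        rankOneProj (w x t) - ((z • Matrix.diagonal a + u x t) * rankOneProj (w x t) -
          rankOneProj (w x t) * (conj z • Matrix.diagonal a + u x t))) x := fun x t =>
    (hasMatDerivAt_rankOneProj (w := fun x => w x t)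
      (hmulVec (hE.inv_deriv_x ha hu x t z)) (hw0 x t)).congr_deriv (by
        rw [hlax, Matrix.mul_neg, ← sub_eq_add_neg, ← sub_eq_add_neg])
  have hπt : ∀ x t, HasMatDerivAt (fun t => rankOneProj (w x t))
      (rankOneProj (w x t) * (flowOp a b j u x t z - flowOp a b j u x t (conj z)) *
        rankOneProj (w x t) - (flowOp a b j u x t z * rankOneProj (w x t) -
          rankOneProj (w x t) * flowOp a b j u x t (conj z))) t := fun x t =>
    (hasMatDerivAt_rankOneProj (w := fun t => w x t)
      (hmulVec (hE.inv_deriv_t ha hb hu x t z)) (hw0 x t)).congr_deriv (by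
        rw [hflow, Matrix.mul_neg, ← sub_eq_add_neg, ← sub_eq_add_neg])
  let S : ℝ → ℝ → Mat n := fun x t => darboux z (w x t)
  let u' : ℝ → ℝ → Mat n := fun x t =>
    u x t + (S x t * Matrix.diagonal a - Matrix.diagonal a * S x t)
  have hS : ∀ {F : ℝ → Fin n → ℂ} {D : Mat n} {s : ℝ},
      HasMatDerivAt (fun s => rankOneProj (F s)) D s →
      HasMatDerivAt (fun s => darboux z (F s)) ((conj z - z) • D) s := fun h =>
    ((h.const_smul (conj z - z)).sub (HasMatDerivAt.const (conj z • 1) _)).congr_deriv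
      (sub_zero _)
  have hSx : ∀ x t, HasMatDerivAt (fun x => S x t) (S x t * u x t - u' x t * S x t) x := fun x t =>
    (hS (hπx x t)).congr_deriv (darboux_deriv_eq (rankOneProj_mul_self (hw0 x t)) rfl)
  have hschw : ∀ t, IsSchwartz fun x => u' x t := fun t =>
    isSchwartz_darboux ha hz (hu.schwartz t) (fun x => hw0 x t) fun x => hπx x t
  have hperp : ∀ x t, u' x t ∈ centralizerPerp a := fun x t => by
    refine mem_centralizerPerp ?_ fun k l hkl => ?_
    · rw [Matrix.conjTranspose_add, (hu.mem_perp x t).1, conjTranspose_darboux_comm ha, neg_add]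
    · simp only [u', S, Matrix.add_apply (u x t), darboux_comm_sub,
        centralizerPerp_apply_eq_zero (hu.mem_perp x t) hkl, hkl]
      ring
  have hQ := fun x t k => Q_darboux hb (hu.schwartz t) (fun x => hu.mem_perp x t) (hschw t)
    (fun x => hperp x t) (fun x => hSx x t) (fun x => rfl) k x
  have hT : ∀ x t l, flowOp a b j u' x t l * (l • 1 + S x t) -
      (l • 1 + S x t) * flowOp a b j u x t l =
      Q a b (fun y => u y t) (j + 1) x - Q a b (fun y => u' y t) (j + 1) x := fun x t l =>
    timeOp_darboux (by rw [Q_zero hb (hschw t) (fun x => hperp x t),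
      Q_zero hb (hu.schwartz t) (fun x => hu.mem_perp x t)]) (hQ x t) j l
  -- The equation for π_t is combined with `hT` at λ = z and λ = z̄. Since `hT` comes from the
  -- x-dependence at a fixed t, no flow equation for u' is presupposed.
  have hSt : ∀ x t, HasMatDerivAt (fun t => S x t)
      (Q a b (fun y => u' y t) (j + 1) x - Q a b (fun y => u y t) (j + 1) x) t := fun x t =>
    (hS (hπt x t)).congr_deriv (darboux_deriv_time_eq (rankOneProj_mul_self (hw0 x t))
      ((hT x t z).trans (neg_sub _ _).symm) ((hT x t (conj z)).trans (neg_sub _ _).symm))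
  have hu' : IsSolution a b j u' :=
    { smooth := fun k l => by
        simp only [u', S, Matrix.add_apply (u _ _), darboux_comm_sub]
        exact (hu.smooth k l).add (contDiff_const.mul
          (contDiff_rankOneProj (w := fun p : ℝ × ℝ => w p.1 p.2) hwsmooth
            (fun p => hw0 p.1 p.2) k l))
      mem_perp := hperp
      schwartz := hschw
      flow := fun x t => by
        refine ((hu.flow' hb x t).add (((hSt x t).mul_const (Matrix.diagonal a)).sub
          ((hSt x t).const_mul (Matrix.diagonal a)))).congr_deriv ?_
        rw [(hasMatDerivAt_Q hb (hschw t) (fun x => hperp x t) j x).matDeriv]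
        noncomm_ring }
  obtain ⟨E', hE', hE'G, -⟩ := hu'.exists_trivialization ha hb
  refine ⟨u', E', w, hu', hE', hE'G, hw0, fun x t l => ?_⟩
  have h1 : w 0 0 = v := by simp [w, hE.base]
  -- E'(λ + S) is parallel for the connection of u, hence a constant times E; the constant is its
  -- value at the origin, where w = v.
  have h2 := hE.eq_mul ha hb hu (F := fun x t => E' x t l * (l • 1 + S x t)) (l := l)
    (fun x t => ((hE'.deriv_x x t l).mul ((HasMatDerivAt.const (l • 1) x).add
      (hSx x t))).congr_deriv (by
        simp only [u', Matrix.mul_add, Matrix.add_mul, Matrix.mul_sub, Matrix.sub_mul,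
          Matrix.mul_smul, Matrix.smul_mul, Matrix.mul_one, Matrix.mul_assoc, zero_add]
        module))
    (fun x t => ((hE'.deriv_t x t l).mul ((HasMatDerivAt.const (l • 1) t).add
      (hSt x t))).congr_deriv (by
        change E' x t l * flowOp a b j u' x t l * (l • 1 + S x t) + _ = _
        have h3 := hT x t l
        rw [sub_eq_iff_eq_add] at h3
        rw [Matrix.mul_assoc, h3, Matrix.mul_assoc]
        noncomm_ring)) x t
  rw [h2]
  simp only [S, h1, hE'.base, Matrix.one_mul]

/-! ### Matrices of rational functions and their values -/

theorem infinite_of_eventually_cofinite {p : ℂ → Prop} (h : ∀ᶠ l in cofinite, p l) :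
    {l | p l}.Infinite := by
  have h1 : {l | ¬p l}.Finite := h
  have h2 := h1.infinite_compl
  rwa [show {l | ¬p l}ᶜ = {l | p l} by ext; simp] at h2

theorem eq_of_eventually_eq_cofinite {X : Type*} [TopologicalSpace X] [T2Space X] {f g : ℂ → X}
    (hf : Continuous f) (hg : Continuous g) (h : ∀ᶠ l in cofinite, f l = g l) : f = g := by
  have h1 : {l | ¬f l = g l}.Finite := h
  refine Continuous.ext_on (s := {l | f l = g l}) ?_ hf hg fun l hl => hl
  have h2 := h1.countable.dense_compl ℂ
  rwa [show {l | ¬f l = g l}ᶜ = {l | f l = g l} by ext; simp] at h2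

theorem eventually_ne_cofinite (z : ℂ) : ∀ᶠ l in cofinite, l ≠ z := by
  have := (Set.finite_singleton z).eventually_cofinite_notMem
  filter_upwards [this] with l hl h
  exact hl h

/-- `RatFunc.eval` has junk values at poles, so values are compared off a finite set only; the
cross-multiplied polynomials still agree at infinitely many points. -/
theorem ratFunc_eq_of_eval {r s : RatFunc ℂ}
    (h : ∀ᶠ l in cofinite, RatFunc.eval (RingHom.id ℂ) l r = RatFunc.eval (RingHom.id ℂ) l s) :
    r = s := by
  have h1 : r.num * s.denom = s.num * r.denom := by
    refine Polynomial.eq_of_infinite_eval_eq _ _ (infinite_of_eventually_cofinite ?_)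
    filter_upwards [h, eventually_denom_ne_zero r, eventually_denom_ne_zero s] with l h1 h2 h3
    simp only [RatFunc.eval] at h1
    rw [div_eq_div_iff h2 h3] at h1
    simpa [Polynomial.eval₂_id] using h1
  rw [← RatFunc.num_div_denom r, ← RatFunc.num_div_denom s, div_eq_div_iff
    (RatFunc.algebraMap_ne_zero r.denom_ne_zero) (RatFunc.algebraMap_ne_zero s.denom_ne_zero),
    ← map_mul, ← map_mul, h1]

theorem eq_of_evalAt {g h : Matrix (Fin n) (Fin n) (RatFunc ℂ)}
    (hgh : ∀ᶠ l in cofinite, evalAt g l = evalAt h l) : g = h := by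
  ext i j : 2
  refine ratFunc_eq_of_eval ?_
  filter_upwards [hgh] with l hl
  exact congrFun (congrFun hl i) j

theorem GMinus.ext_evalAt {g h : GMinus n}
    (hgh : ∀ᶠ l in cofinite, evalAt g.1.val l = evalAt h.1.val l) : g = h :=
  Subtype.ext (Units.ext (eq_of_evalAt hgh))

theorem GMinus.eventually_evalAt_mul (g h : GMinus n) :
    ∀ᶠ l in cofinite, evalAt (g * h).1.val l = evalAt g.1.val l * evalAt h.1.val l :=
  UnHierarchy.eventually_evalAt_mul g.1.val h.1.val

theorem GMinus.eventually_mul_conjTranspose (g : GMinus n) :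
    ∀ᶠ l in cofinite, evalAt g.1.val l * (evalAt g.1.val (conj l))ᴴ = 1 := by
  filter_upwards [g.2.1] with l hl
  exact mul_eq_one_comm.1 hl

theorem eval_div {p q : Polynomial ℂ} {l : ℂ} (hq : q.eval l ≠ 0) :
    RatFunc.eval (RingHom.id ℂ) l (algebraMap (Polynomial ℂ) (RatFunc ℂ) p / algebraMap _ _ q) =
      p.eval l / q.eval l := by
  have hq0 : q ≠ 0 := fun h => hq (by simp [h])
  rw [eq_div_iff hq]
  have h1 : RatFunc.eval (RingHom.id ℂ) l (algebraMap (Polynomial ℂ) (RatFunc ℂ) q) = q.eval l := by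
    simp [Polynomial.eval₂_id]
  rw [← h1, ← RatFunc.eval_mul, div_mul_cancel₀ _ (RatFunc.algebraMap_ne_zero hq0)]
  · simp [Polynomial.eval₂_id]
  · rw [Polynomial.eval₂_id]
    exact fun h => hq (Polynomial.eval_eq_zero_of_dvd_of_eval_eq_zero (RatFunc.denom_div_dvd p q) h)
  · simp

/-! ### Simple elements -/

section Simple

/-- The matrix `(λ + S) / (λ - z̄)`, where `S` is a Darboux matrix. -/
def simpleMat (z : ℂ) (w : Fin n → ℂ) : Matrix (Fin n) (Fin n) (RatFunc ℂ) :=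
  Matrix.of fun i j => algebraMap (Polynomial ℂ) (RatFunc ℂ)
    ((if i = j then Polynomial.X else 0) + Polynomial.C (darboux z w i j)) /
      algebraMap _ _ (Polynomial.X - Polynomial.C (conj z))

theorem evalAt_simpleMat (w : Fin n → ℂ) {z l : ℂ} (hl : l ≠ conj z) :
    evalAt (simpleMat z w) l = (l - conj z)⁻¹ • (l • 1 + darboux z w) := by
  ext i j
  have hq : (Polynomial.X - Polynomial.C (conj z)).eval l ≠ 0 := by simpa [sub_eq_zero] using hl
  simp only [evalAt, simpleMat, Matrix.map_apply, Matrix.of_apply, eval_div hq]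
  by_cases hij : i = j
  · subst hij
    simp
    ring
  · simp [hij]
    ring

/-- Replacing z by z̄ exchanges the eigenvalues λ - z and λ - z̄ on the image and the kernel of π,
so the product is scalar. -/
theorem darboux_mul_darboux_conj (z l : ℂ) {w : Fin n → ℂ} (hw : w ≠ 0) :
    (l • 1 + darboux z w) * (l • 1 + darboux (conj z) w) = ((l - conj z) * (l - z)) • 1 := by
  simp only [darboux, Complex.conj_conj, Matrix.mul_add, Matrix.add_mul, Matrix.mul_sub,
    Matrix.sub_mul, Matrix.smul_mul, Matrix.mul_smul, Matrix.mul_one, Matrix.one_mul,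
    rankOneProj_mul_self hw]
  module

theorem conjTranspose_darboux (z : ℂ) (w : Fin n → ℂ) :
    (darboux z w)ᴴ = darboux (conj z) w := by
  simp [darboux, Matrix.conjTranspose_sub, Matrix.conjTranspose_smul, conjTranspose_rankOneProj]

theorem evalAt_simpleMat_mul (z : ℂ) {w : Fin n → ℂ} (hw : w ≠ 0) {l : ℂ} (h1 : l ≠ z)
    (h2 : l ≠ conj z) : evalAt (simpleMat z w) l * evalAt (simpleMat (conj z) w) l = 1 := by
  rw [evalAt_simpleMat w h2, evalAt_simpleMat w (by simpa using h1), Matrix.smul_mul,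
    Matrix.mul_smul, darboux_mul_darboux_conj z l hw, smul_smul, smul_smul, Complex.conj_conj]
  have h3 := sub_ne_zero.2 h1
  have h4 := sub_ne_zero.2 h2
  rw [show (l - conj z)⁻¹ * (l - z)⁻¹ * ((l - conj z) * (l - z)) = 1 by field_simp, one_smul]

theorem simpleMat_mul (z : ℂ) {w : Fin n → ℂ} (hw : w ≠ 0) :
    simpleMat z w * simpleMat (conj z) w = 1 := by
  refine eq_of_evalAt ?_
  filter_upwards [eventually_evalAt_mul (simpleMat z w) (simpleMat (conj z) w),
    eventually_ne_cofinite z, eventually_ne_cofinite (conj z)] with l h1 h2 h3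
  rw [h1, evalAt_simpleMat_mul z hw h2 h3, evalAt_one]

/-- The simple element `π^⊥ + (λ - z) / (λ - z̄) π` of `G_-^m`, where `π` is the projection onto the
line spanned by `w`. -/
def simpleElt (z : ℂ) (w : Fin n → ℂ) (hw : w ≠ 0) : GMinus n where
  val :=
    { val := simpleMat z w
      inv := simpleMat (conj z) w
      val_inv := simpleMat_mul z hw
      inv_val := by simpa using simpleMat_mul (conj z) hw }
  property := by
    constructor
    · filter_upwards [eventually_ne_cofinite z, eventually_ne_cofinite (conj z)] with l h1 h2
      have h3 : conj l ≠ conj z := fun h => h1 (star_injective h)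
      have h4 : (evalAt (simpleMat z w) (conj l))ᴴ = evalAt (simpleMat (conj z) w) l := by
        rw [evalAt_simpleMat w h3, evalAt_simpleMat w (by simpa using h1),
          Matrix.conjTranspose_smul, Matrix.conjTranspose_add, conjTranspose_darboux,
          Matrix.conjTranspose_smul]
        simp
      change (evalAt (simpleMat z w) (conj l))ᴴ * evalAt (simpleMat z w) l = 1
      rw [h4]
      exact mul_eq_one_comm.1 (evalAt_simpleMat_mul z hw h1 h2)
    · have h1 : Tendsto (fun l : ℂ => (l - conj z)⁻¹) (cocompact ℂ) (𝓝 0) := by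
        have h2 : Tendsto (fun l : ℂ => l - conj z) (cocompact ℂ) (cocompact ℂ) :=
          (Homeomorph.subRight (conj z)).isClosedEmbedding.tendsto_cocompact
        rw [← Metric.cobounded_eq_cocompact] at h2 ⊢
        exact tendsto_inv₀_cobounded.comp h2
      have h2 : Tendsto (fun l : ℂ => (1 : Mat n) + (l - conj z)⁻¹ • ((conj z - z) • rankOneProj w))
          (cocompact ℂ) (𝓝 (1 + (0 : ℂ) • ((conj z - z) • rankOneProj w))) :=
        tendsto_const_nhds.add (h1.smul tendsto_const_nhds)
      rw [zero_smul, add_zero] at h2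
      refine h2.congr' ?_
      filter_upwards [cocompact_le_cofinite (eventually_ne_cofinite (conj z))] with l hl
      rw [evalAt_simpleMat w hl]
      have h3 : l • (1 : Mat n) + darboux z w =
          (l - conj z) • (1 : Mat n) + (conj z - z) • rankOneProj w := by
        rw [darboux]
        module
      rw [h3, smul_add, inv_smul_smul₀ (sub_ne_zero.2 hl)]

theorem evalAt_simpleElt {z : ℂ} {w : Fin n → ℂ} (hw : w ≠ 0) {l : ℂ} (hl : l ≠ conj z) :
    evalAt (simpleElt z w hw).1.val l = (l - conj z)⁻¹ • (l • 1 + darboux z w) :=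
  evalAt_simpleMat w hl

theorem simpleElt_mul_conj (z : ℂ) {w : Fin n → ℂ} (hw : w ≠ 0) :
    simpleElt z w hw * simpleElt (conj z) w hw = 1 :=
  Subtype.ext (Units.ext (simpleMat_mul z hw))

end Simple

/-! ### Generation of `G_-^m` by simple elements -/

/-- `P` is a matrix of polynomials with `P = d g`. -/
def IsNumerator (g : GMinus n) (d : Polynomial ℂ) (P : Matrix (Fin n) (Fin n) (Polynomial ℂ)) :
    Prop :=
  ∀ᶠ l in cofinite, d.eval l • evalAt g.1.val l = P.map (Polynomial.eval l)

theorem exists_common_multiple (f : Fin n → Fin n → Polynomial ℂ) (hf : ∀ i j, f i j ≠ 0) :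
    ∃ d : Polynomial ℂ, d ≠ 0 ∧ ∀ i j, f i j ∣ d := by
  refine ⟨∏ i, ∏ k, f i k, ?_, fun i k => ?_⟩
  · exact Finset.prod_ne_zero_iff.2 fun i _ => Finset.prod_ne_zero_iff.2 fun k _ => hf i k
  · exact (Finset.dvd_prod_of_mem (f i) (Finset.mem_univ k)).trans
      (Finset.dvd_prod_of_mem (fun i => ∏ k, f i k) (Finset.mem_univ i))

theorem GMinus.exists_numerator (g : GMinus n) :
    ∃ (d : Polynomial ℂ) (P : Matrix (Fin n) (Fin n) (Polynomial ℂ)), d ≠ 0 ∧ IsNumerator g d P := by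
  obtain ⟨d, hd0, hdvd⟩ := exists_common_multiple (fun i j => (g.1.val i j).denom)
    fun i j => RatFunc.denom_ne_zero _
  choose c hc using hdvd
  refine ⟨d, Matrix.of fun i j => (g.1.val i j).num * c i j, hd0, ?_⟩
  have h : ∀ᶠ l in cofinite, ∀ i j,
      Polynomial.eval₂ (RingHom.id ℂ) l (g.1.val i j).denom ≠ 0 :=
    eventually_all.2 fun i => eventually_all.2 fun j => eventually_denom_ne_zero _
  filter_upwards [h] with l hl
  ext i j
  have h1 := hl i j
  rw [Polynomial.eval₂_id] at h1
  have h2 := congrArg (Polynomial.eval l) (hc i j)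
  rw [Polynomial.eval_mul] at h2
  simp only [Matrix.smul_apply, evalAt, Matrix.map_apply, RatFunc.eval, Polynomial.eval₂_id,
    Matrix.of_apply, Polynomial.eval_mul, smul_eq_mul, h2]
  field_simp

section Numerator

variable {g : GMinus n} {d : Polynomial ℂ} {P : Matrix (Fin n) (Fin n) (Polynomial ℂ)}

/-- The reality condition of g with denominators cleared. Both sides are continuous, so the identity
extends to every λ, in particular to the zeros of d, where it is needed. -/
theorem IsNumerator.mul_conjTranspose (h : IsNumerator g d P) (l : ℂ) :
    P.map (Polynomial.eval l) * (P.map (Polynomial.eval (conj l)))ᴴ =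
      (d.eval l * conj (d.eval (conj l))) • 1 := by
  have hP : Continuous fun l => P.map (Polynomial.eval l) :=
    continuous_matrix fun i j => (P i j).continuous
  have hconj : Continuous fun l : ℂ => conj l := Complex.continuous_conj
  refine congrFun (eq_of_eventually_eq_cofinite (f := fun l => P.map (Polynomial.eval l) *
    (P.map (Polynomial.eval (conj l)))ᴴ) (g := fun l => (d.eval l * conj (d.eval (conj l))) •
      (1 : Mat n)) (hP.matrix_mul (hP.comp hconj).matrix_conjTranspose) ?_ ?_) l
  · exact (d.continuous.mul (hconj.comp (d.continuous.comp hconj))).smul continuous_const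
  · filter_upwards [h, tendsto_conj_cofinite.eventually h, GMinus.eventually_mul_conjTranspose g]
      with l h1 h2 h3
    rw [← h1, ← h2, Matrix.conjTranspose_smul, Matrix.smul_mul, Matrix.mul_smul, h3, smul_smul]
    rfl

/-- With a constant denominator the entries are entire and have limits at infinity; Liouville makes
them constant. -/
theorem eq_one_of_isNumerator_of_degree (h : IsNumerator g d P) (hd : d ≠ 0)
    (hdeg : d.natDegree = 0) : g = 1 := by
  obtain ⟨c, rfl⟩ := Polynomial.natDegree_eq_zero.1 hdeg
  have hc : c ≠ 0 := fun h => hd (by simp [h])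
  have h1 : ∀ᶠ l in cofinite, evalAt g.1.val l = c⁻¹ • P.map (Polynomial.eval l) := by
    filter_upwards [h] with l hl
    rw [← hl, Polynomial.eval_C, inv_smul_smul₀ hc]
  have h2 : Tendsto (fun l => c⁻¹ • P.map (Polynomial.eval l)) (cocompact ℂ) (𝓝 (1 : Mat n)) :=
    g.2.2.congr' (cocompact_le_cofinite h1)
  have h3 : ∀ l, c⁻¹ • P.map (Polynomial.eval l) = 1 := by
    intro l
    ext i j
    refine Differentiable.apply_eq_of_tendsto_cocompact
      (f := fun l => (c⁻¹ • P.map (Polynomial.eval l)) i j) ?_ l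
      (((continuous_id.matrix_elem i j).tendsto (1 : Mat n)).comp h2)
    exact (P i j).differentiable.const_mul c⁻¹
  refine GMinus.ext_evalAt ?_
  filter_upwards [h1] with l hl
  rw [hl, h3]
  exact (evalAt_one l).symm

theorem IsNumerator.of_mul {z : ℂ} {d' : Polynomial ℂ}
    {P' : Matrix (Fin n) (Fin n) (Polynomial ℂ)} (h : IsNumerator g d P)
    (hd : d = (Polynomial.X - Polynomial.C z) * d')
    (hP : ∀ i j, P i j = (Polynomial.X - Polynomial.C z) * P' i j) : IsNumerator g d' P' := by
  filter_upwards [h, eventually_ne_cofinite z] with l h1 h2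
  have h3 : l - z ≠ 0 := sub_ne_zero.2 h2
  ext i j
  have h4 := congrFun (congrFun h1 i) j
  simp only [hd, Matrix.smul_apply, Matrix.map_apply, hP, Polynomial.eval_mul, Polynomial.eval_sub,
    Polynomial.eval_X, Polynomial.eval_C, smul_eq_mul, mul_assoc] at h4 ⊢
  exact mul_left_cancel₀ h3 h4

/-- The simple element is (1 - π) + (λ - z)/(λ - z̄) π. Its pole at z̄ is cancelled because P(z̄)w =
0 makes Pπ divisible by λ - z̄, so the same d clears denominators. At λ = z the second term
vanishes. -/
theorem IsNumerator.mul_simpleElt {z : ℂ} {w : Fin n → ℂ} (hw : w ≠ 0) (h : IsNumerator g d P)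
    (hP : (P.map (Polynomial.eval (conj z))).mulVec w = 0) :
    ∃ P' : Matrix (Fin n) (Fin n) (Polynomial ℂ), IsNumerator (g * simpleElt z w hw) d P' ∧
      P'.map (Polynomial.eval z) = P.map (Polynomial.eval z) * (1 - rankOneProj w) := by
  let R₀ : Matrix (Fin n) (Fin n) (Polynomial ℂ) := P * (rankOneProj w).map Polynomial.C
  have hR₀ : ∀ l, R₀.map (Polynomial.eval l) = P.map (Polynomial.eval l) * rankOneProj w := by
    intro l
    ext i j
    simp [R₀, Matrix.mul_apply, Polynomial.eval_finsetSum]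
  have hroot : ∀ i j, (Polynomial.X - Polynomial.C (conj z)) ∣ R₀ i j := by
    intro i j
    rw [Polynomial.dvd_iff_isRoot, Polynomial.IsRoot]
    have h1 := congrFun (congrFun (hR₀ (conj z)) i) j
    rw [Matrix.map_apply] at h1
    rw [h1]
    have h2 := congrFun hP i
    simp only [Matrix.mulVec, dotProduct, Pi.zero_apply] at h2
    simp only [Matrix.mul_apply, rankOneProj, Matrix.of_apply]
    calc ∑ k, P.map (Polynomial.eval (conj z)) i k * ((sqLen w : ℂ)⁻¹ * (w k * conj (w j)))
        = (∑ k, P.map (Polynomial.eval (conj z)) i k * w k) * ((sqLen w : ℂ)⁻¹ * conj (w j)) := by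
          rw [Finset.sum_mul]
          exact Finset.sum_congr rfl fun k _ => by ring
      _ = 0 := by rw [h2, zero_mul]
  choose R hR using hroot
  let P' : Matrix (Fin n) (Fin n) (Polynomial ℂ) :=
    Matrix.of fun i j => P i j - R₀ i j + (Polynomial.X - Polynomial.C z) * R i j
  have hP' : ∀ l, P'.map (Polynomial.eval l) = P.map (Polynomial.eval l) * (1 - rankOneProj w) +
      (l - z) • (Matrix.of R).map (Polynomial.eval l) := by
    intro l
    rw [Matrix.mul_sub, Matrix.mul_one, ← hR₀]
    ext i j
    simp [P']
  refine ⟨P', ?_, by rw [hP', sub_self, zero_smul, add_zero]⟩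
  filter_upwards [h, GMinus.eventually_evalAt_mul g (simpleElt z w hw), eventually_ne_cofinite (conj z)]
    with l h1 h2 h3
  have h4 : l - conj z ≠ 0 := sub_ne_zero.2 h3
  have h5 : P.map (Polynomial.eval l) * rankOneProj w =
      (l - conj z) • (Matrix.of R).map (Polynomial.eval l) := by
    rw [← hR₀]
    ext i j
    simp [hR]
  have h6 : l • (1 : Mat n) + darboux z w =
      (l - conj z) • (1 - rankOneProj w) + (l - z) • rankOneProj w := by
    rw [darboux]
    module
  rw [h2, ← Matrix.smul_mul, h1, evalAt_simpleElt hw h3, h6, hP', smul_add,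
    inv_smul_smul₀ h4, Matrix.mul_add, Matrix.mul_smul, Matrix.mul_smul, h5, smul_comm (l - z),
    inv_smul_smul₀ h4]

end Numerator

theorem conj_dotProduct_self {w : Fin n → ℂ} : (fun i => conj (w i)) ⬝ᵥ w = (sqLen w : ℂ) := by
  rw [sqLen_cast]
  exact Finset.sum_congr rfl fun i _ => mul_comm _ _

theorem rankOneProj_mulVec (w x : Fin n → ℂ) : (rankOneProj w).mulVec x =
    ((sqLen w : ℂ)⁻¹ * ((fun i => conj (w i)) ⬝ᵥ x)) • w := by
  ext i
  simp only [Matrix.mulVec, dotProduct, rankOneProj, Matrix.of_apply, Pi.smul_apply, smul_eq_mul,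
    Finset.mul_sum, Finset.sum_mul]
  exact Finset.sum_congr rfl fun k _ => by ring

/-- Multiplication by `1 - π`, where the image of `π` is a line in the image of `Mᴴ`, enlarges the
kernel of `M`. -/
theorem ker_lt_ker_mul {M : Mat n} {y w : Fin n → ℂ} (hy : Mᴴ.mulVec y = w) (hw : w ≠ 0) :
    LinearMap.ker M.mulVecLin < LinearMap.ker (M * (1 - rankOneProj w)).mulVecLin := by
  -- The kernel of M is orthogonal to the image of M*, hence to w. So 1 - π fixes this kernel, while
  -- w itself is the additional kernel vector.
  have hdot : ∀ x, M.mulVec x = 0 → (fun i => conj (w i)) ⬝ᵥ x = 0 := by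
    intro x hx
    have h1 : (fun i => conj (w i)) = star y ᵥ* M := by
      rw [← Matrix.conjTranspose_conjTranspose M, ← Matrix.star_mulVec, hy]
      rfl
    rw [h1, ← Matrix.dotProduct_mulVec, hx, dotProduct_zero]
  refine lt_of_le_of_ne (fun x hx => ?_) fun h => ?_
  · rw [LinearMap.mem_ker, Matrix.mulVecLin_apply] at hx ⊢
    rw [← Matrix.mulVec_mulVec, Matrix.sub_mulVec, Matrix.one_mulVec, rankOneProj_mulVec,
      hdot x hx, mul_zero, zero_smul, sub_zero, hx]
  · have h1 : w ∈ LinearMap.ker (M * (1 - rankOneProj w)).mulVecLin := by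
      rw [LinearMap.mem_ker, Matrix.mulVecLin_apply, ← Matrix.mulVec_mulVec, Matrix.sub_mulVec,
        Matrix.one_mulVec, rankOneProj_mulVec, conj_dotProduct_self,
        inv_mul_cancel₀ (sqLen_ne_zero hw), one_smul, sub_self, Matrix.mulVec_zero]
    rw [← h, LinearMap.mem_ker, Matrix.mulVecLin_apply] at h1
    have h2 := hdot w h1
    rw [conj_dotProduct_self] at h2
    exact sqLen_ne_zero hw h2

open ComplexOrder in
/-- The group `G_-^m` is generated by the simple elements. -/
theorem GMinus.induction {C : GMinus n → Prop} (h1 : C 1)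
    (hmul : ∀ (g : GMinus n) (z : ℂ) (w : Fin n → ℂ) (hw : w ≠ 0), z.im ≠ 0 → C g →
      C (g * simpleElt z w hw)) (g : GMinus n) : C g := by
  -- A double induction: outside on the degree of the common denominator d; inside, for a root z of
  -- d, on the codimension of the kernel of P(z). If P(z) = 0, a factor λ - z cancels; otherwise a
  -- simple element enlarges the kernel without changing d.
  have main : ∀ (N : ℕ) (d : Polynomial ℂ), d ≠ 0 → d.natDegree = N →
      ∀ (g : GMinus n) (P : Matrix (Fin n) (Fin n) (Polynomial ℂ)), IsNumerator g d P → C g := by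
    intro N
    induction N with
    | zero =>
      intro d hd hdeg g P hP
      rwa [eq_one_of_isNumerator_of_degree hP hd hdeg]
    | succ N ih =>
      intro d hd hdeg
      obtain ⟨z, hz⟩ := Complex.exists_root (f := d)
        (Polynomial.natDegree_pos_iff_degree_pos.1 (by omega))
      suffices h : ∀ (r : ℕ) (g : GMinus n) (P : Matrix (Fin n) (Fin n) (Polynomial ℂ)),
          IsNumerator g d P →
          n - Module.finrank ℂ (LinearMap.ker (P.map (Polynomial.eval z)).mulVecLin) = r → C g from
        fun g P hP => h _ g P hP rfl
      intro r
      induction r using Nat.strong_induction_on with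
      | _ r ihr =>
        intro g P hP hr
        by_cases hP0 : P.map (Polynomial.eval z) = 0
        · obtain ⟨d', hd'⟩ := Polynomial.dvd_iff_isRoot.2 hz
          have hdvd : ∀ i j, (Polynomial.X - Polynomial.C z) ∣ P i j := fun i j =>
            Polynomial.dvd_iff_isRoot.2 (congrFun (congrFun hP0 i) j)
          choose P' hP' using hdvd
          have hd0 : d' ≠ 0 := fun h => hd (by rw [hd', h, mul_zero])
          refine ih d' hd0 ?_ g (Matrix.of P') (hP.of_mul hd' hP')
          rw [hd', Polynomial.natDegree_mul (Polynomial.X_sub_C_ne_zero z) hd0,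
            Polynomial.natDegree_X_sub_C] at hdeg
          omega
        · set M := P.map (Polynomial.eval z) with hM
          obtain ⟨y, hy⟩ : ∃ y, Mᴴ.mulVec y ≠ 0 := by
            by_contra! hcon
            refine hP0 (Matrix.conjTranspose_eq_zero.1 ?_)
            exact Matrix.ext_iff_mulVec.2 fun v => by rw [hcon, Matrix.zero_mulVec]
          -- As d(z) = 0, the reality condition gives P(z̄)P(z)* = 0. For real z this would be M M*
          -- = 0, contradicting M ≠ 0; in general it places the image of M* in the kernel of P(z̄).
          have hzero : ∀ l, conj l = z → P.map (Polynomial.eval l) * Mᴴ = 0 := by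
            intro l hl
            have h2 := hP.mul_conjTranspose l
            rw [hl, show d.eval z = 0 from hz, map_zero, mul_zero, zero_smul] at h2
            exact h2
          have him : z.im ≠ 0 := by
            intro h0
            have h2 := hzero z (Complex.conj_eq_iff_im.2 h0)
            rw [← hM, Matrix.self_mul_conjTranspose_eq_zero] at h2
            exact hP0 h2
          obtain ⟨P', hP', hP'z⟩ := hP.mul_simpleElt (z := z) hy (by
            rw [Matrix.mulVec_mulVec, hzero _ (Complex.conj_conj z), Matrix.zero_mulVec])
          have hlt := Submodule.finrank_lt_finrank_of_lt (ker_lt_ker_mul (M := M) rfl hy)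
          have hle := Submodule.finrank_le
            (LinearMap.ker (M * (1 - rankOneProj (Mᴴ.mulVec y))).mulVecLin)
          rw [Module.finrank_fin_fun] at hle
          have h3 : C (g * simpleElt z _ hy) := by
            refine ihr _ ?_ _ P' hP' rfl
            rw [hP'z, ← hM]
            omega
          -- The simple element for z̄ and the same line is the inverse of the one for z, so C
          -- returns from the product to g.
          have h4 := hmul _ (conj z) _ hy (by simpa using him) h3
          rwa [mul_assoc, simpleElt_mul_conj, mul_one] at h4
  obtain ⟨d, P, hd, hP⟩ := GMinus.exists_numerator g
  exact main _ d hd rfl g P hP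

/-! ### Uniqueness of factorizations -/

theorem IsGPlus.mul_conjTranspose {f : ℂ → Mat n} (hf : IsGPlus f) (l : ℂ) :
    f l * (f (conj l))ᴴ = 1 :=
  mul_eq_one_comm.1 (hf.reality l)

/-- The groups `G_+` and `G_-^m` meet in `1`, so that factorizations are unique. -/
theorem IsGPlus.eq_of_mul_evalAt_eq {f f' : ℂ → Mat n} (hf : IsGPlus f) (hf' : IsGPlus f')
    {g g' : GMinus n}
    (h : ∀ᶠ l in cofinite, f l * evalAt g.1.val l = f' l * evalAt g'.1.val l) :
    f = f' ∧ g = g' := by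
  -- The left-hand side is f'⁻¹ f, which is entire; the right-hand side tends to I at infinity.
  -- Liouville then gives f = f'.
  have h1 : ∀ᶠ l in cofinite, (f' (conj l))ᴴ * f l = evalAt (g' * g⁻¹).1.val l := by
    have h2 := GMinus.eventually_evalAt_mul (g' * g⁻¹) g
    rw [inv_mul_cancel_right] at h2
    filter_upwards [h, h2, GMinus.eventually_mul_conjTranspose g] with l h3 h4 h5
    calc (f' (conj l))ᴴ * f l
        = (f' (conj l))ᴴ * (f l * evalAt g.1.val l) * (evalAt g.1.val (conj l))ᴴ := by
          rw [Matrix.mul_assoc, Matrix.mul_assoc (f l), h5, Matrix.mul_one]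
      _ = evalAt g'.1.val l * (evalAt g.1.val (conj l))ᴴ := by
          rw [h3, ← Matrix.mul_assoc _ (f' l), hf'.reality, Matrix.one_mul]
      _ = _ := by rw [h4, Matrix.mul_assoc, h5, Matrix.mul_one]
  have h2 : Tendsto (fun l => (f' (conj l))ᴴ * f l) (cocompact ℂ) (𝓝 (1 : Mat n)) :=
    (g' * g⁻¹).2.2.congr' (cocompact_le_cofinite (h1.mono fun l hl => hl.symm))
  have h3 : ∀ l, (f' (conj l))ᴴ * f l = 1 := by
    intro l
    ext i j
    refine Differentiable.apply_eq_of_tendsto_cocompact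
      (f := fun l => ((f' (conj l))ᴴ * f l) i j) ?_ l
      (((continuous_id.matrix_elem i j).tendsto (1 : Mat n)).comp h2)
    simp only [Matrix.mul_apply, Matrix.conjTranspose_apply]
    refine Differentiable.fun_sum fun k _ => Differentiable.mul (fun l => ?_) (hf.holo k j)
    have h4 := (hf'.holo k i (conj l)).star_star
    rwa [show star (conj l) = l from Complex.conj_conj l] at h4
  have h4 : f = f' := by
    funext l
    rw [← Matrix.one_mul (f l), ← hf'.mul_conjTranspose l, Matrix.mul_assoc, h3, Matrix.mul_one]
  refine ⟨h4, GMinus.ext_evalAt ?_⟩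
  filter_upwards [h] with l hl
  rw [← Matrix.one_mul (evalAt g.1.val l), ← hf'.reality l, Matrix.mul_assoc, ← h4, hl, ← h4,
    ← Matrix.mul_assoc, hf.reality, Matrix.one_mul]

theorem IsFactorization.unique {g g₁ g₂ : GMinus n} {f f₁ f₂ : ℂ → Mat n}
    (h₁ : IsFactorization g f f₁ g₁) (h₂ : IsFactorization g f f₂ g₂) : f₁ = f₂ ∧ g₁ = g₂ := by
  refine h₁.1.eq_of_mul_evalAt_eq h₂.1 ?_
  filter_upwards [h₁.2, h₂.2] with l h3 h4
  rw [← h3, h4]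

theorem IsFactorization.mul {g h g' h' : GMinus n} {f f' f'' : ℂ → Mat n}
    (h₁ : IsFactorization h f f' h') (h₂ : IsFactorization g f' f'' g') :
    IsFactorization (g * h) f f'' (g' * h') := by
  refine ⟨h₂.1, ?_⟩
  filter_upwards [h₁.2, h₂.2, GMinus.eventually_evalAt_mul g h,
    GMinus.eventually_evalAt_mul g' h'] with l h3 h4 h5 h6
  rw [h5, h6, Matrix.mul_assoc, h3, ← Matrix.mul_assoc, h4, Matrix.mul_assoc]

/-! ### The dressing action -/

section Dressing

variable {a : Fin n → ℂ} {b : Mat n} {j : ℕ} {u u₁ u₂ : ℝ → ℝ → Mat n}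

/-- The solution `u'` arises from `u` by factoring the product of `g` with the trivialization
of `u`. -/
def IsDressing (a : Fin n → ℂ) (b : Mat n) (j : ℕ) (g : GMinus n) (u u' : ℝ → ℝ → Mat n) : Prop :=
  ∀ E, IsTrivialization a b j u E → ∃ (E' : ℝ → ℝ → ℂ → Mat n) (g' : ℝ → ℝ → GMinus n),
    IsTrivialization a b j u' E' ∧ ∀ x t, IsFactorization g (E x t) (E' x t) (g' x t)

theorem isDressing_one (ha : ∀ i, (a i).re = 0) (hb : IsSpectral a b)
    (hu : IsSolution a b j u) : IsDressing a b j 1 u u := by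
  intro E hE
  obtain ⟨E₀, hE₀, hplus, -⟩ := hu.exists_trivialization ha hb
  rw [← hE.unique ha hb hu hE₀] at *
  refine ⟨E₀, fun _ _ => 1, hE₀, fun x t => ⟨hplus x t, Eventually.of_forall fun l => ?_⟩⟩
  rw [show evalAt (1 : GMinus n).1.val l = 1 from evalAt_one l, Matrix.one_mul, Matrix.mul_one]

theorem IsDressing.mul {g h : GMinus n} (h₁ : IsDressing a b j h u u₁)
    (h₂ : IsDressing a b j g u₁ u₂) : IsDressing a b j (g * h) u u₂ := by
  intro E hE
  obtain ⟨E₁, h', hE₁, hf₁⟩ := h₁ E hE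
  obtain ⟨E₂, g', hE₂, hf₂⟩ := h₂ E₁ hE₁
  exact ⟨E₂, fun x t => g' x t * h' x t, hE₂, fun x t => (hf₁ x t).mul (hf₂ x t)⟩

/-- Uniqueness of factorizations determines E', and E' determines the new solution as E'⁻¹ E'_x at λ
= 0. -/
theorem IsDressing.unique (ha : ∀ i, (a i).re = 0) (hb : IsSpectral a b)
    (hu : IsSolution a b j u) (hu₁ : IsSolution a b j u₁) {g : GMinus n}
    (h₁ : IsDressing a b j g u u₁) (h₂ : IsDressing a b j g u u₂) : u₁ = u₂ := by
  obtain ⟨E, hE, -⟩ := hu.exists_trivialization ha hb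
  obtain ⟨E₁, g₁, hE₁, hf₁⟩ := h₁ E hE
  obtain ⟨E₂, g₂, hE₂, hf₂⟩ := h₂ E hE
  obtain rfl : E₁ = E₂ := by
    funext x t
    exact ((hf₁ x t).unique (hf₂ x t)).1
  funext x t
  have h := (hE₁.deriv_x x t 0).unique (hE₂.deriv_x x t 0)
  have h' := congrArg (fun M => (E₁ x t (conj 0))ᴴ * M) h
  simpa only [← Matrix.mul_assoc, hE₁.inv_mul ha hb hu₁, Matrix.one_mul, zero_smul, zero_add]
    using h'

theorem exists_isDressing_simpleElt (ha : ∀ i, (a i).re = 0) (hb : IsSpectral a b)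
    (hu : IsSolution a b j u) {z : ℂ} (hz : z.im ≠ 0) {v : Fin n → ℂ} (hv : v ≠ 0) :
    ∃ u', IsSolution a b j u' ∧ IsDressing a b j (simpleElt z v hv) u u' := by
  obtain ⟨E, hE, -⟩ := hu.exists_trivialization ha hb
  obtain ⟨u', E', w, hu', hE', hplus, hw, h⟩ := hu.exists_darboux ha hb hE hz hv
  refine ⟨u', hu', fun F hF => ⟨E', fun x t => simpleElt z (w x t) (hw x t), hE', fun x t =>
    ⟨hplus x t, ?_⟩⟩⟩
  rw [hE.unique ha hb hu hF]
  filter_upwards [eventually_ne_cofinite (conj z)] with l hl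
  rw [evalAt_simpleElt hv hl, evalAt_simpleElt (hw x t) hl, Matrix.smul_mul, h, Matrix.mul_smul]

/-- In g · s the simple element s acts first, so the induction hypothesis for g must cover all
solutions u. -/
theorem exists_isDressing (ha : ∀ i, (a i).re = 0) (hb : IsSpectral a b) (g : GMinus n) :
    ∀ u, IsSolution a b j u → ∃ u', IsSolution a b j u' ∧ IsDressing a b j g u u' := by
  induction g using GMinus.induction with
  | h1 => exact fun u hu => ⟨u, hu, isDressing_one ha hb hu⟩
  | hmul g z w hw hz ih =>
    intro u hu
    obtain ⟨u₁, hu₁, h₁⟩ := exists_isDressing_simpleElt ha hb hu hz hw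
    obtain ⟨u₂, hu₂, h₂⟩ := ih u₁ hu₁
    exact ⟨u₂, hu₂, h₁.mul h₂⟩

/-- The action of `G_-^m` on the space of solutions by dressing. -/
theorem exists_mulAction_isDressing (ha : ∀ i, (a i).re = 0) (hb : IsSpectral a b) (j : ℕ) :
    ∃ act : MulAction (GMinus n) (solutionSpace a b j),
      ∀ g (u : solutionSpace a b j), IsDressing a b j g u.1 (act.smul g u).1 := by
  -- The choice is harmless: `IsDressing.unique` pins down the result, and both laws of an action
  -- compare two dressings of u by the same group element.
  choose d hd using fun (g : GMinus n) (u : solutionSpace a b j) =>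
    exists_isDressing ha hb g u.1 u.2
  let act : MulAction (GMinus n) (solutionSpace a b j) :=
    { smul := fun g u => ⟨d g u, (hd g u).1⟩
      one_smul := fun u => Subtype.ext
        ((hd 1 u).2.unique ha hb u.2 (hd 1 u).1 (isDressing_one ha hb u.2))
      mul_smul := fun g h u => Subtype.ext
        ((hd (g * h) u).2.unique ha hb u.2 (hd (g * h) u).1
          ((hd h u).2.mul (hd g ⟨d h u, (hd h u).1⟩).2)) }
  exact ⟨act, fun g u => (hd g u).2⟩

end Dressing

end UnHierarchy

end

/-! ### The main theorem -/

theorem theorem5p9 {n : ℕ} (a : Fin n → ℂ) (ha : ∀ i, (a i).re = 0)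
    (b : UnHierarchy.Mat n) (hb : bᴴ = -b)
    (hab : ∃ p : Polynomial ℂ, b = Polynomial.aeval (Matrix.diagonal a) p)
    (j : ℕ) (hj : 1 ≤ j) :
    (∀ u ∈ UnHierarchy.solutionSpace a b j, ∃! E : ℝ → ℝ → ℂ → UnHierarchy.Mat n,
      UnHierarchy.IsTrivialization a b j u E) ∧
    ∃ act : MulAction (UnHierarchy.GMinus n) (UnHierarchy.solutionSpace a b j),
      ∀ (g : UnHierarchy.GMinus n) (u : UnHierarchy.solutionSpace a b j)
        (E : ℝ → ℝ → ℂ → UnHierarchy.Mat n), UnHierarchy.IsTrivialization a b j u.1 E →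
        ∃ (E' : ℝ → ℝ → ℂ → UnHierarchy.Mat n) (g' : ℝ → ℝ → UnHierarchy.GMinus n),
          (∀ x t, UnHierarchy.IsFactorization g (E x t) (E' x t) (g' x t)) ∧
          (∀ x t (f : ℂ → UnHierarchy.Mat n) (h : UnHierarchy.GMinus n),
            UnHierarchy.IsFactorization g (E x t) f h → f = E' x t ∧ h = g' x t) ∧
          (∀ l, E' 0 0 l = 1) ∧
          (∀ x t l, UnHierarchy.HasMatDerivAt (fun y => E' y t l)
            (E' x t l * (l • Matrix.diagonal a + (act.smul g u).1 x t)) x) ∧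
          UnHierarchy.IsTrivialization a b j (act.smul g u).1 E' := by
  obtain ⟨p, hp⟩ := hab
  have hs := UnHierarchy.isSpectral_aeval (a := a) hb hp
  refine ⟨fun u hu => ?_, ?_⟩
  · obtain ⟨E, hE, -⟩ := UnHierarchy.IsSolution.exists_trivialization ha hs hu
    exact ⟨E, hE, fun E' hE' => hE.unique ha hs hu hE'⟩
  · obtain ⟨act, hact⟩ := UnHierarchy.exists_mulAction_isDressing ha hs j
    refine ⟨act, fun g u E hE => ?_⟩
    obtain ⟨E', g', hE', hf⟩ := hact g u E hE
    exact ⟨E', g', hf, fun x t f h hfh => hfh.unique (hf x t), hE'.base, hE'.deriv_x, hE'⟩
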